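/- Let $G$ be a finitely generated virtually abelian group. A \emph{virtually abelian group description} of $G$ consists of: an ordered basis $b_1,\dots,b_n$ of a finite-index free abelian normal subgroup $A$ of $G$; a finite transversal $T=\{t_1,\dots,t_d\}$ of $A$ in $G$; a finite presentation of $G/A$; and, writing $B=\{b_1,\dots,b_n\}$, the function $f$ that sends each pair of symbols of $(B\cup T)^{\pm1}$ to the subgroup-transversal normal form $b_1^{z_1}\cdots b_n^{z_n}t_j$ ($z_i\in\mathbb Z$) of their product. Let $\Sigma=\{\sigma_1,\dots,\sigma_k\}$ be a finite set that generates $G$ as a monoid, with every $\sigma_i$ given in subgroup-transversal normal form, and let $\omega\colon\Sigma\to\mathbb N\setminus\{0\}$ be a weight function; the weight $\omega(u)$ of a word $u\in\Sigma^*$ is the sum of the weights of its letters. A word is \emph{geodesic} if it has minimal weight among all words in $\Sigma^*$ that represent the same element of $G$. A \emph{geodesic normal form} is a set $\mathcal U\subset\Sigma^*$ of geodesic words that contains exactly one representative of every element of $G$. Let $S$ be the set of elements of $G$ that are products of at least one and at most $[G:A]$ elements of $\Sigma$. Write $S\cap A=\{x_1,\dots,x_r\}$ and $S\setminus A=\{y_1,\dots,y_s\}$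 (without repetition), and fix for each $x_i$ and each $y_i$ a word over $\Sigma$ of length between $1$ and $[G:A]$ that represents it. A \emph{pattern} is a word $\pi=\pi_1\cdots\pi_l$ of length $l\le[G:A]$ in the letters $y_1,\dots,y_s$; put $m(\pi)=(l+1)r$. For $w\in\mathbb N^{m(\pi)}$ let $\pi[w]\in\Sigma^*$ be the word obtained from $$x_1^{w_1}\cdots x_r^{w_r}\,\pi_1\,x_1^{w_{r+1}}\cdots x_r^{w_{2r}}\,\pi_2\cdots\pi_l\,x_1^{w_{lr+1}}\cdots x_r^{w_{lr+r}}$$ by replacing every $x_i$ and every $y_i$ by the fixed word over $\Sigma$. \textbf{Theorem.} There is one algorithm (a partial recursive function) that, for every such $G$, takes as input a virtually abelian group description of $G$, the generators in $\Sigma$ in subgroup-transversal normal form and their weights $\omega$, terminates, and outputs (a) words over $\Sigma$ representing $x_1,\dots,x_r$ and $y_1,\dots,y_s$ as above; (b) finitely many pairwise distinct patterns $\pi^{(1)},\dots,\pi^{(N)}$; (c) for each $j$, with $m_j=m(\pi^{(j)})$, elements $a_1,\dots,a_q\in\mathbb N^{m_j}$ and finite subsets $B_1,\dots,B_q\subset\mathbb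 N^{m_j}$ (with $q$ depending on $j$), and numbers $c_1,\dots,c_{m_j},c_0\in\mathbb N$, such that the following holds. There is a geodesic normal form $\mathcal U\subset\Sigma^*$ and a partition $\mathcal U=U_1\sqcup\dots\sqcup U_N$ into non-empty sets, each equipped with an injective map $\phi_j\colon U_j\to\mathbb N^{m_j}$, such that for every $j$: $u=\pi^{(j)}[\phi_j(u)]$ for all $u\in U_j$; the image is the semilinear set $\phi_j(U_j)=\bigcup_{i=1}^q(a_i+B_i^*)$, where $B_i^*$ is the submonoid of $\mathbb N^{m_j}$ generated by $B_i$; and $\omega(u)=c_0+\sum_{i=1}^{m_j}c_i\,\phi_j(u)_i$ for all $u\in U_j$. -/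

import Mathlib

open scoped Pointwise

namespace VirtAbelian

/-- A subgroup-transversal normal form `b₁^{z₁} ⋯ bₙ^{zₙ} t_j`, recorded by the exponent vector
`z` and the index `j` of the transversal element. -/
abbrev NormalForm (n d : ℕ) : Type := (Fin n → ℤ) × Fin d

/-- The symbols of `(B ∪ T)^{±1}`: a basis element (`Sum.inl`) or a transversal element
(`Sum.inr`), with a sign; `true` is the generator itself and `false` is its inverse. -/
abbrev Symbol (n d : ℕ) : Type := (Fin n ⊕ Fin d) × Bool

/-- The set of relators of a finite presentation given by finitely many words. -/
def relatorSet {p : ℕ} (rels : List (List (Fin p × Bool))) : Set (FreeGroup (Fin p)) :=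
  {g | ∃ w ∈ rels, FreeGroup.mk w = g}

/-- The element of `G` written `b₁^{z₁} ⋯ bₙ^{zₙ} t_j`. -/
def nfValue {G : Type*} [Group G] {n d : ℕ} (b : Fin n → G) (t : Fin d → G)
    (c : NormalForm n d) : G :=
  (List.ofFn fun i => b i ^ c.1 i).prod * t c.2

/-- The element of `G` denoted by a symbol of `(B ∪ T)^{±1}`. -/
def symbolValue {G : Type*} [Group G] {n d : ℕ} (b : Fin n → G) (t : Fin d → G)
    (g : Symbol n d) : G :=
  let v := Sum.elim b t g.1
  if g.2 then v else v⁻¹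

/-- A virtually abelian group description for `G`. -/
structure Description (G : Type*) [Group G] where
  /-- the finite-index free abelian normal subgroup -/
  A : Subgroup G
  normal : A.Normal
  /-- the rank of `A` -/
  rank : ℕ
  /-- the ordered basis `b₁, …, bₙ` of `A` -/
  b : Fin rank → G
  b_commute : ∀ i j, Commute (b i) (b j)
  b_generate : Subgroup.closure (Set.range b) = A
  b_independent : ∀ z : Fin rank → ℤ, (List.ofFn fun i => b i ^ z i).prod = 1 → z = 0
  /-- the number of transversal elements -/
  numT : ℕ
  /-- the transversal of `A` in `G` -/
  t : Fin numT → G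
  t_transversal : Function.Bijective fun j => (QuotientGroup.mk (t j) : G ⧸ A)
  /-- the number of generators in the presentation of `G ⧸ A` -/
  numGen : ℕ
  /-- the relators in the presentation of `G ⧸ A` -/
  rels : List (List (Fin numGen × Bool))
  presentation : Nonempty (PresentedGroup (relatorSet rels) ≃* G ⧸ A)
  /-- the function that collects the product of two symbols into its normal form -/
  f : Symbol rank numT → Symbol rank numT → NormalForm rank numT
  f_spec : ∀ g h, nfValue b t (f g h) = symbolValue b t g * symbolValue b t h

/-! ### Encoding of the input of the algorithm -/

/-- Code of a normal form. -/
abbrev NFCode : Type := List ℤ × ℕ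

/-- Code of a description: rank, size of the transversal, presentation of the quotient
(number of generators and relators), and multiplication table. -/
abbrev DescriptionCode : Type :=
  (ℕ × ℕ) × (ℕ × List (List (ℕ × Bool))) × List (List NFCode)

/-- Code of an input: a description, the generators in normal form, and their weights. -/
abbrev InputCode : Type := DescriptionCode × List NFCode × List ℕ

def nfCode {n d : ℕ} (c : NormalForm n d) : NFCode := (List.ofFn c.1, (c.2 : ℕ))

/-- All symbols of `(B ∪ T)^{±1}`, in the order
`b₁, …, bₙ, t₁, …, t_d, b₁⁻¹, …, bₙ⁻¹, t₁⁻¹, …, t_d⁻¹`. -/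
def symbolList (n d : ℕ) : List (Symbol n d) :=
  (List.ofFn fun i => (Sum.inl i, true)) ++ (List.ofFn fun j => (Sum.inr j, true)) ++
  (List.ofFn fun i => (Sum.inl i, false)) ++ (List.ofFn fun j => (Sum.inr j, false))

def Description.code {G : Type*} [Group G] (D : Description G) : DescriptionCode :=
  ((D.rank, D.numT),
   (D.numGen, D.rels.map fun w => w.map fun l => ((l.1 : ℕ), l.2)),
   (symbolList D.rank D.numT).map fun g =>
     (symbolList D.rank D.numT).map fun h => nfCode (D.f g h))

def Description.inputCode {G : Type*} [Group G] (D : Description G) {k : ℕ}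
    (gen : Fin k → NormalForm D.rank D.numT) (ω : Fin k → ℕ) : InputCode :=
  (D.code, List.ofFn fun i => nfCode (gen i), List.ofFn ω)

/-! ### Words, weights, geodesics -/

/-- The element of `G` represented by a word over the generators `σ₁, …, σₖ`. -/
def wordValue {G : Type*} [Group G] {k : ℕ} (σ : Fin k → G) (w : List (Fin k)) : G :=
  (w.map σ).prod

def wordWeight {k : ℕ} (ω : Fin k → ℕ) (w : List (Fin k)) : ℕ := (w.map ω).sum

/-- A word is geodesic if it has minimal weight among all words for the same element. -/
def IsGeodesic {G : Type*} [Group G] {k : ℕ} (σ : Fin k → G) (ω : Fin k → ℕ)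
    (u : List (Fin k)) : Prop :=
  ∀ v : List (Fin k), wordValue σ v = wordValue σ u → wordWeight ω u ≤ wordWeight ω v

/-- A geodesic normal form: one geodesic representative for every element. -/
def IsGeodesicNormalForm {G : Type*} [Group G] {k : ℕ} (σ : Fin k → G) (ω : Fin k → ℕ)
    (μ : G → List (Fin k)) : Prop :=
  ∀ g, wordValue σ (μ g) = g ∧ IsGeodesic σ ω (μ g)

/-- The words of positive length at most `[G : A]`. -/
def shortWords {G : Type*} [Group G] (A : Subgroup G) (k : ℕ) : Set (List (Fin k)) :=
  {w | 1 ≤ w.length ∧ w.length ≤ A.index}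

/-- The extended generating set `S`: all products of at least one and at most `[G : A]`
generators. -/
def extendedGenSet {G : Type*} [Group G] (A : Subgroup G) {k : ℕ} (σ : Fin k → G) : Set G :=
  wordValue σ '' shortWords A k

/-! ### Patterned words -/

/-- The word `x₁^{w₁} ⋯ x_r^{w_r}`. -/
def powerBlock {k r : ℕ} (x : Fin r → List (Fin k)) (w : Fin r → ℕ) : List (Fin k) :=
  (List.ofFn fun i => (List.replicate (w i) (x i)).flatten).flatten

/-- The number `m(π) = (|π| + 1) r` of exponents in a word with pattern `π`. -/
abbrev patternDim (r : ℕ) {s : ℕ} (π : List (Fin s)) : ℕ := (π.length + 1) * r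

/-- The word
`x₁^{w₁} ⋯ x_r^{w_r} π₁ x₁^{w_{r+1}} ⋯ x_r^{w_{2r}} π₂ ⋯ π_l x₁^{w_{lr+1}} ⋯ x_r^{w_{lr+r}}`,
where `π₁, …, π_l` are taken from the list of words `y`. Note that `finProdFinEquiv (l, i)` is
`l * r + i`. -/
def patternedWord {k r s : ℕ} (x : Fin r → List (Fin k)) (y : Fin s → List (Fin k))
    (π : List (Fin s)) (w : Fin (patternDim r π) → ℕ) : List (Fin k) :=
  powerBlock x (fun i => w (finProdFinEquiv (0, i))) ++
    (List.ofFn fun l : Fin π.length =>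
      y (π.get l) ++ powerBlock x (fun i => w (finProdFinEquiv (l.succ, i)))).flatten

/-! ### Semilinear expressions -/

/-- An expression `(a₁, B₁), …, (a_q, B_q)` for a semilinear subset of `ℕ^m`. -/
abbrev SemilinearExpr (m : ℕ) : Type := List ((Fin m → ℕ) × List (Fin m → ℕ))

/-- The semilinear set `⋃ i, (a_i + B_i^*)`. -/
def SemilinearExpr.toSet {m : ℕ} (E : SemilinearExpr m) : Set (Fin m → ℕ) :=
  ⋃ p ∈ E, p.1 +ᵥ (AddSubmonoid.closure {v | v ∈ p.2} : Set (Fin m → ℕ))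

theorem SemilinearExpr.isSemilinearSet_toSet {m : ℕ} (E : SemilinearExpr m) :
    IsSemilinearSet E.toSet := by
  refine IsSemilinearSet.biUnion (List.finite_toSet E) fun p _ => ?_
  exact IsLinearSet.isSemilinearSet ⟨p.1, _, List.finite_toSet p.2, rfl⟩

/-! ### The output of the algorithm -/

/-- The finite data describing one class: its pattern, a semilinear expression for the image
of the class in `ℕ^m`, and the coefficients of an affine function on `ℕ^m`. -/
structure ClassData (r s : ℕ) where
  pattern : List (Fin s)
  image : SemilinearExpr (patternDim r pattern)
  coeff : Fin (patternDim r pattern) → ℕ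
  const : ℕ

/-- The finite data produced by the algorithm: the words `x₁, …, x_r` and `y₁, …, y_s` over
the `k` generators, and the data of the classes. -/
structure OutputData (k : ℕ) where
  r : ℕ
  s : ℕ
  x : Fin r → List (Fin k)
  y : Fin s → List (Fin k)
  numClasses : ℕ
  cls : Fin numClasses → ClassData r s

abbrev ClassCode : Type :=
  List ℕ × List (List ℕ × List (List ℕ)) × List ℕ × ℕ

abbrev OutputCode : Type := (List (List ℕ) × List (List ℕ)) × List ClassCode

def ClassData.code {r s : ℕ} (C : ClassData r s) : ClassCode :=
  (C.pattern.map (fun i => (i : ℕ)),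
   C.image.map (fun p => (List.ofFn p.1, p.2.map List.ofFn)),
   List.ofFn C.coeff, C.const)

def OutputData.code {k : ℕ} (O : OutputData k) : OutputCode :=
  ((List.ofFn fun i => (O.x i).map (fun a => (a : ℕ)),
    List.ofFn fun i => (O.y i).map (fun a => (a : ℕ))),
   List.ofFn fun j => (O.cls j).code)

end VirtAbelian

/-! The algorithm is an unbounded search. It enumerates pairs of a candidate output and a
certificate, and stops at the first pair accepted by a primitive recursive check. It therefore
suffices that acceptance by some certificate is equivalent to a correctness condition on outputs
(`check_iff`), that some output meets this condition (`exists_goodWords`, `exists_goodClasses`), and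
that the condition yields the required normal form (`exists_geodesicNormalForm`).

Why a good output exists. Read a word as a path in the finite group `G ⧸ A`. A loop of length at
most the index represents some `x_i`. Since `A` is abelian and normal, the loop can be moved to any
earlier visit of the same coset, and what remains is a short path written in the `y_j`. Choosing
lightest words for the `x_i` and `y_j`, every word becomes a patterned word of the same value and no
greater weight (`exists_patWord_le`). For a fixed pattern the coset is constant, while the exponents
of the normal form and the weight are affine in the parameters (`exists_affine_patWord`,
`weight_patWord`). Hence having equal values and comparing weights are semilinear relations.
Minimising first the weight, then the code of the pattern, then the parameter vector
lexicographically selects exactly one patterned word per element. The selected parameters of each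
pattern form a semilinear set, because semilinear sets are closed under Boolean operations and
projections.

Why a good output can be recognised. Apart from finitely many decidable conditions, it must be
verified that the listed words dominate all patterned words (`dom`), and that the value of a listed
word determines its class and parameters (`sep`). Both are finite families of statements of the
form: for all natural parameters, one of finitely many systems of linear inequalities is solvable in
natural numbers. Such a statement is certified by a tree of case splits whose leaves carry solutions
affine in the parameters. Certificates are complete (`Goal.Valid.provable`). The solvable parameters
of each system form a semilinear set, described by affine inequalities, equations and congruences,
and splits settle each of these on every leaf. On a leaf where one system is always solvable,
Dickson's lemma supplies recession directions, which give an affine solution after further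
congruence splits.

Domination and separation never mention geodesics but imply them: the listed word that dominates an
arbitrary word must be the unique listed word of the same value. -/

/-! ### Primitive recursive functions: a calculus for `fun_prop` -/

namespace VirtAbelian

section Primrec

variable {α β γ δ : Type*} [Primcodable α] [Primcodable β] [Primcodable γ] [Primcodable δ]

attribute [fun_prop] Primrec

namespace Prim

@[fun_prop] theorem id' : Primrec fun x : α => x := Primrec.id

@[fun_prop] theorem const' (c : β) : Primrec fun _ : α => c := Primrec.const c

@[fun_prop] theorem comp' {f : β → γ} {g : α → β} (hf : Primrec f) (hg : Primrec g) :
    Primrec fun x => f (g x) := hf.comp hg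

@[fun_prop] theorem mk {f : α → β} {g : α → γ} (hf : Primrec f) (hg : Primrec g) :
    Primrec fun x => (f x, g x) := hf.pair hg

@[fun_prop] theorem fst {f : α → β × γ} (hf : Primrec f) : Primrec fun x => (f x).1 :=
  Primrec.fst.comp hf

@[fun_prop] theorem snd {f : α → β × γ} (hf : Primrec f) : Primrec fun x => (f x).2 :=
  Primrec.snd.comp hf

/-! #### Lists -/

@[fun_prop] theorem map {f : α → List β} {g : α → β → γ} (hf : Primrec f)
    (hg : Primrec fun p : α × β => g p.1 p.2) : Primrec fun x => (f x).map (g x) :=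
  Primrec.list_map hf hg

@[fun_prop] theorem flatMap {f : α → List β} {g : α → β → List γ} (hf : Primrec f)
    (hg : Primrec fun p : α × β => g p.1 p.2) : Primrec fun x => (f x).flatMap (g x) :=
  Primrec.list_flatMap hf hg

@[fun_prop] theorem foldr {f : α → List β} {g : α → γ} {h : α → β → γ → γ} (hf : Primrec f)
    (hg : Primrec g) (hh : Primrec fun p : α × β × γ => h p.1 p.2.1 p.2.2) :
    Primrec fun x => (f x).foldr (h x) (g x) :=
  Primrec.list_foldr (h := fun x p => h x p.1 p.2) hf hg hh

@[fun_prop] theorem foldl {f : α → List β} {g : α → γ} {h : α → γ → β → γ} (hf : Primrec f)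
    (hg : Primrec g) (hh : Primrec fun p : α × γ × β => h p.1 p.2.1 p.2.2) :
    Primrec fun x => (f x).foldl (h x) (g x) :=
  Primrec.list_foldl (h := fun x p => h x p.1 p.2) hf hg hh

@[fun_prop] theorem getD (d : β) {f : α → List β} {g : α → ℕ} (hf : Primrec f)
    (hg : Primrec g) : Primrec fun x => (f x).getD (g x) d := (Primrec.list_getD d).comp hf hg

@[fun_prop] theorem length {f : α → List β} (hf : Primrec f) :
    Primrec fun x => (f x).length := Primrec.list_length.comp hf

@[fun_prop] theorem range {f : α → ℕ} (hf : Primrec f) :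
    Primrec fun x => List.range (f x) := Primrec.list_range.comp hf

@[fun_prop] theorem append {f g : α → List β} (hf : Primrec f) (hg : Primrec g) :
    Primrec fun x => f x ++ g x := Primrec.list_append.comp hf hg

@[fun_prop] theorem cons {f : α → β} {g : α → List β} (hf : Primrec f) (hg : Primrec g) :
    Primrec fun x => f x :: g x := Primrec.list_cons.comp hf hg

@[fun_prop] theorem flatten {f : α → List (List β)} (hf : Primrec f) :
    Primrec fun x => (f x).flatten := Primrec.list_flatten.comp hf

@[fun_prop] theorem tail {f : α → List β} (hf : Primrec f) :
    Primrec fun x => (f x).tail := Primrec.list_tail.comp hf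

@[fun_prop] theorem replicate {f : α → ℕ} {g : α → β} (hf : Primrec f) (hg : Primrec g) :
    Primrec fun x => List.replicate (f x) (g x) := by
  have h : Primrec fun x => (List.range (f x)).map fun _ => g x := by fun_prop
  exact h.of_eq fun x => by simp

@[fun_prop] theorem nat_rec {f : α → ℕ} {g : α → γ} {h : α → ℕ → γ → γ} (hf : Primrec f)
    (hg : Primrec g) (hh : Primrec fun p : α × ℕ × γ => h p.1 p.2.1 p.2.2) :
    Primrec fun x => Nat.rec (motive := fun _ => γ) (g x) (h x) (f x) :=
  Primrec.nat_rec' (h := fun x p => h x p.1 p.2) hf hg hh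

/-! #### Booleans -/

@[fun_prop] theorem and {f g : α → Bool} (hf : Primrec f) (hg : Primrec g) :
    Primrec fun x => f x && g x := Primrec.and.comp hf hg

@[fun_prop] theorem or {f g : α → Bool} (hf : Primrec f) (hg : Primrec g) :
    Primrec fun x => f x || g x := Primrec.or.comp hf hg

@[fun_prop] theorem not {f : α → Bool} (hf : Primrec f) :
    Primrec fun x => !f x := Primrec.not.comp hf

@[fun_prop] theorem cond {c : α → Bool} {f g : α → β} (hc : Primrec c) (hf : Primrec f)
    (hg : Primrec g) : Primrec fun x => cond (c x) (f x) (g x) := Primrec.cond hc hf hg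

@[fun_prop] theorem beq [DecidableEq β] {f g : α → β} (hf : Primrec f) (hg : Primrec g) :
    Primrec fun x => f x == g x := Primrec.beq.comp hf hg

@[fun_prop] theorem all {f : α → List β} {g : α → β → Bool} (hf : Primrec f)
    (hg : Primrec fun p : α × β => g p.1 p.2) : Primrec fun x => (f x).all (g x) := by
  have h : Primrec fun x => (f x).foldr (fun b s => g x b && s) true := by fun_prop
  exact h.of_eq fun x => by induction f x <;> simp_all

@[fun_prop] theorem any {f : α → List β} {g : α → β → Bool} (hf : Primrec f)
    (hg : Primrec fun p : α × β => g p.1 p.2) : Primrec fun x => (f x).any (g x) := by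
  have h : Primrec fun x => (f x).foldr (fun b s => g x b || s) false := by fun_prop
  exact h.of_eq fun x => by induction f x <;> simp_all

/-! #### Natural numbers -/

@[fun_prop] theorem nat_add {f g : α → ℕ} (hf : Primrec f) (hg : Primrec g) :
    Primrec fun x => f x + g x := Primrec.nat_add.comp hf hg

@[fun_prop] theorem nat_sub {f g : α → ℕ} (hf : Primrec f) (hg : Primrec g) :
    Primrec fun x => f x - g x := Primrec.nat_sub.comp hf hg

@[fun_prop] theorem nat_mul {f g : α → ℕ} (hf : Primrec f) (hg : Primrec g) :
    Primrec fun x => f x * g x := Primrec.nat_mul.comp hf hg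

@[fun_prop] theorem nat_div {f g : α → ℕ} (hf : Primrec f) (hg : Primrec g) :
    Primrec fun x => f x / g x := Primrec.nat_div.comp hf hg

@[fun_prop] theorem nat_mod {f g : α → ℕ} (hf : Primrec f) (hg : Primrec g) :
    Primrec fun x => f x % g x := Primrec.nat_mod.comp hf hg

@[fun_prop] theorem nat_le {f g : α → ℕ} (hf : Primrec f) (hg : Primrec g) :
    Primrec fun x => decide (f x ≤ g x) := Primrec.nat_le.decide.comp hf hg

@[fun_prop] theorem nat_lt {f g : α → ℕ} (hf : Primrec f) (hg : Primrec g) :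
    Primrec fun x => decide (f x < g x) := Primrec.nat_lt.decide.comp hf hg

@[fun_prop] theorem nat_sum {f : α → List ℕ} (hf : Primrec f) : Primrec fun x => (f x).sum := by
  have h : Primrec fun x => (f x).foldr (fun b s => b + s) 0 := by fun_prop
  exact h

/-! #### Integers -/

/-- Nonnegative integers have even codes and negative ones odd codes. Parity and halving thus
recover the positive and negative parts, to which all integer arithmetic below is reduced. -/
theorem encode_int (z : ℤ) :
    Encodable.encode z = bif decide (0 ≤ z) then 2 * z.toNat else 2 * (-z).toNat - 1 := by
  cases z with
  | ofNat n => rfl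
  | negSucc n => exact (by omega : 2 * n + 1 = 2 * (n + 1) - 1)

@[fun_prop] theorem int_encode {f : α → ℤ} (hf : Primrec f) :
    Primrec fun x => Encodable.encode (f x) := Primrec.encode.comp hf

theorem int_toNat : Primrec Int.toNat := by
  have h : Primrec fun z : ℤ =>
      bif Encodable.encode z % 2 == 0 then Encodable.encode z / 2 else 0 := by fun_prop
  refine h.of_eq fun z => ?_
  rw [encode_int]
  rcases le_or_gt 0 z with hz | hz
  · simp [hz]
  · have h1 : (2 * (-z).toNat - 1) % 2 = 1 := by omega
    have h2 : z.toNat = 0 := by omega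
    have h0 : decide (0 ≤ z) = false := by simpa using hz
    simp [h0, h1, h2]

theorem int_negToNat : Primrec fun z : ℤ => (-z).toNat := by
  have h : Primrec fun z : ℤ =>
      bif Encodable.encode z % 2 == 0 then 0 else Encodable.encode z / 2 + 1 := by fun_prop
  refine h.of_eq fun z => ?_
  rw [encode_int]
  rcases le_or_gt 0 z with hz | hz
  · have h2 : (-z).toNat = 0 := by omega
    simp [hz, h2]
  · have h1 : (2 * (-z).toNat - 1) % 2 = 1 := by omega
    have h2 : (2 * (-z).toNat - 1) / 2 + 1 = (-z).toNat := by omega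
    have h0 : decide (0 ≤ z) = false := by simpa using hz
    simp [h0, h1, h2]

/-- The way back from the two parts to the integer: a function into `ℤ` is primitive recursive as
soon as its code is. -/
theorem int_subNat : Primrec fun p : ℕ × ℕ => (p.1 : ℤ) - p.2 := by
  have h : Primrec fun p : ℕ × ℕ =>
      bif decide (p.2 ≤ p.1) then 2 * (p.1 - p.2) else 2 * (p.2 - p.1) - 1 := by fun_prop
  refine Primrec.encode_iff.1 (h.of_eq fun p => ?_)
  rw [encode_int]
  have h1 : ((p.1 : ℤ) - p.2).toNat = p.1 - p.2 := by omega
  have h2 : (-((p.1 : ℤ) - p.2)).toNat = p.2 - p.1 := by omega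
  have h3 : decide (0 ≤ (p.1 : ℤ) - p.2) = decide (p.2 ≤ p.1) := by
    rw [decide_eq_decide]; omega
  rw [h1, h2, h3]

theorem int_ofParts {f g : α → ℕ} (hf : Primrec f) (hg : Primrec g) :
    Primrec fun x => (f x : ℤ) - g x := int_subNat.comp (hf.pair hg)

@[fun_prop] theorem int_natCast {f : α → ℕ} (hf : Primrec f) : Primrec fun x => (f x : ℤ) :=
  (int_ofParts hf (Primrec.const 0)).of_eq fun x => by simp

@[fun_prop] theorem toNat {f : α → ℤ} (hf : Primrec f) : Primrec fun x => (f x).toNat :=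
  int_toNat.comp hf

theorem negToNat {f : α → ℤ} (hf : Primrec f) : Primrec fun x => (-(f x)).toNat :=
  int_negToNat.comp hf

@[fun_prop] theorem int_neg {f : α → ℤ} (hf : Primrec f) : Primrec fun x => -(f x) :=
  (int_ofParts (negToNat hf) (toNat hf)).of_eq fun x => by omega

@[fun_prop] theorem int_add {f g : α → ℤ} (hf : Primrec f) (hg : Primrec g) :
    Primrec fun x => f x + g x :=
  (int_ofParts (nat_add (toNat hf) (toNat hg)) (nat_add (negToNat hf) (negToNat hg))).of_eq
    fun x => by push_cast; omega

@[fun_prop] theorem int_sub {f g : α → ℤ} (hf : Primrec f) (hg : Primrec g) :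
    Primrec fun x => f x - g x :=
  (int_add hf (int_neg hg)).of_eq fun _ => (sub_eq_add_neg _ _).symm

@[fun_prop] theorem int_mul {f g : α → ℤ} (hf : Primrec f) (hg : Primrec g) :
    Primrec fun x => f x * g x :=
  (int_ofParts (nat_add (nat_mul (toNat hf) (toNat hg)) (nat_mul (negToNat hf) (negToNat hg)))
    (nat_add (nat_mul (toNat hf) (negToNat hg)) (nat_mul (negToNat hf) (toNat hg)))).of_eq
    fun x => by
      have key : ∀ a b : ℤ, ((a.toNat * b.toNat + (-a).toNat * (-b).toNat : ℕ) : ℤ) -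
          ((a.toNat * (-b).toNat + (-a).toNat * b.toNat : ℕ) : ℤ) = a * b := by
        intro a b
        have h1 : ((a.toNat : ℤ) - ((-a).toNat : ℤ)) = a := by omega
        have h2 : ((b.toNat : ℤ) - ((-b).toNat : ℤ)) = b := by omega
        push_cast
        calc _ = ((a.toNat : ℤ) - ((-a).toNat : ℤ)) * ((b.toNat : ℤ) - ((-b).toNat : ℤ)) := by
              ring
          _ = _ := by rw [h1, h2]
      exact key _ _

@[fun_prop] theorem int_nonneg {f : α → ℤ} (hf : Primrec f) :
    Primrec fun x => decide (0 ≤ f x) := by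
  have h : Primrec fun x => (-(f x)).toNat == 0 := by
    have := negToNat hf
    fun_prop
  refine h.of_eq fun x => ?_
  rw [beq_eq_decide, decide_eq_decide]
  omega

@[fun_prop] theorem int_sum {f : α → List ℤ} (hf : Primrec f) : Primrec fun x => (f x).sum := by
  have h : Primrec fun x => (f x).foldr (fun b s => b + s) 0 := by fun_prop
  exact h

end Prim

end Primrec

end VirtAbelian

/-! ### Certificates for `∀ ∃` statements about linear inequalities -/

namespace VirtAbelian

/-- An affine inequality `u · x + v · z + c ≥ 0`, given as `(u, v, c)`. -/
abbrev Constr : Type := List ℤ × List ℤ × ℤ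

/-- A disjunction of conjunctions of inequalities. -/
abbrev Goal : Type := List (List Constr)

/-- Missing coefficients count as `0` and the argument is an infinite sequence, so forms in
different numbers of variables can be combined freely. -/
def dot (u : List ℤ) (x : ℕ → ℕ) : ℤ := ∑ i ∈ Finset.range u.length, u.getD i 0 * x i

theorem dot_eq {u : List ℤ} {N : ℕ} (h : u.length ≤ N) (x : ℕ → ℕ) :
    dot u x = ∑ i ∈ Finset.range N, u.getD i 0 * x i := by
  refine Finset.sum_subset (by simpa using h) fun i _ hi => ?_
  rw [List.getD_eq_default _ _ (by simpa using hi), zero_mul]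

def Constr.val (κ : Constr) (x z : ℕ → ℕ) : ℤ := dot κ.1 x + dot κ.2.1 z + κ.2.2

/-- For all `x` there is `z` that satisfies one of the systems of inequalities. -/
def Goal.Valid (G : Goal) : Prop :=
  ∀ x : ℕ → ℕ, ∃ D ∈ G, ∃ z : ℕ → ℕ, ∀ κ ∈ D, 0 ≤ Constr.val κ x z

/-! ### Substitutions and case splits -/

/-- The substitution `x_i := a x_i + b x_j + c`. -/
def subst (i j a b c : ℕ) (x : ℕ → ℕ) : ℕ → ℕ := Function.update x i (a * x i + b * x j + c)

/-- Only the coefficients at `i` and `j` and the constant change. The two corrections add up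
correctly when `i = j`. The length leaves room for index `j`; if `i` lies beyond it, its coefficient
is `0` and nothing is lost. -/
def Constr.subst (i j a b c : ℕ) (κ : Constr) : Constr :=
  ((List.range (κ.1.length + j + 1)).map fun l =>
      (bif l == i then (a : ℤ) * κ.1.getD i 0 else κ.1.getD l 0) +
        (bif l == j then (b : ℤ) * κ.1.getD i 0 else 0),
    κ.2.1, κ.2.2 + (c : ℤ) * κ.1.getD i 0)

theorem getD_map_range (f : ℕ → ℤ) (n i : ℕ) :
    ((List.range n).map f).getD i 0 = if i < n then f i else 0 := by
  rw [List.getD_eq_getElem?_getD]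
  split_ifs with h
  · simp [h]
  · simp [h]

theorem Constr.val_subst (i j a b c : ℕ) (κ : Constr) (x z : ℕ → ℕ) :
    Constr.val (Constr.subst i j a b c κ) x z = Constr.val κ (VirtAbelian.subst i j a b c x) z := by
  obtain ⟨u, v, d⟩ := κ
  simp only [Constr.val, Constr.subst]
  set N := u.length + i + j + 1 with hN
  rw [dot_eq (N := N) (by simp; omega), dot_eq (u := u) (N := N) (by omega)]
  have hu : ∀ l, ¬ l < u.length + j + 1 → u.getD l 0 = 0 := fun l hl =>
    List.getD_eq_default _ _ (by omega)
  -- Both sides are the original sum plus corrections supported at `i` and `j`, which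
  -- `Finset.sum_ite_eq'` then evaluates.
  have h1 : ∀ l ∈ Finset.range N,
      ((List.range (u.length + j + 1)).map fun l =>
        (bif l == i then (a : ℤ) * u.getD i 0 else u.getD l 0) +
          (bif l == j then (b : ℤ) * u.getD i 0 else 0)).getD l 0 * (x l : ℤ) =
      u.getD l 0 * x l + (if l = i then u.getD i 0 * (a * x i - x i) else 0) +
        (if l = j then b * u.getD i 0 * x j else 0) := by
    intro l _
    rw [getD_map_range]
    simp only [cond_eq_ite, beq_iff_eq]
    by_cases h : l < u.length + j + 1
    · rw [if_pos h]
      split_ifs with h' h'' h''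
      · subst h'; subst h''; ring
      · subst h'; ring
      · subst h''; ring
      · ring
    · rw [if_neg h, hu _ h, if_neg (show ¬ l = j by omega)]
      split_ifs with h'
      · subst h'; rw [hu _ h]; ring
      · simp
  have h2 : ∀ l ∈ Finset.range N, u.getD l 0 * ((VirtAbelian.subst i j a b c x l : ℕ) : ℤ) =
      u.getD l 0 * x l +
        (if l = i then u.getD i 0 * ((a * x i + b * x j + c : ℕ) - x i : ℤ) else 0) := by
    intro l _
    split_ifs with h
    · subst h; simp [VirtAbelian.subst]; ring
    · simp [VirtAbelian.subst, h]
  rw [Finset.sum_congr rfl h1, Finset.sum_congr rfl h2, Finset.sum_add_distrib,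
    Finset.sum_add_distrib, Finset.sum_add_distrib, Finset.sum_ite_eq', Finset.sum_ite_eq',
    if_pos (by simp; omega), if_pos (by simp; omega), Finset.sum_ite_eq', if_pos (by simp; omega)]
  push_cast
  ring

def Goal.subst (i j a b c : ℕ) (G : Goal) : Goal :=
  G.map fun D => D.map (Constr.subst i j a b c)

/-- `Ψ s` for a composite `s` of substitutions corresponds to the goal after that substitution. -/
def Goal.Pull (G : Goal) (s : (ℕ → ℕ) → ℕ → ℕ) (G' : Goal) : Prop :=
  List.Forall₂ (List.Forall₂ fun κ κ' => ∀ x z, Constr.val κ' x z = Constr.val κ (s x) z) G G'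

theorem Goal.Pull.refl (G : Goal) : G.Pull id G :=
  List.forall₂_same.2 fun _ _ => List.forall₂_same.2 fun _ _ _ _ => rfl

theorem Goal.Pull.subst {G G' : Goal} {s : (ℕ → ℕ) → ℕ → ℕ} (h : G.Pull s G')
    (i j a b c : ℕ) : G.Pull (s ∘ VirtAbelian.subst i j a b c) (G'.subst i j a b c) := by
  unfold Goal.Pull Goal.subst
  rw [List.forall₂_map_right_iff]
  refine h.imp fun D D' hD => ?_
  rw [List.forall₂_map_right_iff]
  exact hD.imp fun κ κ' hκ x z => by rw [Constr.val_subst, hκ]; rfl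

/-- Soundness of a case split: the images of the substitutions cover all parameters, and a solution
`z` for a preimage serves for its image. -/
theorem Goal.Valid.of_subst {ι : Type*} {G : Goal} (S : ι → ℕ × ℕ × ℕ × ℕ × ℕ)
    (hS : ∀ x, ∃ k y, x = VirtAbelian.subst (S k).1 (S k).2.1 (S k).2.2.1 (S k).2.2.2.1
      (S k).2.2.2.2 y)
    (h : ∀ k, Goal.Valid (G.subst (S k).1 (S k).2.1 (S k).2.2.1 (S k).2.2.2.1 (S k).2.2.2.2)) :
    G.Valid := by
  intro x
  obtain ⟨k, y, rfl⟩ := hS x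
  obtain ⟨D, hD, z, hz⟩ := h k y
  obtain ⟨D', hD', rfl⟩ := List.mem_map.1 hD
  refine ⟨D', hD', z, fun κ hκ => ?_⟩
  rw [← Constr.val_subst]
  exact hz _ (List.mem_map_of_mem hκ)

theorem Goal.Valid.zero {G : Goal} (i : ℕ) (h₀ : Goal.Valid (G.subst i i 0 0 0))
    (h₁ : Goal.Valid (G.subst i i 1 0 1)) : G.Valid := by
  refine Goal.Valid.of_subst (fun b : Bool => bif b then (i, i, 0, 0, 0) else (i, i, 1, 0, 1))
    (fun x => ?_) fun k => by cases k <;> assumption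
  rcases Nat.eq_zero_or_pos (x i) with hx | hx
  · exact ⟨true, x, by simp [VirtAbelian.subst, hx]⟩
  · refine ⟨false, Function.update x i (x i - 1), ?_⟩
    simp [VirtAbelian.subst, Nat.sub_add_cancel hx]

/-- The hyperplane `x_i = x_j` cuts the orthant into two unimodular cones. On each, the larger
coordinate is the smaller one plus a fresh natural number. -/
theorem Goal.Valid.cone {G : Goal} {i j : ℕ} (hij : i ≠ j)
    (h₀ : Goal.Valid (G.subst i j 1 1 0)) (h₁ : Goal.Valid (G.subst j i 1 1 0)) : G.Valid := by
  refine Goal.Valid.of_subst (fun b : Bool => bif b then (i, j, 1, 1, 0) else (j, i, 1, 1, 0))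
    (fun x => ?_) fun k => by cases k <;> assumption
  rcases le_total (x j) (x i) with hx | hx
  · refine ⟨true, Function.update x i (x i - x j), ?_⟩
    simp [VirtAbelian.subst, hij.symm, Nat.sub_add_cancel hx]
  · refine ⟨false, Function.update x j (x j - x i), ?_⟩
    simp [VirtAbelian.subst, hij, Nat.sub_add_cancel hx]

theorem Goal.Valid.mod {G : Goal} (i : ℕ) {m : ℕ} (hm : 0 < m)
    (h : ∀ ρ < m, Goal.Valid (G.subst i i m 0 ρ)) : G.Valid := by
  refine Goal.Valid.of_subst (fun ρ : Fin m => (i, i, m, 0, ρ.1)) (fun x => ?_)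
    fun k => h k k.2
  refine ⟨⟨x i % m, Nat.mod_lt _ hm⟩, Function.update x i (x i / m), ?_⟩
  simp [VirtAbelian.subst, Nat.div_add_mod]

/-! ### Leaves with affine solutions -/

def listDot (v : List ℤ) (z : List ℕ) : ℤ :=
  ((List.range v.length).map fun l => v.getD l 0 * ((z.getD l 0 : ℕ) : ℤ)).sum

/-- The inequality holds identically for `z = z₀ + ∑ i, x_i z_{i+1}`. -/
def leafCheck (zs : List (List ℕ)) (κ : Constr) : Bool :=
  decide (0 ≤ κ.2.2 + listDot κ.2.1 (zs.getD 0 [])) &&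
    (List.range (κ.1.length + zs.length)).all fun i =>
      decide (0 ≤ κ.1.getD i 0 + listDot κ.2.1 (zs.getD (i + 1) []))

theorem sum_map_range (f : ℕ → ℤ) (n : ℕ) :
    ((List.range n).map f).sum = ∑ i ∈ Finset.range n, f i := by
  induction n with
  | zero => simp
  | succ n ih => rw [List.range_succ, Finset.sum_range_succ]; simp [ih]

theorem leafCheck_iff (zs : List (List ℕ)) (κ : Constr) :
    leafCheck zs κ ↔ 0 ≤ κ.2.2 + dot κ.2.1 (fun l => (zs.getD 0 []).getD l 0) ∧
      ∀ i < κ.1.length + zs.length,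
        0 ≤ κ.1.getD i 0 + dot κ.2.1 (fun l => (zs.getD (i + 1) []).getD l 0) := by
  simp only [leafCheck, listDot, sum_map_range, dot, Bool.and_eq_true, decide_eq_true_eq, List.all_eq_true,
    List.mem_range]

/-- Inserting the affine solution leaves an affine form in `x` alone. The check says that its
constant and all its coefficients are nonnegative, so it is nonnegative on the orthant. -/
theorem Constr.val_of_leafCheck {zs : List (List ℕ)} {κ : Constr} (h : leafCheck zs κ)
    (x : ℕ → ℕ) :
    0 ≤ Constr.val κ x fun l => (zs.getD 0 []).getD l 0 +
      ∑ i ∈ Finset.range zs.length, x i * (zs.getD (i + 1) []).getD l 0 := by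
  obtain ⟨h0, h1⟩ := (leafCheck_iff _ _).1 h
  obtain ⟨u, v, c⟩ := κ
  simp only [Constr.val] at *
  set N := u.length + zs.length
  have hz : ∀ i, ¬ i < zs.length → zs.getD (i + 1) [] = [] := fun i hi =>
    List.getD_eq_default _ _ (by omega)
  have h2 : dot v (fun l => (zs.getD 0 []).getD l 0 +
      ∑ i ∈ Finset.range zs.length, x i * (zs.getD (i + 1) []).getD l 0) =
      dot v (fun l => (zs.getD 0 []).getD l 0) +
      ∑ i ∈ Finset.range N, x i * dot v (fun l => (zs.getD (i + 1) []).getD l 0) := by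
    have h3 : ∀ l, ∑ i ∈ Finset.range zs.length, x i * (zs.getD (i + 1) []).getD l 0 =
        ∑ i ∈ Finset.range N, x i * (zs.getD (i + 1) []).getD l 0 := fun l => by
      refine Finset.sum_subset (by simp [N]) fun i _ hi => ?_
      rw [hz i (by simpa using hi)]; simp
    simp only [h3, dot, Finset.mul_sum]
    rw [Finset.sum_comm, ← Finset.sum_add_distrib]
    refine Finset.sum_congr rfl fun l _ => ?_
    push_cast
    rw [mul_add, Finset.mul_sum]
    congr 1
    exact Finset.sum_congr rfl fun i _ => by ring
  rw [h2, dot_eq (u := u) (N := N) (by simp [N])]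
  have h4 : 0 ≤ ∑ i ∈ Finset.range N,
      (u.getD i 0 + dot v (fun l => (zs.getD (i + 1) []).getD l 0)) * (x i : ℤ) :=
    Finset.sum_nonneg fun i hi => mul_nonneg (h1 i (by simpa using hi)) (by positivity)
  have h5 : ∑ i ∈ Finset.range N,
      (u.getD i 0 + dot v (fun l => (zs.getD (i + 1) []).getD l 0)) * (x i : ℤ) =
      ∑ i ∈ Finset.range N, u.getD i 0 * (x i : ℤ) +
      ∑ i ∈ Finset.range N, x i * dot v (fun l => (zs.getD (i + 1) []).getD l 0) := by
    rw [← Finset.sum_add_distrib]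
    exact Finset.sum_congr rfl fun i _ => by ring
  rw [h5] at h4
  linarith

/-! ### Derivations and the certificate machine -/

/-- Derivations of goals by case splits. -/
inductive Goal.Provable : Goal → Prop
  | leaf {G : Goal} (zs : List (List ℕ)) {D : List Constr} (hD : D ∈ G)
      (h : ∀ κ ∈ D, leafCheck zs κ) : Provable G
  | zero {G : Goal} (i : ℕ) (h₀ : Provable (G.subst i i 0 0 0))
      (h₁ : Provable (G.subst i i 1 0 1)) : Provable G
  | cone {G : Goal} {i j : ℕ} (hij : i ≠ j) (h₀ : Provable (G.subst i j 1 1 0))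
      (h₁ : Provable (G.subst j i 1 1 0)) : Provable G
  | mod {G : Goal} (i : ℕ) {m : ℕ} (hm : 0 < m)
      (h : ∀ ρ < m, Provable (G.subst i i m 0 ρ)) : Provable G

/-- An instruction: the kind of a split or a leaf, two numbers, and the witnesses of a leaf. -/
abbrev Instr : Type := ℕ × ℕ × ℕ × List (List ℕ)

/-- The kinds `0`, `1`, `2` are the three splits, anything else is a leaf. A malformed instruction
returns the goal unchanged, so soundness needs no assumption on certificates. -/
def Goal.children (G : Goal) (p : Instr) : List Goal :=
  bif p.1 == 0 then [G.subst p.2.1 p.2.1 0 0 0, G.subst p.2.1 p.2.1 1 0 1]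
  else bif p.1 == 1 then
    bif p.2.1 == p.2.2.1 then [G]
    else [G.subst p.2.1 p.2.2.1 1 1 0, G.subst p.2.2.1 p.2.1 1 1 0]
  else bif p.1 == 2 then
    bif p.2.2.1 == 0 then [G]
    else (List.range p.2.2.1).map fun ρ => G.subst p.2.1 p.2.1 p.2.2.1 0 ρ
  else bif decide (p.2.1 < G.length) && (G.getD p.2.1 []).all (leafCheck p.2.2.2) then [] else [G]

/-- The list of goals is a stack: the top goal is replaced by its children, and an empty stack stays
empty. -/
def execInstr (st : List Goal) (p : Instr) : List Goal :=
  bif st.length == 0 then [] else (st.getD 0 []).children p ++ st.tail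

/-- Run a certificate on a list of goals. -/
def runCert (st : List Goal) (l : List Instr) : List Goal := l.foldl execInstr st

theorem Goal.valid_of_children {G : Goal} (p : Instr) (h : ∀ G' ∈ G.children p, G'.Valid) :
    G.Valid := by
  obtain ⟨t, i, j, zs⟩ := p
  simp only [Goal.children, cond_eq_ite, beq_iff_eq] at h
  rcases t with _ | _ | _ | t
  · exact Goal.Valid.zero i (h _ (by simp)) (h _ (by simp))
  · by_cases hij : i = j
    · exact h G (by simp [hij])
    · exact Goal.Valid.cone hij (h _ (by simp [hij])) (h _ (by simp [hij]))
  · by_cases hj : j = 0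
    · exact h G (by simp [hj])
    · exact Goal.Valid.mod i (Nat.pos_of_ne_zero hj) fun ρ hρ => h _ (by
        simp only [hj]; exact List.mem_map_of_mem (List.mem_range.2 hρ))
  · by_cases hc : (decide (i < G.length) && (G.getD i []).all (leafCheck zs)) = true
    · simp only [Bool.and_eq_true, decide_eq_true_eq, List.all_eq_true] at hc
      refine fun x => ⟨G.getD i [], ?_, _, fun κ hκ => Constr.val_of_leafCheck (hc.2 κ hκ) x⟩
      rw [List.getD_eq_getElem _ _ hc.1]
      exact List.getElem_mem _
    · refine h G ?_
      rw [if_neg (by omega), if_neg (by omega), if_neg (by omega), if_neg hc]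
      simp

theorem valid_of_runCert {st : List Goal} {l : List Instr} (h : runCert st l = []) :
    ∀ G ∈ st, G.Valid := by
  induction l generalizing st with
  | nil =>
    have : st = [] := h
    simp [this]
  | cons p l ih =>
    have h' := ih (st := execInstr st p) h
    cases st with
    | nil => simp
    | cons G st =>
      have e : execInstr (G :: st) p = G.children p ++ st := rfl
      rw [e] at h'
      intro G' hG'
      rcases List.mem_cons.1 hG' with rfl | hG'
      · exact Goal.valid_of_children p fun G'' hG'' => h' _ (List.mem_append_left _ hG'')
      · exact h' _ (List.mem_append_right _ hG')

theorem runCert_append (st : List Goal) (l l' : List Instr) :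
    runCert st (l ++ l') = runCert (runCert st l) l' := List.foldl_append

theorem runCert_cons (G : Goal) (st : List Goal) (p : Instr) (l : List Instr) :
    runCert (G :: st) (p :: l) = runCert (G.children p ++ st) l := rfl

theorem exists_runCert_list {L : List Goal}
    (h : ∀ G ∈ L, ∃ l, ∀ st, runCert (G :: st) l = st) :
    ∃ l, ∀ st, runCert (L ++ st) l = st := by
  induction L with
  | nil => exact ⟨[], fun st => rfl⟩
  | cons G L ih =>
    obtain ⟨l, hl⟩ := h G (by simp)
    obtain ⟨l', hl'⟩ := ih fun G' hG' => h G' (by simp [hG'])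
    exact ⟨l ++ l', fun st => by rw [runCert_append, List.cons_append, hl, hl']⟩

/-- The derivation is written out depth first. Quantifying over the rest `st` of the stack says that
a certificate consumes exactly its own goal, which is what allows certificates of the children to be
concatenated. -/
theorem Goal.Provable.exists_runCert {G : Goal} (h : G.Provable) :
    ∃ l, ∀ st, runCert (G :: st) l = st := by
  have key : ∀ (G : Goal) (p : Instr),
      (∀ G' ∈ G.children p, ∃ l, ∀ st, runCert (G' :: st) l = st) →
      ∃ l, ∀ st, runCert (G :: st) l = st := fun G p h => by
    obtain ⟨l, hl⟩ := exists_runCert_list h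
    exact ⟨p :: l, fun st => by rw [runCert_cons, hl]⟩
  induction h with
  | @leaf G zs D hD h =>
    obtain ⟨i, hi, rfl⟩ := List.getElem_of_mem hD
    refine key G (3, i, 0, zs) ?_
    have : G.children (3, i, 0, zs) = [] := by
      have : (decide (i < G.length) && (G.getD i []).all (leafCheck zs)) = true := by
        rw [List.getD_eq_getElem _ _ hi]
        simpa [hi] using h
      simp only [Goal.children, cond_eq_ite, this]; rfl
    simp [this]
  | @zero G i _ _ ih₀ ih₁ =>
    refine key G (0, i, 0, []) ?_
    simpa [Goal.children] using ⟨ih₀, ih₁⟩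
  | @cone G i j hij _ _ ih₀ ih₁ =>
    refine key G (1, i, j, []) ?_
    simpa [Goal.children, cond_eq_ite, hij] using ⟨ih₀, ih₁⟩
  | @mod G i m hm _ ih =>
    refine key G (2, i, m, []) ?_
    simpa [Goal.children, cond_eq_ite, hm.ne'] using ih

/-! ### The certificate machine is primitive recursive -/

@[fun_prop] theorem primrec_substC {α : Type*} [Primcodable α] {i j a b c : α → ℕ}
    {κ : α → Constr} (hi : Primrec i) (hj : Primrec j) (ha : Primrec a) (hb : Primrec b)
    (hc : Primrec c) (hκ : Primrec κ) :
    Primrec fun x => Constr.subst (i x) (j x) (a x) (b x) (c x) (κ x) := by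
  unfold Constr.subst; fun_prop

@[fun_prop] theorem primrec_substG {α : Type*} [Primcodable α] {i j a b c : α → ℕ}
    {G : α → Goal} (hi : Primrec i) (hj : Primrec j) (ha : Primrec a) (hb : Primrec b)
    (hc : Primrec c) (hG : Primrec G) :
    Primrec fun x => Goal.subst (i x) (j x) (a x) (b x) (c x) (G x) := by
  unfold Goal.subst; fun_prop

@[fun_prop] theorem primrec_leafCheck {α : Type*} [Primcodable α] {zs : α → List (List ℕ)}
    {κ : α → Constr} (hz : Primrec zs) (hκ : Primrec κ) :
    Primrec fun x => leafCheck (zs x) (κ x) := by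
  unfold leafCheck listDot; fun_prop

@[fun_prop] theorem primrec_children {α : Type*} [Primcodable α] {G : α → Goal} {p : α → Instr}
    (hG : Primrec G) (hp : Primrec p) : Primrec fun x => (G x).children (p x) := by
  unfold Goal.children; fun_prop

@[fun_prop] theorem primrec_runCert {α : Type*} [Primcodable α] {st : α → List Goal}
    {l : α → List Instr} (hs : Primrec st) (hl : Primrec l) :
    Primrec fun x => runCert (st x) (l x) := by
  unfold runCert execInstr; fun_prop

end VirtAbelian

/-! ### Completeness of the case splits -/

namespace VirtAbelian

/-- Affine functions of the first `p` coordinates. -/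
def Aff (p : ℕ) (h : (ℕ → ℕ) → ℤ) : Prop :=
  ∃ (u : ℕ → ℤ) (c : ℤ), ∀ x, h x = ∑ i ∈ Finset.range p, u i * x i + c

/-- Maps that preserve affine functions. -/
def Adm (p : ℕ) (s : (ℕ → ℕ) → ℕ → ℕ) : Prop := ∀ h, Aff p h → Aff p (h ∘ s)

theorem Adm.id (p : ℕ) : Adm p id := fun _ h => h

theorem Adm.comp {p : ℕ} {s s' : (ℕ → ℕ) → ℕ → ℕ} (hs : Adm p s) (hs' : Adm p s') :
    Adm p (s ∘ s') := fun _ hh => hs' _ (hs _ hh)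

theorem sum_subst {p i j : ℕ} (hi : i < p) (hj : j < p) (a b c : ℕ) (u : ℕ → ℤ) (d : ℤ)
    (x : ℕ → ℕ) :
    ∑ l ∈ Finset.range p, u l * (subst i j a b c x l : ℕ) + d =
      ∑ l ∈ Finset.range p, ((if l = i then a * u i else u l) + if l = j then b * u i else 0) * x l
        + (d + c * u i) := by
  have h1 : ∀ l ∈ Finset.range p,
      ((if l = i then a * u i else u l) + if l = j then b * u i else 0) * (x l : ℤ) =
      u l * x l + (if l = i then u i * (a * x i - x i) else 0) +
        (if l = j then b * u i * x j else 0) := by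
    intro l _
    split_ifs with h h' h'
    · subst h; subst h'; ring
    · subst h; ring
    · subst h'; ring
    · ring
  have h2 : ∀ l ∈ Finset.range p, u l * ((subst i j a b c x l : ℕ) : ℤ) =
      u l * x l + (if l = i then u i * ((a * x i + b * x j + c : ℕ) - x i : ℤ) else 0) := by
    intro l _
    split_ifs with h
    · subst h; simp [subst]; ring
    · simp [subst, h]
  rw [Finset.sum_congr rfl h1, Finset.sum_congr rfl h2, Finset.sum_add_distrib,
    Finset.sum_add_distrib, Finset.sum_add_distrib, Finset.sum_ite_eq', Finset.sum_ite_eq',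
    if_pos (by simpa), if_pos (by simpa), Finset.sum_ite_eq', if_pos (by simpa)]
  push_cast
  ring

theorem Adm.subst {p i j : ℕ} (hi : i < p) (hj : j < p) (a b c : ℕ) :
    Adm p (subst i j a b c) := by
  rintro h ⟨u, d, hu⟩
  exact ⟨_, _, fun x => by rw [Function.comp, hu, sum_subst hi hj]⟩

/-- A finite tree of case splits of the first `p` coordinates, all of whose leaves, as
substitutions, satisfy `Φ`. -/
inductive Tree (p : ℕ) : (((ℕ → ℕ) → ℕ → ℕ) → Prop) → Prop
  | leaf {Φ : ((ℕ → ℕ) → ℕ → ℕ) → Prop} (h : Φ id) : Tree p Φ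
  | zero {Φ : ((ℕ → ℕ) → ℕ → ℕ) → Prop} {i : ℕ} (hi : i < p)
      (h₀ : Tree p fun s => Φ (subst i i 0 0 0 ∘ s))
      (h₁ : Tree p fun s => Φ (subst i i 1 0 1 ∘ s)) : Tree p Φ
  | cone {Φ : ((ℕ → ℕ) → ℕ → ℕ) → Prop} {i j : ℕ} (hi : i < p) (hj : j < p) (hij : i ≠ j)
      (h₀ : Tree p fun s => Φ (subst i j 1 1 0 ∘ s))
      (h₁ : Tree p fun s => Φ (subst j i 1 1 0 ∘ s)) : Tree p Φ
  | mod {Φ : ((ℕ → ℕ) → ℕ → ℕ) → Prop} {i m : ℕ} (hi : i < p) (hm : 0 < m)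
      (h : ∀ ρ < m, Tree p fun s => Φ (subst i i m 0 ρ ∘ s)) : Tree p Φ

namespace Tree

variable {p : ℕ} {Φ Ψ : ((ℕ → ℕ) → ℕ → ℕ) → Prop}

/-- Grafting further trees onto the leaves. The leaf substitution `s` is handed over with its
admissibility, so affine forms stay affine when pulled back to the leaf. -/
theorem bind (h : Tree p Φ) (hΨ : ∀ s, Adm p s → Φ s → Tree p fun s' => Ψ (s ∘ s')) :
    Tree p Ψ := by
  induction h generalizing Ψ with
  | leaf h => exact hΨ id (Adm.id p) h
  | zero hi _ _ ih₀ ih₁ =>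
    exact zero hi (ih₀ fun s hs h => hΨ _ ((Adm.subst hi hi _ _ _).comp hs) h)
      (ih₁ fun s hs h => hΨ _ ((Adm.subst hi hi _ _ _).comp hs) h)
  | cone hi hj hij _ _ ih₀ ih₁ =>
    exact cone hi hj hij (ih₀ fun s hs h => hΨ _ ((Adm.subst hi hj _ _ _).comp hs) h)
      (ih₁ fun s hs h => hΨ _ ((Adm.subst hj hi _ _ _).comp hs) h)
  | mod hi hm _ ih =>
    exact mod hi hm fun ρ hρ => ih ρ hρ fun s hs h => hΨ _ ((Adm.subst hi hi _ _ _).comp hs) h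

theorem mono (h : Tree p Φ) (hΨ : ∀ s, Φ s → Ψ s) : Tree p Ψ :=
  h.bind fun s _ hs => leaf (hΨ s hs)

/-- A tree of splits becomes a derivation once the goals pulled back to its leaves are derivable.
The accumulated substitution `s` is what makes the induction work. -/
theorem provable {G G' : Goal} {s : (ℕ → ℕ) → ℕ → ℕ} (h : Tree p Φ) (hG : G.Pull s G')
    (hΦ : ∀ s' G'', Φ s' → G.Pull (s ∘ s') G'' → G''.Provable) : G'.Provable := by
  induction h generalizing s G' with
  | leaf h => exact hΦ _ _ h hG
  | zero hi _ _ ih₀ ih₁ =>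
    exact .zero _ (ih₀ (hG.subst _ _ _ _ _) fun s' G'' h h' => hΦ _ _ h h')
      (ih₁ (hG.subst _ _ _ _ _) fun s' G'' h h' => hΦ _ _ h h')
  | cone hi hj hij _ _ ih₀ ih₁ =>
    exact .cone hij (ih₀ (hG.subst _ _ _ _ _) fun s' G'' h h' => hΦ _ _ h h')
      (ih₁ (hG.subst _ _ _ _ _) fun s' G'' h h' => hΦ _ _ h h')
  | mod hi hm _ ih =>
    exact .mod _ hm fun ρ hρ => ih ρ hρ (hG.subst _ _ _ _ _) fun s' G'' h h' => hΦ _ _ h h'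

/-- Split all coordinates modulo given moduli. -/
theorem mod_all (p : ℕ) (μ : ℕ → ℕ) (hμ : ∀ i, 0 < μ i) :
    Tree p fun s => ∃ ρ : ℕ → ℕ, ∀ x, ∀ i < p, s x i = μ i * x i + ρ i := by
  -- For the induction, the coordinates from `k` on must also be known to be untouched.
  suffices h : ∀ k ≤ p, Tree p fun s => ∃ ρ : ℕ → ℕ, ∀ x i,
      (i < k → s x i = μ i * x i + ρ i) ∧ (k ≤ i → s x i = x i) from
    (h p le_rfl).mono fun s ⟨ρ, hρ⟩ => ⟨ρ, fun x i hi => (hρ x i).1 hi⟩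
  intro k
  induction k with
  | zero => exact fun _ => leaf ⟨0, by simp⟩
  | succ k ih =>
    intro hk
    refine (ih (by omega)).bind fun s _ ⟨ρ, hρ⟩ => mod (i := k) (m := μ k) (by omega) (hμ k)
      fun r hr => leaf ⟨Function.update ρ k r, fun x i => ⟨fun hi => ?_, fun hi => ?_⟩⟩
    · rcases Nat.lt_succ_iff_lt_or_eq.1 hi with hi | rfl
      · simp [(hρ _ i).1 hi, VirtAbelian.subst, hi.ne]
      · simp [(hρ _ i).2 le_rfl, VirtAbelian.subst]
    · have : i ≠ k := by omega
      simp [(hρ _ i).2 (by omega), VirtAbelian.subst, this]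

end Tree

/-! ### Splitting until an affine form has constant sign -/

/-- The leaf `s` lies on one side of the hyperplane `h = 0`. -/
def OneSided (h : (ℕ → ℕ) → ℤ) (s : (ℕ → ℕ) → ℕ → ℕ) : Prop :=
  (∀ x, 0 ≤ h (s x)) ∨ ∀ x, h (s x) < 0

/-- Induction on the deficit of the constant plus the number of nonzero coefficients. If `c < 0` and
some `u i > 0`, split at `x_i`: setting `x_i = 0` removes a coefficient, and replacing `x_i` by `x_i
+ 1` raises the constant by `u i ≥ 1`. If all coefficients vanish, the sign is that of `c`. -/
theorem tree_oneSided_of_nonneg (p : ℕ) (n : ℕ) : ∀ (u : ℕ → ℤ) (c : ℤ), (∀ i < p, 0 ≤ u i) →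
    (-c).toNat + ((Finset.range p).filter fun i => u i ≠ 0).card ≤ n →
    Tree p (OneSided fun x => ∑ i ∈ Finset.range p, u i * x i + c) := by
  induction n with
  | zero =>
    intro u c hu hn
    refine .leaf (.inl fun x => add_nonneg (Finset.sum_nonneg fun i hi =>
      mul_nonneg (hu i (by simpa using hi)) (by positivity)) (by omega))
  | succ n ih =>
    intro u c hu hn
    rcases le_or_gt 0 c with hc | hc
    · exact .leaf (.inl fun x => add_nonneg (Finset.sum_nonneg fun i hi =>
        mul_nonneg (hu i (by simpa using hi)) (by positivity)) hc)
    by_cases hz : ∀ i < p, u i = 0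
    · refine .leaf (.inr fun x => ?_)
      have : ∑ i ∈ Finset.range p, u i * (x i : ℤ) = 0 :=
        Finset.sum_eq_zero fun i hi => by rw [hz i (by simpa using hi), zero_mul]
      simpa [this] using hc
    push Not at hz
    obtain ⟨i, hi, hui⟩ := hz
    have hpos : 0 < u i := lt_of_le_of_ne (hu i hi) hui.symm
    refine .zero hi ?_ ?_
    · refine (ih (fun l => if l = i then 0 else u l) c (fun l hl => ?_) ?_).mono fun s hs => ?_
      · split_ifs; exacts [le_rfl, hu l hl]
      · have : ((Finset.range p).filter fun l => (if l = i then 0 else u l) ≠ 0).card <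
            ((Finset.range p).filter fun l => u l ≠ 0).card := by
          refine Finset.card_lt_card (Finset.ssubset_iff_of_subset ?_ |>.2
            ⟨i, by simp [hi, hui], by simp⟩)
          intro l
          simp only [Finset.mem_filter]
          split_ifs <;> simp_all
        omega
      · simpa [OneSided, sum_subst hi hi] using hs
    · refine (ih u (c + u i) hu (by omega)).mono fun s hs => ?_
      have e : ∀ l, (if l = i then u i else u l) = u l := fun l => by
        split_ifs with h <;> simp [h]
      simpa [OneSided, sum_subst hi hi, e] using hs

/-- Over the integers `h < 0` means `0 ≤ -h - 1`, so the nonnegative case applied to `-h - 1`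
settles `h` with the sides exchanged. -/
theorem tree_oneSided_of_nonpos (p : ℕ) (u : ℕ → ℤ) (c : ℤ) (hu : ∀ i < p, u i ≤ 0) :
    Tree p (OneSided fun x => ∑ i ∈ Finset.range p, u i * x i + c) := by
  refine (tree_oneSided_of_nonneg p _ (-u) (-c - 1) (fun i hi => by simpa using hu i hi)
    le_rfl).mono fun s hs => ?_
  have e : ∀ x : ℕ → ℕ, ∑ i ∈ Finset.range p, (-u) i * (x i : ℤ) + (-c - 1) =
      -(∑ i ∈ Finset.range p, u i * (x i : ℤ) + c) - 1 := fun x => by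
    simp only [Pi.neg_apply, neg_mul, Finset.sum_neg_distrib]; ring
  simp only [OneSided, e] at hs
  exact hs.symm.imp (fun h x => by have := h x; dsimp only; omega)
    (fun h x => by have := h x; dsimp only; omega)

/-- When both signs occur, a cone split at coordinates of opposite sign makes the two coefficients
cancel in either branch. The number of nonzero coefficients drops until only one sign is left. -/
theorem tree_oneSided_of_balanced (p : ℕ) (M : ℤ) (hM : 0 < M) (n : ℕ) :
    ∀ (u : ℕ → ℤ) (c : ℤ), (∀ i < p, u i = 0 ∨ u i = M ∨ u i = -M) →
    ((Finset.range p).filter fun i => u i ≠ 0).card ≤ n →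
    Tree p (OneSided fun x => ∑ i ∈ Finset.range p, u i * x i + c) := by
  induction n with
  | zero =>
    intro u c hu hn
    refine tree_oneSided_of_nonpos p u c fun i hi => ?_
    have := Finset.card_eq_zero.1 (Nat.le_zero.1 hn)
    rw [Finset.filter_eq_empty_iff] at this
    exact (not_not.1 (this (Finset.mem_range.2 hi))).le
  | succ n ih =>
    intro u c hu hn
    by_cases h1 : ∀ i < p, 0 ≤ u i
    · exact tree_oneSided_of_nonneg p _ u c h1 le_rfl
    by_cases h2 : ∀ i < p, u i ≤ 0
    · exact tree_oneSided_of_nonpos p u c h2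
    push Not at h1 h2
    obtain ⟨j, hj, huj⟩ := h1
    obtain ⟨i, hi, hui⟩ := h2
    have hij : i ≠ j := by rintro rfl; omega
    -- After `x_i := x_i + x_j` the coefficient at `j` becomes `u i + u j = 0`. Stated
    -- symmetrically, this serves both branches.
    have key : ∀ i j, i < p → j < p → i ≠ j → u i + u j = 0 → u i ≠ 0 →
        Tree p (fun s => OneSided (fun x => ∑ i ∈ Finset.range p, u i * x i + c)
          (subst i j 1 1 0 ∘ s)) := by
      intro i j hi hj hij h0 hui
      refine (ih (fun l => if l = j then 0 else u l) c (fun l hl => ?_) ?_).mono fun s hs => ?_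
      · split_ifs; exacts [.inl rfl, hu l hl]
      · have : ((Finset.range p).filter fun l => (if l = j then 0 else u l) ≠ 0).card <
            ((Finset.range p).filter fun l => u l ≠ 0).card := by
          refine Finset.card_lt_card (Finset.ssubset_iff_of_subset ?_ |>.2
            ⟨j, by simp [hj]; omega, by simp⟩)
          intro l
          simp only [Finset.mem_filter]
          split_ifs <;> simp_all
        omega
      · have e : ∀ l, ((if l = i then ((1 : ℕ) : ℤ) * u i else u l) +
            if l = j then ((1 : ℕ) : ℤ) * u i else 0) = if l = j then 0 else u l := fun l => by
          split_ifs with h h' h'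
          · omega
          · subst h; simp
          · subst h'; push_cast; linarith
          · simp
        simpa only [OneSided, Function.comp, sum_subst hi hj, e, Nat.cast_zero, zero_mul,
          add_zero] using hs
    have hsum : u i + u j = 0 := by
      rcases hu i hi with h | h | h <;> rcases hu j hj with h' | h' | h' <;> omega
    exact .cone hi hj hij (key i j hi hj hij hsum (by omega))
      (key j i hj hi hij.symm (by omega) (by omega))

/-- Congruence splits rescale the coordinates so that all nonzero coefficients get the same absolute
value; then opposite coefficients cancel in a single cone split. -/
theorem tree_oneSided {p : ℕ} {h : (ℕ → ℕ) → ℤ} (hh : Aff p h) : Tree p (OneSided h) := by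
  obtain ⟨u, c, hu⟩ := hh
  -- `v i` is `|u i|`, replaced by `1` where `u i = 0` so that the product `M` is positive.
  -- Splitting coordinate `i` modulo `μ i = M / v i` turns `u i` into `0` or `±M`.
  set v : ℕ → ℕ := fun i => if u i = 0 then 1 else (u i).natAbs with hv
  have hvpos : ∀ i, 0 < v i := fun i => by
    simp only [hv]; split_ifs with h0; exacts [one_pos, Int.natAbs_pos.2 h0]
  set M : ℕ := ∏ i ∈ Finset.range p, v i with hM
  have hMpos : 0 < M := Finset.prod_pos fun i _ => hvpos i
  set μ : ℕ → ℕ := fun i => if i < p then M / v i else 1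
  have hμ : ∀ i < p, v i * μ i = M := fun i hi => by
    simp only [μ, if_pos hi]
    exact Nat.mul_div_cancel' (Finset.dvd_prod_of_mem v (Finset.mem_range.2 hi))
  have hμpos : ∀ i, 0 < μ i := fun i => by
    by_cases hi : i < p
    · exact Nat.pos_of_ne_zero fun h0 => by have := hμ i hi; simp [h0] at this; omega
    · simp [μ, hi]
  refine (Tree.mod_all p μ hμpos).bind fun s _ ⟨ρ, hρ⟩ => ?_
  have e : ∀ x, h (s x) = ∑ i ∈ Finset.range p, (u i * μ i) * x i +
      (∑ i ∈ Finset.range p, u i * ρ i + c) := fun x => by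
    rw [hu, ← add_assoc, ← Finset.sum_add_distrib]
    congr 1
    refine Finset.sum_congr rfl fun i hi => ?_
    rw [hρ x i (by simpa using hi)]; push_cast; ring
  refine (tree_oneSided_of_balanced p M (by exact_mod_cast hMpos) _ (fun i => u i * μ i)
    (∑ i ∈ Finset.range p, u i * ρ i + c) (fun i hi => ?_) le_rfl).mono fun s' hs' => ?_
  · have := hμ i hi
    rcases lt_trichotomy (u i) 0 with h0 | h0 | h0
    · right; right
      rw [← this]
      simp only [hv, if_neg h0.ne]
      push_cast
      rw [abs_of_neg h0]; ring
    · simp [h0]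
    · right; left
      rw [← this]
      simp only [hv, if_neg h0.ne']
      push_cast
      rw [abs_of_pos h0]
  · simpa only [OneSided, Function.comp, e] using hs'

/-! ### Boolean combinations of half-spaces and congruences -/

/-- Every admissible substitution can be refined by case splits such that each leaf lies inside
or outside `X`. -/
def Resolvable (p : ℕ) (X : Set (ℕ → ℕ)) : Prop :=
  ∀ s₀, Adm p s₀ → Tree p fun s => (∀ x, s₀ (s x) ∈ X) ∨ ∀ x, s₀ (s x) ∉ X

namespace Resolvable

variable {p : ℕ} {X Y : Set (ℕ → ℕ)}

theorem compl (hX : Resolvable p X) : Resolvable p Xᶜ := fun s₀ hs₀ =>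
  (hX s₀ hs₀).mono fun _ h => h.symm.imp (fun h x => h x) fun h x => by simpa using h x

theorem inter (hX : Resolvable p X) (hY : Resolvable p Y) : Resolvable p (X ∩ Y) := by
  intro s₀ hs₀
  refine (hX s₀ hs₀).bind fun s hs h => ?_
  rcases h with h | h
  · refine (hY (s₀ ∘ s) (hs₀.comp hs)).mono fun s' h' => ?_
    exact h'.imp (fun h' x => ⟨h _, h' x⟩) fun h' x hx => h' x hx.2
  · exact .leaf (.inr fun x hx => h x hx.1)

theorem univ : Resolvable p Set.univ := fun _ _ => .leaf (.inl fun _ => trivial)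

theorem iInter {ι : Type*} [Finite ι] {X : ι → Set (ℕ → ℕ)} (hX : ∀ i, Resolvable p (X i)) :
    Resolvable p (⋂ i, X i) := by
  have key : ∀ S : Set (Set (ℕ → ℕ)), S.Finite → (∀ t ∈ S, Resolvable p t) →
      Resolvable p (⋂₀ S) := by
    intro S hS
    induction S, hS using Set.Finite.induction_on with
    | empty => exact fun _ => by simpa using univ
    | insert _ _ ih =>
      intro h
      rw [Set.sInter_insert]
      exact (h _ (by simp)).inter (ih fun t ht => h t (by simp [ht]))
  rw [← Set.sInter_range]
  exact key _ (Set.finite_range X) (by rintro _ ⟨i, rfl⟩; exact hX i)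

theorem iUnion {ι : Type*} [Finite ι] {X : ι → Set (ℕ → ℕ)} (hX : ∀ i, Resolvable p (X i)) :
    Resolvable p (⋃ i, X i) := by
  have := (iInter fun i => (hX i).compl).compl
  simpa [Set.compl_iInter] using this

theorem halfspace {h : (ℕ → ℕ) → ℤ} (hh : Aff p h) : Resolvable p {x | 0 ≤ h x} := fun _ hs₀ =>
  (tree_oneSided (hs₀ h hh)).mono fun _ hs =>
    hs.imp (fun hs x => hs x) fun hs x => not_le.2 (hs x)

theorem hyperplane {h : (ℕ → ℕ) → ℤ} (hh : Aff p h) : Resolvable p {x | h x = 0} := by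
  have hn : Aff p fun x => -h x := by
    obtain ⟨u, c, hu⟩ := hh
    exact ⟨fun i => -u i, -c, fun x => by
      simp only [hu, neg_mul, Finset.sum_neg_distrib, neg_add]⟩
  convert (halfspace hh).inter (halfspace hn) using 1
  ext x
  simp only [Set.mem_ofPred_eq, Set.mem_inter_iff]
  omega

/-- Once every coordinate is split modulo `D`, the residue of `h` modulo `D` is constant on each
leaf. -/
theorem dvd {h : (ℕ → ℕ) → ℤ} (hh : Aff p h) {D : ℕ} (hD : 0 < D) :
    Resolvable p {x | (D : ℤ) ∣ h x} := by
  intro s₀ hs₀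
  obtain ⟨u, c, hu⟩ := hs₀ h hh
  refine (Tree.mod_all p (fun _ => D) fun _ => hD).mono fun s ⟨ρ, hρ⟩ => ?_
  have e : ∀ x, h (s₀ (s x)) = D * ∑ i ∈ Finset.range p, u i * x i +
      (∑ i ∈ Finset.range p, u i * ρ i + c) := fun x => by
    rw [show h (s₀ (s x)) = (h ∘ s₀) (s x) from rfl, hu, Finset.mul_sum, ← add_assoc,
      ← Finset.sum_add_distrib]
    congr 1
    refine Finset.sum_congr rfl fun i hi => ?_
    rw [hρ x i (by simpa using hi)]; push_cast; ring
  simp only [Set.mem_ofPred_eq, e, dvd_add_right (dvd_mul_right _ _), forall_const]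
  exact em _

end Resolvable

end VirtAbelian

/-! ### Semilinear sets can be resolved by case splits -/

namespace VirtAbelian

/-- Clearing denominators reduces to relations over `ℤ`. Moving the negative coefficients to the
other side turns such a relation into an equality of two combinations over `ℕ`. -/
theorem linearIndependent_natCast {ι : Type*} {t : Set (ι → ℕ)} (ht : LinearIndepOn ℕ id t) :
    LinearIndependent ℚ fun c : t => fun i => ((c : ι → ℕ) i : ℚ) := by
  rw [← LinearIndependent.iff_fractionRing ℤ ℚ]
  suffices h : LinearIndepOn ℤ (fun (c : ι → ℕ) i => (c i : ℚ)) t from h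
  rw [linearIndepOn_iff'']
  intro s f hs hf heq i hi
  rw [linearIndepOn_iff_linearIndepOn_finset] at ht
  specialize ht s hs
  rw [linearIndepOn_finset_iffₛ] at ht
  -- The two natural combinations have the positive and the negative parts of `f` as coefficients;
  -- if these agree at `i`, then `f i = 0`.
  specialize ht (Int.toNat ∘ f) (Int.toNat ∘ (-·) ∘ f) ?_ i hi
  · ext k
    have h := congrFun heq k
    simp only [Finset.sum_apply, Pi.zero_apply, zsmul_eq_mul, Pi.mul_apply,
      Pi.intCast_apply] at h
    have h' : ∑ j ∈ s, f j * (j k : ℤ) = 0 := by exact_mod_cast h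
    simp only [Finset.sum_apply, Function.comp, id, Pi.smul_apply, smul_eq_mul]
    zify
    rw [← sub_eq_zero, ← Finset.sum_sub_distrib, ← h']
    refine Finset.sum_congr rfl fun j _ => ?_
    rw [← sub_mul]
    congr 1
    omega
  · have : (f i).toNat = (-f i).toNat := ht
    omega

/-- A left inverse of the injective rational map given by `t` provides dual functionals, and
clearing denominators makes them integral. -/
theorem exists_integer_dual {p : ℕ} {t : Set (Fin p → ℕ)} (hfin : t.Finite)
    (ht : LinearIndepOn ℕ id t) [DecidableEq t] :
    ∃ (D : ℕ) (_ : 0 < D) (H : t → Fin p → ℤ), ∀ c c' : t,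
      ∑ i, H c i * (c'.1 i : ℤ) = if c' = c then (D : ℤ) else 0 := by
  have := hfin.fintype
  have hli := linearIndependent_natCast ht
  obtain ⟨g, hg⟩ := LinearMap.exists_leftInverse_of_injective
    (Fintype.linearCombination ℚ fun c : t => fun i => ((c : Fin p → ℕ) i : ℚ))
    (LinearMap.ker_eq_bot.2 (linearIndependent_iff_injective_fintypeLinearCombination.1 hli))
  obtain ⟨⟨b, hb⟩, hb'⟩ := IsLocalization.exist_integer_multiples_of_finite (nonZeroDivisors ℤ)
    fun q : t × Fin p => g (Pi.single q.2 1) q.1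
  have hb0 : b ≠ 0 := nonZeroDivisors.ne_zero hb
  choose H hH using hb'
  -- The common denominator `b` may be negative. A second factor `b` gives the positive scale `b *
  -- b`.
  refine ⟨(b * b).toNat, by have := mul_self_pos.2 hb0; omega, fun c i => b * H (c, i),
    fun c c' => ?_⟩
  have h1 : g (fun i => (c'.1 i : ℚ)) c = if c' = c then 1 else 0 := by
    have := congrFun (LinearMap.congr_fun hg (Pi.single c' 1)) c
    simpa [Fintype.linearCombination_apply_single, Pi.single_apply, eq_comm] using this
  have h2 : g (fun i => (c'.1 i : ℚ)) c = ∑ i, (c'.1 i : ℚ) * g (Pi.single i 1) c := by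
    conv_lhs => rw [LinearMap.pi_apply_eq_sum_univ g]
    simp only [Finset.sum_apply, Pi.smul_apply, smul_eq_mul]
    refine Finset.sum_congr rfl fun i _ => ?_
    have : (fun j => if i = j then (1 : ℚ) else 0) = Pi.single i 1 :=
      funext fun j => by simp [Pi.single_apply, eq_comm]
    rw [this]
  have h3 : ∀ i, (H (c, i) : ℚ) = b * g (Pi.single i 1) c := fun i => by
    simpa using hH (c, i)
  have h4 : (∑ i, (b * H (c, i)) * (c'.1 i : ℤ) : ℚ) = if c' = c then ((b * b : ℤ) : ℚ) else 0 := by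
    have : ∀ i, (b * H (c, i)) * ((c'.1 i : ℤ) : ℚ) =
        (b * b) * ((c'.1 i : ℚ) * g (Pi.single i 1) c) := fun i => by
      rw [h3]; push_cast; ring
    simp only [this, ← Finset.mul_sum, ← h2, h1]
    split_ifs <;> simp
  have h5 : ((b * b).toNat : ℤ) = b * b := Int.toNat_of_nonneg (mul_self_nonneg b)
  rw [h5]
  exact_mod_cast h4

/-- If `x - a = ∑ n_c c`, duality gives `D n_c = H_c · (x - a)`. So the candidate coefficients are
forced, and membership says that they are nonnegative, that they are integral, and that they
reproduce `x - a`. These conditions are inequalities, congruences and equations. -/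
theorem mem_linear_iff {p : ℕ} {t : Set (Fin p → ℕ)} (hfin : t.Finite)
    (ht : LinearIndepOn ℕ id t) (a : Fin p → ℕ) :
    ∃ (D : ℕ) (_ : 0 < D) (H : t → Fin p → ℤ), ∀ x : Fin p → ℕ,
      x ∈ (a +ᵥ (AddSubmonoid.closure t : Set (Fin p → ℕ))) ↔
      (∀ c, 0 ≤ ∑ i, H c i * ((x i : ℤ) - a i)) ∧
      (∀ c, (D : ℤ) ∣ ∑ i, H c i * ((x i : ℤ) - a i)) ∧
      ∀ j, ∑ c : hfin.toFinset, (∑ i, H ⟨c.1, hfin.mem_toFinset.1 c.2⟩ i * ((x i : ℤ) - a i)) *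
        (c.1 j : ℤ) - D * ((x j : ℤ) - a j) = 0 := by
  classical
  obtain ⟨D, hD, H, hH⟩ := exists_integer_dual hfin ht
  have := hfin.fintype
  refine ⟨D, hD, H, fun x => ?_⟩
  have hsum : ∀ F : t → ℤ, ∑ c : hfin.toFinset, F ⟨c.1, hfin.mem_toFinset.1 c.2⟩ =
      ∑ c : t, F c := fun F =>
    Fintype.sum_equiv (Equiv.subtypeEquivRight fun c => hfin.mem_toFinset) _ _ fun c => rfl
  have hsum' : ∀ j, ∑ c : hfin.toFinset, (∑ i, H ⟨c.1, hfin.mem_toFinset.1 c.2⟩ i *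
      ((x i : ℤ) - a i)) * (c.1 j : ℤ) = ∑ c : t, (∑ i, H c i * ((x i : ℤ) - a i)) * (c.1 j : ℤ) :=
    fun j => hsum fun c => (∑ i, H c i * ((x i : ℤ) - a i)) * (c.1 j : ℤ)
  simp only [hsum']
  have hmem : x ∈ (a +ᵥ (AddSubmonoid.closure t : Set (Fin p → ℕ))) ↔
      ∃ n : t → ℕ, ∀ j, (x j : ℤ) - a j = ∑ c, (n c : ℤ) * (c.1 j : ℤ) := by
    rw [Set.mem_vadd_set]
    constructor
    · rintro ⟨y, hy, rfl⟩
      rw [← Subtype.range_val (s := t), SetLike.mem_coe,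
        AddSubmonoid.mem_closure_range_iff_of_fintype] at hy
      obtain ⟨n, rfl⟩ := hy
      exact ⟨n, fun j => by simp [Finset.sum_apply]⟩
    · rintro ⟨n, hn⟩
      refine ⟨∑ c, n c • c.1, AddSubmonoid.sum_mem _ fun c _ =>
        AddSubmonoid.nsmul_mem _ (AddSubmonoid.subset_closure c.2) _, ?_⟩
      ext j
      have := hn j
      simp only [vadd_eq_add, Pi.add_apply, Finset.sum_apply, Pi.smul_apply, smul_eq_mul]
      zify
      linarith
  rw [hmem]
  constructor
  · rintro ⟨n, hn⟩
    have hh : ∀ c, ∑ i, H c i * ((x i : ℤ) - a i) = D * n c := fun c => by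
      simp only [hn, Finset.mul_sum]
      rw [Finset.sum_comm]
      have : ∀ c' : t, ∑ i, H c i * ((n c' : ℤ) * (c'.1 i : ℤ)) =
          n c' * if c' = c then (D : ℤ) else 0 := fun c' => by
        rw [← hH c c', Finset.mul_sum]
        exact Finset.sum_congr rfl fun i _ => by ring
      simp only [this, mul_ite, mul_zero, Finset.sum_ite_eq', Finset.mem_univ, if_true]
      ring
    refine ⟨fun c => by rw [hh]; positivity, fun c => by rw [hh]; exact dvd_mul_right _ _,
      fun j => ?_⟩
    simp only [hh]
    rw [hn, Finset.mul_sum, ← Finset.sum_sub_distrib]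
    exact Finset.sum_eq_zero fun c _ => by ring
  · rintro ⟨h0, hd, he⟩
    choose n hn using hd
    have hn0 : ∀ c, 0 ≤ n c := fun c => by
      have := h0 c
      rw [hn] at this
      exact nonneg_of_mul_nonneg_right this (by exact_mod_cast hD)
    refine ⟨fun c => (n c).toNat, fun j => ?_⟩
    have hDz : (D : ℤ) ≠ 0 := by exact_mod_cast hD.ne'
    have := he j
    rw [sub_eq_zero] at this
    refine mul_left_cancel₀ hDz (this.symm.trans ?_)
    rw [Finset.mul_sum]
    refine Finset.sum_congr rfl fun c _ => ?_
    rw [hn, Int.toNat_of_nonneg (hn0 c)]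
    ring

theorem aff_sum {p : ℕ} (H a : Fin p → ℤ) :
    Aff p fun x => ∑ i : Fin p, H i * ((x i : ℤ) - a i) := by
  refine ⟨fun i => if h : i < p then H ⟨i, h⟩ else 0, -∑ i, H i * a i, fun x => ?_⟩
  rw [Finset.sum_range, ← sub_eq_add_neg, ← Finset.sum_sub_distrib]
  exact Finset.sum_congr rfl fun i _ => by simp; ring

theorem Aff.mul_const {p : ℕ} {h : (ℕ → ℕ) → ℤ} (hh : Aff p h) (d : ℤ) :
    Aff p fun x => h x * d := by
  obtain ⟨u, c, hu⟩ := hh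
  refine ⟨fun i => u i * d, c * d, fun x => ?_⟩
  simp only [hu, add_mul, Finset.sum_mul]
  congr 1
  exact Finset.sum_congr rfl fun i _ => by ring

theorem Aff.add {p : ℕ} {h h' : (ℕ → ℕ) → ℤ} (hh : Aff p h) (hh' : Aff p h') :
    Aff p fun x => h x + h' x := by
  obtain ⟨u, c, hu⟩ := hh
  obtain ⟨u', c', hu'⟩ := hh'
  refine ⟨fun i => u i + u' i, c + c', fun x => ?_⟩
  simp only [hu, hu', add_mul, Finset.sum_add_distrib]
  ring

theorem Aff.const {p : ℕ} (d : ℤ) : Aff p fun _ => d := ⟨0, d, by simp⟩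

theorem Aff.sum {p : ℕ} {ι : Type*} (s : Finset ι) {h : ι → (ℕ → ℕ) → ℤ}
    (hh : ∀ i, Aff p (h i)) : Aff p fun x => ∑ i ∈ s, h i x := by
  classical
  induction s using Finset.induction_on with
  | empty => simpa using Aff.const 0
  | insert a s ha ih => simpa [Finset.sum_insert ha] using (hh a).add ih

theorem Aff.coord {p : ℕ} (j : Fin p) (d : ℤ) : Aff p fun x => (x j : ℤ) - d := by
  classical
  have := aff_sum (Pi.single j 1) (fun _ => d)
  simpa [Pi.single_apply] using this

theorem resolvable_of_isProperLinearSet {p : ℕ} {X : Set (Fin p → ℕ)}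
    (hX : IsProperLinearSet X) : Resolvable p {x | (fun i : Fin p => x i) ∈ X} := by
  obtain ⟨a, t, hfin, ht, rfl⟩ := hX
  obtain ⟨D, hD, H, hH⟩ := mem_linear_iff hfin ht a
  have := hfin.to_subtype
  have e : {x : ℕ → ℕ | (fun i : Fin p => x i) ∈
      (a +ᵥ (AddSubmonoid.closure t : Set (Fin p → ℕ)))} =
      (⋂ c, {x | 0 ≤ ∑ i : Fin p, H c i * ((x i : ℤ) - a i)}) ∩
      ((⋂ c, {x | (D : ℤ) ∣ ∑ i : Fin p, H c i * ((x i : ℤ) - a i)}) ∩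
      ⋂ j : Fin p, {x | ∑ c : hfin.toFinset, (∑ i : Fin p, H ⟨c.1, hfin.mem_toFinset.1 c.2⟩ i *
        ((x i : ℤ) - a i)) * (c.1 j : ℤ) + ((x j : ℤ) - a j) * (-D) = 0}) := by
    ext x
    rw [Set.mem_ofPred_eq, hH]
    simp only [Set.mem_inter_iff, Set.mem_iInter, Set.mem_ofPred_eq]
    refine and_congr_right fun _ => and_congr_right fun _ => forall_congr' fun j => ?_
    rw [mul_neg, ← sub_eq_add_neg, mul_comm (D : ℤ)]
  rw [e]
  refine (Resolvable.iInter fun c => .halfspace (aff_sum _ _)).inter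
    ((Resolvable.iInter fun c => .dvd (aff_sum _ _) hD).inter
      (Resolvable.iInter fun j => .hyperplane ?_))
  exact (Aff.sum _ fun c => (aff_sum _ _).mul_const _).add ((Aff.coord j _).mul_const _)

/-- A semilinear set is a finite union of linear sets with independent periods, and for those
membership is a Boolean combination of resolvable conditions. -/
theorem resolvable_of_isSemilinearSet {p : ℕ} {X : Set (Fin p → ℕ)}
    (hX : IsSemilinearSet X) : Resolvable p {x | (fun i : Fin p => x i) ∈ X} := by
  obtain ⟨S, hS, hS', rfl⟩ := hX.isProperSemilinearSet
  have := hS.to_subtype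
  have e : {x : ℕ → ℕ | (fun i : Fin p => x i) ∈ ⋃₀ S} =
      ⋃ t : S, {x | (fun i : Fin p => x i) ∈ t.1} := by
    ext x; simp
  rw [e]
  exact Resolvable.iUnion fun t => resolvable_of_isProperLinearSet (hS' t t.2)

end VirtAbelian

/-! ### Valid goals are provable -/

namespace VirtAbelian

/-- A slack variable `y` turns the inequality into the equation `f x + c = y`; its solution set is
semilinear, and so is the projection. -/
theorem isSemilinearSet_nonneg {ι : Type*} [Finite ι] (f : (ι → ℕ) →+ ℤ) (c : ℤ) :
    IsSemilinearSet {x | 0 ≤ f x + c} := by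
  let F : (ι ⊕ Unit → ℕ) →+ ℤ :=
    { toFun := fun w => f (w ∘ Sum.inl), map_zero' := f.map_zero, map_add' := fun a b => f.map_add _ _ }
  let F' : (ι ⊕ Unit → ℕ) →+ ℤ :=
    { toFun := fun w => w (Sum.inr ()), map_zero' := rfl, map_add' := fun a b => by simp }
  have h := IsSemilinearSet.proj' (p := fun (x : ι → ℕ) (y : Unit → ℕ) => c + f x = 0 + (y () : ℤ))
    (isSemilinearSet_setOfPred_eq c 0 F F')
  convert h using 1
  ext x
  simp only [Set.mem_ofPred_eq]
  constructor
  · intro hx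
    exact ⟨fun _ => (f x + c).toNat, by rw [Int.toNat_of_nonneg hx]; ring⟩
  · rintro ⟨y, hy⟩
    omega

theorem isSemilinearSet_forall_mem_list {ι α : Type*} [Finite ι] (l : List α)
    {P : α → (ι → ℕ) → Prop} (h : ∀ a ∈ l, IsSemilinearSet {x | P a x}) :
    IsSemilinearSet {x | ∀ a ∈ l, P a x} := by
  have := IsSemilinearSet.biInter (List.finite_toSet l) (t := fun a => {x | P a x}) h
  convert this using 1
  ext x
  simp

def dotHom {ι : Type*} (u : List ℤ) (e : ℕ → (ι → ℕ) →+ ℕ) : (ι → ℕ) →+ ℤ :=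
  ∑ i ∈ Finset.range u.length, (AddMonoidHom.mulLeft (u.getD i 0)).comp
    ((Nat.castAddMonoidHom ℤ).comp (e i))

theorem dotHom_apply {ι : Type*} (u : List ℤ) (e : ℕ → (ι → ℕ) →+ ℕ) (x : ι → ℕ) :
    dotHom u e x = dot u fun i => e i x := by
  simp [dotHom, dot]

/-- Extend a vector by zero. -/
def extend {p : ℕ} (x : Fin p → ℕ) (i : ℕ) : ℕ := if h : i < p then x ⟨i, h⟩ else 0

def extendHom {p : ℕ} {ι : Type*} (e : Fin p → ι) (i : ℕ) : (ι → ℕ) →+ ℕ where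
  toFun x := extend (x ∘ e) i
  map_zero' := by simp [extend]
  map_add' x y := by simp only [extend]; split_ifs <;> simp

theorem dot_congr {u : List ℤ} {x y : ℕ → ℕ} (h : ∀ i < u.length, x i = y i) :
    dot u x = dot u y :=
  Finset.sum_congr rfl fun i hi => by rw [h i (by simpa using hi)]

theorem isSemilinearSet_system {p q : ℕ} (D : List Constr) :
    IsSemilinearSet {x : Fin p → ℕ | ∃ z : Fin q → ℕ, ∀ κ ∈ D,
      0 ≤ Constr.val κ (extend x) (extend z)} := by
  refine IsSemilinearSet.proj' (p := fun (x : Fin p → ℕ) (z : Fin q → ℕ) => ∀ κ ∈ D,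
      0 ≤ Constr.val κ (extend x) (extend z)) ?_
  refine isSemilinearSet_forall_mem_list D fun κ _ => ?_
  have := isSemilinearSet_nonneg (dotHom κ.1 (extendHom (Sum.inl : Fin p → Fin p ⊕ Fin q)) +
    dotHom κ.2.1 (extendHom (Sum.inr : Fin q → Fin p ⊕ Fin q))) κ.2.2
  simp only [AddMonoidHom.add_apply, dotHom_apply] at this
  exact this

theorem exists_length_bound (G : Goal) : ∃ N, ∀ D ∈ G, ∀ κ ∈ D, κ.1.length ≤ N ∧ κ.2.1.length ≤ N := by
  refine ⟨(G.flatten.map fun κ => κ.1.length + κ.2.1.length).sum, fun D hD κ hκ => ?_⟩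
  have := List.le_sum_of_mem (List.mem_map_of_mem (f := fun κ : Constr => κ.1.length + κ.2.1.length)
    (List.mem_flatten_of_mem hD hκ))
  omega

/-- The system `D` has a solution `z` for the parameters `x`. -/
def Sat (D : List Constr) (x : ℕ → ℕ) : Prop := ∃ z : ℕ → ℕ, ∀ κ ∈ D, 0 ≤ Constr.val κ x z

theorem resolvable_sat {N : ℕ} {D : List Constr}
    (hD : ∀ κ ∈ D, κ.1.length ≤ N ∧ κ.2.1.length ≤ N) : Resolvable N {x | Sat D x} := by
  have h := resolvable_of_isSemilinearSet (isSemilinearSet_system (p := N) (q := N) D)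
  convert h using 1
  ext x
  simp only [Set.mem_ofPred_eq, Sat]
  have e : ∀ (y : ℕ → ℕ), ∀ i < N, extend (fun i : Fin N => y i) i = y i := fun y i hi => by
    simp [extend, hi]
  constructor
  · rintro ⟨z, hz⟩
    refine ⟨fun i => z i, fun κ hκ => ?_⟩
    have := hz κ hκ
    rwa [Constr.val, dot_congr fun i hi => e x i (hi.trans_le (hD κ hκ).1),
      dot_congr fun i hi => e z i (hi.trans_le (hD κ hκ).2)]
  · rintro ⟨z, hz⟩
    refine ⟨extend z, fun κ hκ => ?_⟩
    have := hz κ hκ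
    rwa [Constr.val, dot_congr fun i hi => e x i (hi.trans_le (hD κ hκ).1)] at this

theorem aff_val {N : ℕ} {κ : Constr} (h : κ.1.length ≤ N) (z : ℕ → ℕ) :
    Aff N fun x => Constr.val κ x z :=
  ⟨fun i => κ.1.getD i 0, dot κ.2.1 z + κ.2.2, fun x => by
    simp only [Constr.val, dot_eq h, add_assoc]⟩

theorem dot_add (v : List ℤ) (x y : ℕ → ℕ) : dot v (fun i => x i + y i) = dot v x + dot v y := by
  simp [dot, mul_add, Finset.sum_add_distrib]

/-- If a system with affine parameter `w n + c` is solvable for all `n`, then its recession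
system has a solution for some positive multiple of `w`. -/
theorem exists_recession {D : List Constr} (w c : Constr → ℤ)
    (h : ∀ n : ℕ, ∃ z : ℕ → ℕ, ∀ κ ∈ D, 0 ≤ w κ * n + c κ + dot κ.2.1 z) :
    ∃ (m : ℕ) (_ : 0 < m) (z : ℕ → ℕ), ∀ κ ∈ D, 0 ≤ m * w κ + dot κ.2.1 z := by
  choose z hz using h
  set q := (D.map fun κ => κ.2.1.length).sum
  have hq : ∀ κ ∈ D, κ.2.1.length ≤ q := fun κ hκ =>
    List.le_sum_of_mem (List.mem_map_of_mem (f := fun κ : Constr => κ.2.1.length) hκ)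
  -- `S n` records the solution for `n` together with the slack of each inequality. By Dickson's
  -- lemma some `m < n` have `S m ≤ S n`, and then `z n - z m` is a natural vector solving the
  -- recession system for the multiple `n - m`.
  let S : ℕ → Fin q ⊕ Fin D.length → ℕ := fun n => Sum.elim (fun i => z n i)
    fun k => (w (D.get k) * n + c (D.get k) + dot (D.get k).2.1 (z n)).toNat
  obtain ⟨m, n, hmn, hle⟩ := wellQuasiOrdered_le S
  refine ⟨n - m, by omega, fun i => if i < q then z n i - z m i else 0, fun κ hκ => ?_⟩
  obtain ⟨k, hk⟩ := List.get_of_mem hκ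
  have h1 : dot κ.2.1 (z n) = dot κ.2.1 (z m) +
      dot κ.2.1 fun i => if i < q then z n i - z m i else 0 := by
    rw [← dot_add]
    refine dot_congr fun i hi => ?_
    have hi' := hi.trans_le (hq κ hκ)
    have := hle (Sum.inl ⟨i, hi'⟩)
    simp only [S, Sum.elim_inl] at this
    rw [if_pos hi']
    omega
  have h2 := hle (Sum.inr k)
  simp only [S, Sum.elim_inr, hk] at h2
  have h3 := hz n κ hκ
  have h4 := hz m κ hκ
  have h5 : w κ * m + c κ + dot κ.2.1 (z m) ≤ w κ * n + c κ + dot κ.2.1 (z n) := by omega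
  rw [h1] at h5
  rw [Nat.cast_sub hmn.le]
  linarith

theorem dot_zero_right (u : List ℤ) : dot u (fun _ => 0) = 0 := by simp [dot]

theorem dot_single (u : List ℤ) (i : ℕ) : dot u (Pi.single i 1) = u.getD i 0 := by
  rw [dot_eq (N := u.length + i + 1) (by omega)]
  simp [Pi.single_apply]

/-- The coefficients required by the check are recovered from values at the origin and at the unit
vectors. -/
theorem leafCheck_of_val {zs : List (List ℕ)} {κ : Constr}
    (h₀ : 0 ≤ Constr.val κ (fun _ => 0) fun l => (zs.getD 0 []).getD l 0)
    (h₁ : ∀ i, 0 ≤ Constr.val κ (Pi.single i 1) (fun l => (zs.getD (i + 1) []).getD l 0) -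
      Constr.val κ (fun _ => 0) fun _ => 0) : leafCheck zs κ := by
  refine (leafCheck_iff _ _).2 ⟨?_, fun i _ => ?_⟩
  · simp only [Constr.val, dot_zero_right] at h₀; linarith
  · have := h₁ i
    simp only [Constr.val, dot_zero_right, dot_single] at this; linarith

theorem val_congr_right {κ : Constr} {q : ℕ} (hq : κ.2.1.length ≤ q) (x z : ℕ → ℕ) :
    Constr.val κ x (fun l => ((List.range q).map z).getD l 0) = Constr.val κ x z := by
  unfold Constr.val
  rw [dot_congr (u := κ.2.1) (y := z)]
  intro i hi
  have := hi.trans_le hq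
  simp [List.getD_eq_getElem?_getD, this]

/-- If a system is solvable on all points of a leaf, then the leaf can be refined by splits into
leaves on which a solution depends on the parameters affinely. -/
theorem tree_leaf {N : ℕ} {D : List Constr} (hD : ∀ κ ∈ D, κ.1.length ≤ N ∧ κ.2.1.length ≤ N)
    {s : (ℕ → ℕ) → ℕ → ℕ} (hs : Adm N s) (hsat : ∀ x, Sat D (s x)) :
    Tree N fun s' => ∃ zs : List (List ℕ), ∀ κ ∈ D, ∀ κ' : Constr,
      (∀ x z, Constr.val κ' x z = Constr.val κ (s (s' x)) z) → leafCheck zs κ' := by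
  have haff : ∀ κ : Constr, ∃ (w : ℕ → ℤ) (c : ℤ), κ ∈ D → ∀ x,
      Constr.val κ (s x) (fun _ => 0) = ∑ i ∈ Finset.range N, w i * x i + c := fun κ => by
    by_cases hκ : κ ∈ D
    · obtain ⟨w, c, h⟩ := hs _ (aff_val (hD κ hκ).1 fun _ => 0)
      exact ⟨w, c, fun _ => h⟩
    · exact ⟨0, 0, fun h => absurd h hκ⟩
  choose w c hwc using haff
  have hval : ∀ κ ∈ D, ∀ x z, Constr.val κ (s x) z =
      ∑ i ∈ Finset.range N, w κ i * x i + c κ + dot κ.2.1 z := fun κ hκ x z => by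
    rw [← hwc κ hκ x]
    simp only [Constr.val, dot_zero_right]; ring
  -- Along the `i`-th axis, solvability at all points `n e_i` yields a recession solution `z i` for
  -- the step `m i`.
  have hrec : ∀ i, ∃ (m : ℕ) (_ : 0 < m) (z : ℕ → ℕ), i < N →
      ∀ κ ∈ D, 0 ≤ m * w κ i + dot κ.2.1 z := fun i => by
    by_cases hi : i < N
    · have := exists_recession (D := D) (fun κ => w κ i) c fun n => by
        obtain ⟨z, hz⟩ := hsat (Pi.single i n)
        refine ⟨z, fun κ hκ => ?_⟩
        have := hz κ hκ
        rw [hval κ hκ] at this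
        simpa [Pi.single_apply, hi] using this
      obtain ⟨m, hm, z, hz⟩ := this
      exact ⟨m, hm, z, fun _ => hz⟩
    · exact ⟨1, one_pos, 0, fun h => absurd h hi⟩
  choose m hm z hz using hrec
  -- With `x_i = m i * x_i' + ρ i`, a solution `z₀` at `x' = 0` plus `∑ x_i' z i` solves the system
  -- on the whole leaf.
  refine (Tree.mod_all N m hm).mono fun s' ⟨ρ, hρ⟩ => ?_
  obtain ⟨z₀, hz₀⟩ := hsat (s' fun _ => 0)
  refine ⟨((List.range N).map z₀) :: (List.range N).map fun i => (List.range N).map (z i),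
    fun κ hκ κ' hκ' => leafCheck_of_val ?_ fun i => ?_⟩
  · rw [hκ', List.getD_cons_zero, val_congr_right (hD κ hκ).2]
    exact hz₀ κ hκ
  · rw [hκ', hκ', hval κ hκ, hval κ hκ, dot_zero_right, List.getD_cons_succ]
    have hsum : ∀ x, ∑ j ∈ Finset.range N, w κ j * (s' x j : ℤ) =
        ∑ j ∈ Finset.range N, (w κ j * m j) * (x j : ℤ) + ∑ j ∈ Finset.range N, w κ j * ρ j :=
      fun x => by
        rw [← Finset.sum_add_distrib]
        refine Finset.sum_congr rfl fun j hj => ?_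
        rw [hρ x j (by simpa using hj)]; push_cast; ring
    rw [hsum, hsum]
    by_cases hi : i < N
    · have h1 : ((List.range N).map fun i => (List.range N).map (z i)).getD i [] =
          (List.range N).map (z i) := by
        simp [List.getD_eq_getElem?_getD, hi]
      have h2 := val_congr_right (κ := κ) (hD κ hκ).2 (fun _ => 0) (z i)
      simp only [Constr.val, dot_zero_right, zero_add] at h2
      rw [h1]
      have := hz i hi κ hκ
      simp [Pi.single_apply, hi]
      simp at h2
      linarith
    · have h1 : ((List.range N).map fun i => (List.range N).map (z i)).getD i [] = [] :=
        List.getD_eq_default _ _ (by simpa using hi)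
      rw [h1]
      simp [Pi.single_apply, hi, dot_zero_right]

/-- Completeness of the calculus. First split until each of the finitely many systems is solvable
everywhere or nowhere on every leaf, then refine the leaves to obtain affine solutions. -/
theorem Goal.Valid.provable {G : Goal} (hG : G.Valid) : G.Provable := by
  obtain ⟨N, hN⟩ := exists_length_bound G
  have hres : ∀ L : List (List Constr), (∀ D ∈ L, D ∈ G) →
      Tree N fun s => ∀ D ∈ L, (∀ x, Sat D (s x)) ∨ ∀ x, ¬ Sat D (s x) := by
    intro L
    induction L with
    | nil => exact fun _ => .leaf (by simp)
    | cons D L ih =>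
      intro hL
      refine (ih fun D' hD' => hL D' (by simp [hD'])).bind fun s hs h => ?_
      refine (resolvable_sat (hN D (hL D (by simp))) s hs).mono fun s' h' => ?_
      intro D' hD'
      rcases List.mem_cons.1 hD' with rfl | hD'
      · exact h'
      · exact (h D' hD').imp (fun h x => h _) fun h x => h _
  have htree : Tree N fun s => ∃ D ∈ G, ∃ zs : List (List ℕ), ∀ κ ∈ D, ∀ κ' : Constr,
      (∀ x z, Constr.val κ' x z = Constr.val κ (s x) z) → leafCheck zs κ' := by
    refine (hres G fun _ h => h).bind fun s hs h => ?_
    -- Validity at a single point of the leaf picks a system solvable there, hence on the entire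
    -- leaf.
    obtain ⟨D, hD, z, hz⟩ := hG (s fun _ => 0)
    have hsat : ∀ x, Sat D (s x) := (h D hD).resolve_right fun h => h _ ⟨z, hz⟩
    exact (tree_leaf (hN D hD) hs hsat).mono fun s' h => ⟨D, hD, h⟩
  refine htree.provable (Goal.Pull.refl G) fun s G' ⟨D, hD, zs, hzs⟩ hpull => ?_
  obtain ⟨i, hi, rfl⟩ := List.getElem_of_mem hD
  have hlen := hpull.length_eq
  have hi' : i < G'.length := hlen ▸ hi
  refine .leaf zs (List.getElem_mem hi') fun κ' hκ' => ?_
  have hD' := hpull.get (i := i) hi hi'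
  simp only [List.get_eq_getElem] at hD'
  obtain ⟨k, hk, rfl⟩ := List.getElem_of_mem hκ'
  have hk' : k < G[i].length := hD'.length_eq ▸ hk
  have := hD'.get (i := k) hk' hk
  exact hzs _ (List.getElem_mem hk') _ this

/-- Certificates exist exactly for lists of valid goals. -/
theorem exists_runCert_iff (L : List Goal) :
    (∃ l, runCert L l = []) ↔ ∀ G ∈ L, G.Valid := by
  refine ⟨fun ⟨l, hl⟩ => valid_of_runCert hl, fun h => ?_⟩
  obtain ⟨l, hl⟩ := exists_runCert_list fun G hG => (h G hG).provable.exists_runCert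
  exact ⟨l, by simpa using hl []⟩

end VirtAbelian

/-! ### Arithmetic of normal forms -/

namespace VirtAbelian

namespace Description

variable {G : Type*} [Group G] (D : Description G)

/-- The element `b₁^{z₁} ⋯ bₙ^{zₙ}`. -/
def avec (z : Fin D.rank → ℤ) : G := (List.ofFn fun i => D.b i ^ z i).prod

theorem nfValue_eq (c : NormalForm D.rank D.numT) : nfValue D.b D.t c = D.avec c.1 * D.t c.2 := rfl

theorem prod_ofFn_zpow_add {G : Type*} [Group G] {n : ℕ} (b : Fin n → G)
    (hb : ∀ i j, Commute (b i) (b j)) (z z' : Fin n → ℤ) :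
    (List.ofFn fun i => b i ^ (z i + z' i)).prod =
      (List.ofFn fun i => b i ^ z i).prod * (List.ofFn fun i => b i ^ z' i).prod := by
  induction n with
  | zero => simp
  | succ n ih =>
    simp only [List.ofFn_succ, List.prod_cons]
    rw [ih (fun i => b i.succ) (fun i j => hb _ _), zpow_add]
    have : Commute (b 0 ^ z' 0) (List.ofFn fun i : Fin n => b i.succ ^ z i.succ).prod :=
      Commute.list_prod_right _ _ fun x hx => by
        obtain ⟨i, rfl⟩ := (List.mem_ofFn' _ _).1 hx
        exact (hb _ _).zpow_zpow _ _
    rw [mul_assoc, ← mul_assoc (b 0 ^ z' 0), this.eq]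
    simp only [mul_assoc]

theorem avec_add (z z' : Fin D.rank → ℤ) : D.avec (z + z') = D.avec z * D.avec z' :=
  prod_ofFn_zpow_add D.b D.b_commute z z'

theorem avec_zero : D.avec 0 = 1 := by
  have := D.avec_add 0 0
  rwa [add_zero, left_eq_mul] at this

theorem avec_neg (z : Fin D.rank → ℤ) : D.avec (-z) = (D.avec z)⁻¹ := by
  rw [eq_inv_iff_mul_eq_one, ← avec_add, neg_add_cancel, avec_zero]

theorem avec_injective : Function.Injective D.avec := by
  intro z z' h
  have : D.avec (z - z') = 1 := by rw [sub_eq_add_neg, avec_add, avec_neg, h, mul_inv_cancel]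
  exact sub_eq_zero.1 (D.b_independent _ this)

theorem avec_single (i : Fin D.rank) : D.avec (Pi.single i 1) = D.b i := by
  unfold avec
  have key : ∀ (n : ℕ) (b : Fin n → G) (i : Fin n),
      (List.ofFn fun j => b j ^ (Pi.single i (1 : ℤ) : Fin n → ℤ) j).prod = b i := by
    intro n
    induction n with
    | zero => exact fun _ i => i.elim0
    | succ n ih =>
      intro b i
      rw [List.ofFn_succ, List.prod_cons]
      refine Fin.cases ?_ (fun i => ?_) i
      · simp
      · have e : ∀ j : Fin n, (Pi.single i.succ (1 : ℤ) : Fin (n + 1) → ℤ) j.succ =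
            (Pi.single i (1 : ℤ) : Fin n → ℤ) j := fun j => by
          simp [Pi.single_apply]
        simp only [e, ih (fun j => b j.succ) i]
        simp
  exact key _ _ i

theorem avec_mem (z : Fin D.rank → ℤ) : D.avec z ∈ D.A :=
  list_prod_mem fun x hx => by
    obtain ⟨i, rfl⟩ := (List.mem_ofFn' _ _).1 hx
    refine D.A.zpow_mem ?_ _
    rw [← D.b_generate]
    exact Subgroup.subset_closure ⟨i, rfl⟩

def avecHom : Multiplicative (Fin D.rank → ℤ) →* G where
  toFun z := D.avec z.toAdd
  map_one' := D.avec_zero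
  map_mul' _ _ := D.avec_add _ _

theorem exists_avec {g : G} (hg : g ∈ D.A) : ∃ z, D.avec z = g := by
  have : D.A ≤ D.avecHom.range := by
    rw [← D.b_generate, Subgroup.closure_le]
    rintro _ ⟨i, rfl⟩
    exact ⟨Multiplicative.ofAdd (Pi.single i 1), D.avec_single i⟩
  obtain ⟨z, hz⟩ := this hg
  exact ⟨z.toAdd, hz⟩

theorem exists_nf (g : G) : ∃ c, nfValue D.b D.t c = g := by
  obtain ⟨j, hj⟩ := D.t_transversal.2 (QuotientGroup.mk g)
  have h1 : (D.t j)⁻¹ * g ∈ D.A := QuotientGroup.eq.1 hj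
  have h2 : g * (D.t j)⁻¹ ∈ D.A := by
    have := D.normal.conj_mem _ h1 (D.t j)
    rwa [mul_inv_cancel_left] at this
  obtain ⟨z, hz⟩ := D.exists_avec h2
  exact ⟨(z, j), by rw [nfValue_eq, hz, inv_mul_cancel_right]⟩

theorem nfValue_injective : Function.Injective (nfValue D.b D.t) := by
  rintro ⟨z, j⟩ ⟨z', j'⟩ h
  simp only [nfValue_eq] at h
  have hj : j = j' := by
    refine D.t_transversal.1 (QuotientGroup.eq.2 ?_)
    have h1 : D.t j * (D.t j')⁻¹ ∈ D.A := by
      have : D.t j * (D.t j')⁻¹ = D.avec (-z + z') := by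
        rw [avec_add, avec_neg, eq_inv_mul_iff_mul_eq, ← mul_assoc, h, mul_inv_cancel_right]
      rw [this]
      exact D.avec_mem _
    have h2 := D.normal.conj_mem _ (D.A.inv_mem h1) (D.t j)⁻¹
    simpa [mul_assoc] using h2
  subst hj
  rw [mul_left_inj] at h
  rw [D.avec_injective h]

noncomputable def nf (g : G) : NormalForm D.rank D.numT := (D.exists_nf g).choose

theorem nfValue_nf (g : G) : nfValue D.b D.t (D.nf g) = g := (D.exists_nf g).choose_spec

theorem nf_nfValue (c : NormalForm D.rank D.numT) : D.nf (nfValue D.b D.t c) = c :=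
  D.nfValue_injective (D.nfValue_nf _)

theorem nf_injective : Function.Injective D.nf := fun g h e => by
  rw [← D.nfValue_nf g, e, D.nfValue_nf]

theorem nf_eq_iff {g : G} {c : NormalForm D.rank D.numT} : D.nf g = c ↔ g = nfValue D.b D.t c :=
  ⟨fun h => by rw [← h, nfValue_nf], fun h => by rw [h, nf_nfValue]⟩

theorem nf_avec_mul (z : Fin D.rank → ℤ) (g : G) :
    D.nf (D.avec z * g) = (z + (D.nf g).1, (D.nf g).2) := by
  rw [nf_eq_iff, nfValue_eq]
  conv_lhs => rw [← D.nfValue_nf g, nfValue_eq]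
  rw [avec_add, mul_assoc]

/-- The transversal need not contain `1`, so `A` is recognised by the transversal symbol in the
normal form of `1`. -/
theorem mem_A_iff_nf {g : G} : g ∈ D.A ↔ (D.nf g).2 = (D.nf 1).2 := by
  constructor
  · intro h
    obtain ⟨z, rfl⟩ := D.exists_avec h
    have := D.nf_avec_mul z 1
    rw [mul_one] at this
    rw [this]
  · intro h
    have h1 := D.nfValue_nf g
    have h2 := D.nfValue_nf 1
    rw [nfValue_eq] at h1 h2
    rw [h] at h1
    have h3 : D.t (D.nf 1).2 = D.avec (-(D.nf 1).1) := by
      rw [avec_neg]; exact eq_inv_of_mul_eq_one_right h2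
    rw [← h1, h3]
    exact D.A.mul_mem (D.avec_mem _) (D.avec_mem _)

theorem index_eq : D.A.index = D.numT := by
  have := Nat.card_congr (Equiv.ofBijective _ D.t_transversal)
  rw [Nat.card_eq_fintype_card, Fintype.card_fin] at this
  exact this.symm

theorem numT_pos : 0 < D.numT := (D.nf 1).2.pos

/-- Conjugation, in coordinates. -/
theorem exists_conj (g : G) : ∃ C : (Fin D.rank → ℤ) →+ (Fin D.rank → ℤ),
    ∀ z, g * D.avec z = D.avec (C z) * g := by
  have h : ∀ z, ∃ z', D.avec z' = g * D.avec z * g⁻¹ := fun z =>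
    D.exists_avec (D.normal.conj_mem _ (D.avec_mem z) g)
  choose C hC using h
  refine ⟨{ toFun := C, map_zero' := ?_, map_add' := fun z z' => ?_ }, fun z => ?_⟩
  · apply D.avec_injective; simp [hC, avec_zero]
  · apply D.avec_injective; simp [hC, avec_add, mul_assoc]
  · simp [hC]

/-- By normality `t_j b_i` lies in `A t_j`; uniqueness of normal forms then forces the tabulated
transversal symbol to be `t_j` again. -/
theorem f_t_b (j : Fin D.numT) (i : Fin D.rank) :
    D.t j * D.b i = D.avec (D.f (Sum.inr j, true) (Sum.inl i, true)).1 * D.t j := by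
  have h := D.f_spec (Sum.inr j, true) (Sum.inl i, true)
  simp only [symbolValue, Sum.elim_inr, Sum.elim_inl, if_true] at h
  obtain ⟨C, hC⟩ := D.exists_conj (D.t j)
  have h1 : D.t j * D.b i = nfValue D.b D.t (C (Pi.single i 1), j) := by
    rw [← avec_single, hC, nfValue_eq]
  have h2 := D.nfValue_injective (h.trans h1)
  rw [h2, h1, nfValue_eq]

theorem t_mul_avec (j : Fin D.numT) (z : Fin D.rank → ℤ) :
    D.t j * D.avec z =
      D.avec (∑ i, z i • (D.f (Sum.inr j, true) (Sum.inl i, true)).1) * D.t j := by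
  obtain ⟨C, hC⟩ := D.exists_conj (D.t j)
  have h1 : ∀ i, C (Pi.single i 1) = (D.f (Sum.inr j, true) (Sum.inl i, true)).1 := fun i => by
    apply D.avec_injective
    have := D.f_t_b j i
    rwa [← avec_single, hC, mul_left_inj] at this
  rw [hC]
  congr 2
  have h2 : z = ∑ i, z i • Pi.single i (1 : ℤ) := by
    ext k; simp [Finset.sum_apply, Pi.single_apply]
  conv_lhs => rw [h2]
  simp only [map_sum, map_zsmul, h1]

/-- Collection: in `a t_j a' t_l` the factor `t_j` moves past `a'` by conjugation, which is additive
on exponents and determined by the table entries of `t_j b_i`; the entry of `t_j t_l` finishes the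
product. Thus the table alone suffices to multiply. -/
theorem nf_mul (g h : G) :
    D.nf (g * h) = ((D.nf g).1 +
      ∑ i, (D.nf h).1 i • (D.f (Sum.inr (D.nf g).2, true) (Sum.inl i, true)).1 +
      (D.f (Sum.inr (D.nf g).2, true) (Sum.inr (D.nf h).2, true)).1,
      (D.f (Sum.inr (D.nf g).2, true) (Sum.inr (D.nf h).2, true)).2) := by
  rw [nf_eq_iff, nfValue_eq]
  have hf := D.f_spec (Sum.inr (D.nf g).2, true) (Sum.inr (D.nf h).2, true)
  simp only [symbolValue, Sum.elim_inr, if_true, nfValue_eq] at hf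
  conv_lhs => rw [← D.nfValue_nf g, ← D.nfValue_nf h, nfValue_eq, nfValue_eq]
  simp only [avec_add, mul_assoc, hf]
  rw [← mul_assoc (D.t _) (D.avec _), t_mul_avec]
  simp only [mul_assoc]

theorem nf_one : D.nf 1 = D.f (Sum.inr ⟨0, D.numT_pos⟩, true) (Sum.inr ⟨0, D.numT_pos⟩, false) := by
  rw [nf_eq_iff, D.f_spec]
  simp [symbolValue]

end Description

/-! #### The same on codes -/

def tableEntry (I : InputCode) (p q : ℕ) : NFCode := (I.1.2.2.getD p []).getD q ([], 0)

def inputRank (I : InputCode) : ℕ := I.1.1.1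

def inputIndex (I : InputCode) : ℕ := I.1.1.2

/-- The formula of `nf_mul` on codes; the symbol `t_j` sits at position `inputRank I + j` of the
table. -/
def mulCode (I : InputCode) (c c' : NFCode) : NFCode :=
  ((List.range (inputRank I)).map fun k =>
      c.1.getD k 0 +
        ((List.range (inputRank I)).map fun i =>
          c'.1.getD i 0 * (tableEntry I (inputRank I + c.2) i).1.getD k 0).sum +
        (tableEntry I (inputRank I + c.2) (inputRank I + c'.2)).1.getD k 0,
    (tableEntry I (inputRank I + c.2) (inputRank I + c'.2)).2)

/-- The entry of the first transversal symbol times its inverse; the inverse transversal symbols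
follow the blocks of `b`, `t` and `b⁻¹`. -/
def oneCode (I : InputCode) : NFCode :=
  tableEntry I (inputRank I) (inputRank I + inputIndex I + inputRank I)

def wordCode (I : InputCode) (w : List ℕ) : NFCode :=
  w.foldr (fun a s => mulCode I (I.2.1.getD a ([], 0)) s) (oneCode I)

section

variable {G : Type*} [Group G] (D : Description G) {k : ℕ}
  (gen : Fin k → NormalForm D.rank D.numT) (ω : Fin k → ℕ)

theorem symbolList_inl_true {n d : ℕ} (i : Fin n) :
    (symbolList n d)[(i : ℕ)]? = some (Sum.inl i, true) := by
  simp only [symbolList, List.append_assoc]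
  rw [List.getElem?_append_left (by simp)]
  simp

theorem symbolList_inr_true {n d : ℕ} (j : Fin d) :
    (symbolList n d)[n + (j : ℕ)]? = some (Sum.inr j, true) := by
  simp only [symbolList, List.append_assoc]
  rw [List.getElem?_append_right (by simp), List.getElem?_append_left (by simp)]
  simp

theorem symbolList_inr_false {n d : ℕ} (j : Fin d) :
    (symbolList n d)[n + d + n + (j : ℕ)]? = some (Sum.inr j, false) := by
  simp only [symbolList]
  rw [List.getElem?_append_right (by simp; omega)]
  simp only [List.length_append, List.length_ofFn, List.getElem?_ofFn, Option.dite_none_right_eq_some,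
    Option.some.injEq, Prod.mk.injEq, Sum.inr.injEq, and_true]
  exact ⟨by omega, Fin.ext (by simp only; omega)⟩

theorem tableEntry_eq {p q : ℕ} {g h : Symbol D.rank D.numT}
    (hp : (symbolList D.rank D.numT)[p]? = some g) (hq : (symbolList D.rank D.numT)[q]? = some h) :
    tableEntry (D.inputCode gen ω) p q = nfCode (D.f g h) := by
  simp [tableEntry, Description.inputCode, Description.code, List.getD_eq_getElem?_getD, hp, hq]

theorem getD_nfCode (c : NormalForm D.rank D.numT) (i : Fin D.rank) :
    (nfCode c).1.getD i 0 = c.1 i := by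
  simp [nfCode, List.getD_eq_getElem?_getD]

theorem mulCode_nf (g h : G) :
    mulCode (D.inputCode gen ω) (nfCode (D.nf g)) (nfCode (D.nf h)) = nfCode (D.nf (g * h)) := by
  have hr : inputRank (D.inputCode gen ω) = D.rank := rfl
  have h2 : ∀ c : NormalForm D.rank D.numT, (nfCode c).2 = c.2 := fun _ => rfl
  have e1 : tableEntry (D.inputCode gen ω) (D.rank + ((D.nf g).2 : ℕ))
      (D.rank + ((D.nf h).2 : ℕ)) =
      nfCode (D.f (Sum.inr (D.nf g).2, true) (Sum.inr (D.nf h).2, true)) :=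
    tableEntry_eq D gen ω (symbolList_inr_true _) (symbolList_inr_true _)
  have e2 : ∀ i : Fin D.rank, tableEntry (D.inputCode gen ω) (D.rank + ((D.nf g).2 : ℕ)) i =
      nfCode (D.f (Sum.inr (D.nf g).2, true) (Sum.inl i, true)) := fun i =>
    tableEntry_eq D gen ω (symbolList_inr_true _) (symbolList_inl_true _)
  rw [D.nf_mul]
  refine Prod.ext ?_ ?_
  · simp only [mulCode, hr, h2, e1]
    refine List.ext_getElem (by simp [nfCode]) fun l hl hl' => ?_
    have hl0 : l < D.rank := by simpa using hl
    rw [List.getElem_map, List.getElem_range, sum_map_range, Finset.sum_range]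
    have g1 := fun c => getD_nfCode D c ⟨l, hl0⟩
    simp only at g1
    simp only [e2, getD_nfCode, g1]
    simp [nfCode, Finset.sum_apply]
  · simp only [mulCode, hr, h2, e1]

theorem oneCode_nf : oneCode (D.inputCode gen ω) = nfCode (D.nf 1) := by
  rw [D.nf_one]
  have h1 := symbolList_inr_true (n := D.rank) (⟨0, D.numT_pos⟩ : Fin D.numT)
  have h2 := symbolList_inr_false (n := D.rank) (⟨0, D.numT_pos⟩ : Fin D.numT)
  exact tableEntry_eq D gen ω (p := D.rank) (q := D.rank + D.numT + D.rank) h1 h2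

theorem wordCode_nf (w : List (Fin k)) :
    wordCode (D.inputCode gen ω) (w.map fun i : Fin k => (i : ℕ)) =
      nfCode (D.nf (wordValue (fun i => nfValue D.b D.t (gen i)) w)) := by
  induction w with
  | nil => exact oneCode_nf D gen ω
  | cons a w ih =>
    have e : (D.inputCode gen ω).2.1.getD a ([], 0) =
        nfCode (D.nf (nfValue D.b D.t (gen a))) := by
      rw [D.nf_nfValue]
      simp [Description.inputCode, List.getD_eq_getElem?_getD]
    have : wordCode (D.inputCode gen ω) ((a :: w).map fun i : Fin k => (i : ℕ)) =
        mulCode (D.inputCode gen ω) ((D.inputCode gen ω).2.1.getD a ([], 0))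
          (wordCode (D.inputCode gen ω) (w.map fun i : Fin k => (i : ℕ))) := rfl
    rw [this, ih, e, mulCode_nf]
    rfl

theorem nfCode_injective {n d : ℕ} : Function.Injective (nfCode : NormalForm n d → NFCode) := by
  rintro ⟨z, j⟩ ⟨z', j'⟩ h
  simp only [nfCode, Prod.mk.injEq] at h
  exact Prod.ext (List.ofFn_injective h.1) (Fin.ext h.2)

end

@[fun_prop] theorem primrec_wordCode {α : Type*} [Primcodable α] {I : α → InputCode}
    {w : α → List ℕ} (hI : Primrec I) (hw : Primrec w) : Primrec fun x => wordCode (I x) (w x) := by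
  unfold wordCode mulCode oneCode tableEntry inputRank inputIndex
  fun_prop

end VirtAbelian

/-! ### Patterned words over the alphabet `ℕ` -/

namespace VirtAbelian

section PatternedWords

variable {G : Type*} [Group G]

/-- The value of a word over `ℕ` under an interpretation of the letters. -/
def val (s : ℕ → G) (w : List ℕ) : G := (w.map s).prod

def weight (o : ℕ → ℕ) (w : List ℕ) : ℕ := (w.map o).sum

theorem val_append (s : ℕ → G) (u v : List ℕ) : val s (u ++ v) = val s u * val s v := by simp [val]

theorem weight_append (o : ℕ → ℕ) (u v : List ℕ) : weight o (u ++ v) = weight o u + weight o v := by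
  simp [weight]

theorem val_nil (s : ℕ → G) : val s [] = 1 := rfl

theorem weight_nil (o : ℕ → ℕ) : weight o [] = 0 := rfl

/-- Letters are plain natural numbers and exponents form an infinite sequence. Patterns of different
lengths then have parameters of one type, and the words are primitive recursive in their data. -/
def powWord (x : List (List ℕ)) (w : ℕ → ℕ) (l : ℕ) : List ℕ :=
  (List.range x.length).flatMap fun i =>
    (List.replicate (w (l * x.length + i)) (x.getD i [])).flatten

def patWord (x y : List (List ℕ)) (π : List ℕ) (w : ℕ → ℕ) : List ℕ :=
  powWord x w 0 ++
    (List.range π.length).flatMap fun l => y.getD (π.getD l 0) [] ++ powWord x w (l + 1)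

variable (x y : List (List ℕ))

theorem powWord_succ (w : ℕ → ℕ) (l : ℕ) :
    powWord x w (l + 1) = powWord x (fun i => w (i + x.length)) l := by
  unfold powWord
  congr 1
  funext i
  congr 3
  ring

theorem patWord_nil (w : ℕ → ℕ) : patWord x y [] w = powWord x w 0 := by simp [patWord]

theorem patWord_cons (p : ℕ) (π : List ℕ) (w : ℕ → ℕ) :
    patWord x y (p :: π) w =
      powWord x w 0 ++ (y.getD p [] ++ patWord x y π fun i => w (i + x.length)) := by
  unfold patWord
  rw [List.length_cons, List.range_succ_eq_map, List.flatMap_cons, List.flatMap_map]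
  simp only [List.getD_cons_zero, List.getD_cons_succ, powWord_succ, List.append_assoc]

theorem patWord_append_singleton (p : ℕ) (π : List ℕ) (w : ℕ → ℕ) :
    patWord x y (π ++ [p]) w =
      patWord x y π w ++ (y.getD p [] ++ powWord x w (π.length + 1)) := by
  induction π generalizing w with
  | nil => simp [patWord_cons, patWord_nil, powWord_succ]
  | cons a π ih =>
    rw [List.cons_append, patWord_cons, patWord_cons, ih, List.length_cons, powWord_succ x w]
    simp

theorem mem_powWord {w : ℕ → ℕ} {l a : ℕ} (h : a ∈ powWord x w l) : ∃ u ∈ x, a ∈ u := by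
  simp only [powWord, List.mem_flatMap, List.mem_range, List.mem_flatten, List.mem_replicate] at h
  obtain ⟨i, hi, u, ⟨_, rfl⟩, ha⟩ := h
  rw [List.getD_eq_getElem _ _ hi] at ha
  exact ⟨_, List.getElem_mem hi, ha⟩

theorem mem_of_mem_getD {y : List (List ℕ)} {p a : ℕ} (h : a ∈ y.getD p []) :
    ∃ u ∈ y, a ∈ u := by
  by_cases hp : p < y.length
  · rw [List.getD_eq_getElem _ _ hp] at h
    exact ⟨_, List.getElem_mem hp, h⟩
  · rw [List.getD_eq_default _ _ (by omega)] at h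
    simp at h

theorem mem_patWord {π : List ℕ} {w : ℕ → ℕ} {a : ℕ} (h : a ∈ patWord x y π w) :
    ∃ u ∈ x ++ y, a ∈ u := by
  simp only [patWord, List.mem_append, List.mem_flatMap] at h
  rcases h with h | ⟨l, _, h | h⟩
  · obtain ⟨u, hu, ha⟩ := mem_powWord x h
    exact ⟨u, List.mem_append_left _ hu, ha⟩
  · obtain ⟨u, hu, ha⟩ := mem_of_mem_getD h
    exact ⟨u, List.mem_append_right _ hu, ha⟩
  · obtain ⟨u, hu, ha⟩ := mem_powWord x h
    exact ⟨u, List.mem_append_left _ hu, ha⟩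

theorem patWord_congr {π : List ℕ} {w w' : ℕ → ℕ}
    (h : ∀ i < (π.length + 1) * x.length, w i = w' i) :
    patWord x y π w = patWord x y π w' := by
  have hp : ∀ l ≤ π.length, powWord x w l = powWord x w' l := by
    intro l hl
    unfold powWord
    simp only [List.flatMap]
    congr 1
    refine List.map_congr_left fun i hi => ?_
    have hi : i < x.length := by simpa using hi
    rw [h]
    calc l * x.length + i < l * x.length + x.length := by omega
      _ = (l + 1) * x.length := by ring
      _ ≤ _ := Nat.mul_le_mul_right _ (by omega)
  unfold patWord
  rw [hp 0 (by omega)]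
  congr 1
  simp only [List.flatMap]
  congr 1
  refine List.map_congr_left fun l hl => ?_
  rw [hp (l + 1) (by simpa using hl)]

theorem powWord_zero (l : ℕ) : powWord x 0 l = [] := by simp [powWord]

/-! #### Weights -/

theorem weight_powWord (o : ℕ → ℕ) (w : ℕ → ℕ) (l : ℕ) :
    weight o (powWord x w l) =
      ∑ i ∈ Finset.range x.length, w (l * x.length + i) * weight o (x.getD i []) := by
  unfold powWord
  generalize x.length = m
  have key : ∀ r : ℕ, weight o ((List.range r).flatMap fun i =>
      (List.replicate (w (l * m + i)) (x.getD i [])).flatten) =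
      ∑ i ∈ Finset.range r, w (l * m + i) * weight o (x.getD i []) := by
    intro r
    induction r with
    | zero => simp [weight]
    | succ r ih =>
      rw [List.range_succ, List.flatMap_append, weight_append, ih, Finset.sum_range_succ]
      congr 1
      have : ∀ n (u : List ℕ), weight o (List.replicate n u).flatten = n * weight o u := by
        intro n u
        induction n with
        | zero => simp [weight]
        | succ n ih => rw [List.replicate_succ, List.flatten_cons, weight_append, ih]; ring
      simp [this]
  exact key m

/-- Exponent number `i` belongs to the word `x_{i mod r}`, whichever block it stands in. -/
theorem weight_patWord (o : ℕ → ℕ) (π : List ℕ) (w : ℕ → ℕ) :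
    weight o (patWord x y π w) = weight o (patWord x y π 0) +
      ∑ i ∈ Finset.range ((π.length + 1) * x.length), w i * weight o (x.getD (i % x.length) []) := by
  induction π generalizing w with
  | nil =>
    simp only [patWord_nil, weight_powWord, powWord_zero, weight_nil]
    simp only [zero_mul, zero_add, List.length_nil, one_mul]
    exact Finset.sum_congr rfl fun i hi => by rw [Nat.mod_eq_of_lt (by simpa using hi)]
  | cons p π ih =>
    rw [patWord_cons, patWord_cons, weight_append, weight_append, weight_append, weight_append,
      ih, powWord_zero, weight_nil]
    have e : ((p :: π).length + 1) * x.length = x.length + (π.length + 1) * x.length := by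
      rw [List.length_cons]; ring
    rw [e, Finset.sum_range_add, weight_powWord]
    have h1 : ∑ i ∈ Finset.range x.length, w (0 * x.length + i) * weight o (x.getD i []) =
        ∑ i ∈ Finset.range x.length, w i * weight o (x.getD (i % x.length) []) :=
      Finset.sum_congr rfl fun i hi => by
        rw [Nat.mod_eq_of_lt (by simpa using hi), zero_mul, zero_add]
    have h2 : (fun i => (0 : ℕ → ℕ) (i + x.length)) = 0 := rfl
    rw [h1, h2]
    simp only [Nat.add_mod_left]
    have h3 : ∀ i, w (i + x.length) = w (x.length + i) := fun i => by rw [add_comm]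
    simp only [h3]
    ring

/-! #### Values -/

variable (A : Subgroup G) (s : ℕ → G)

theorem val_powWord_mem (hx : ∀ u ∈ x, val s u ∈ A) (w : ℕ → ℕ) (l : ℕ) :
    val s (powWord x w l) ∈ A := by
  have h1 : ∀ L : List (List ℕ), (∀ u ∈ L, val s u ∈ A) → val s L.flatten ∈ A := by
    intro L
    induction L with
    | nil => exact fun _ => A.one_mem
    | cons u L ih =>
      intro h
      rw [List.flatten_cons, val_append]
      exact A.mul_mem (h u (by simp)) (ih fun v hv => h v (by simp [hv]))
  unfold powWord List.flatMap
  refine h1 _ fun u hu => ?_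
  obtain ⟨i, hi, rfl⟩ := List.mem_map.1 hu
  refine h1 _ fun v hv => ?_
  rw [List.eq_of_mem_replicate hv, List.getD_eq_getElem _ _ (by simpa using hi)]
  exact hx _ (List.getElem_mem _)

/-- The image of the prefix of length `l` of a pattern. -/
def patPrefix (π : List ℕ) (l : ℕ) : G := ((π.take l).map fun p => val s (y.getD p [])).prod

theorem patPrefix_zero (π : List ℕ) : patPrefix y s π 0 = 1 := rfl

theorem patPrefix_cons (p : ℕ) (π : List ℕ) (l : ℕ) :
    patPrefix y s (p :: π) (l + 1) = val s (y.getD p []) * patPrefix y s π l := by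
  simp [patPrefix]

/-- The power blocks lie in `A`, so only the pattern is visible in the quotient. -/
theorem mk_val_patWord [A.Normal] (hx : ∀ u ∈ x, val s u ∈ A) (π : List ℕ) (w : ℕ → ℕ) :
    ((val s (patWord x y π w) : G) : G ⧸ A) = ((patPrefix y s π π.length : G) : G ⧸ A) := by
  have h1 : ∀ w l, ((val s (powWord x w l) : G) : G ⧸ A) = 1 := fun w l =>
    (QuotientGroup.eq_one_iff _).2 (val_powWord_mem x A s hx w l)
  induction π generalizing w with
  | nil => rw [patWord_nil, h1]; rfl
  | cons p π ih =>
    rw [patWord_cons, val_append, val_append, List.length_cons, patPrefix_cons]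
    simp only [QuotientGroup.mk_mul, h1, ih, one_mul]

theorem val_powWord_add_single (hA : ∀ a ∈ A, ∀ b ∈ A, a * b = b * a) (hx : ∀ u ∈ x, val s u ∈ A) (w : ℕ → ℕ) {i : ℕ}
    (hi : i < x.length) :
    val s (powWord x (w + Pi.single i 1) 0) = val s (x.getD i []) * val s (powWord x w 0) := by
  have hrep : ∀ n (u : List ℕ), val s (List.replicate n u).flatten = val s u ^ n := by
    intro n u
    induction n with
    | zero => simp [val]
    | succ n ih => rw [List.replicate_succ, List.flatten_cons, val_append, ih, pow_succ']
  have hxi : ∀ j, val s (x.getD j []) ∈ A := fun j => by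
    by_cases hj : j < x.length
    · rw [List.getD_eq_getElem _ _ hj]; exact hx _ (List.getElem_mem _)
    · rw [List.getD_eq_default _ _ (by omega)]; exact A.one_mem
  have key : ∀ r : ℕ, val s ((List.range r).flatMap fun j =>
      (List.replicate ((w + Pi.single i 1 : ℕ → ℕ) j) (x.getD j [])).flatten) =
      (if i < r then val s (x.getD i []) else 1) * val s ((List.range r).flatMap fun j =>
      (List.replicate (w j) (x.getD j [])).flatten) ∧
      val s ((List.range r).flatMap fun j => (List.replicate (w j) (x.getD j [])).flatten) ∈ A := by
    intro r
    induction r with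
    | zero => simp [val_nil, A.one_mem]
    | succ r ih =>
      simp only [List.range_succ, List.flatMap_append, val_append, ih.1, List.flatMap_singleton,
        hrep]
      refine ⟨?_, A.mul_mem ih.2 (A.pow_mem (hxi _) _)⟩
      by_cases hir : i = r
      · subst hir
        simp only [lt_irrefl, if_false, one_mul, Nat.lt_succ_self, if_true, Pi.add_apply,
          Pi.single_eq_same, pow_succ']
        rw [← mul_assoc, ← mul_assoc, hA _ ih.2 _ (hxi i)]
      · have h1 : (Pi.single i 1 : ℕ → ℕ) r = 0 := by simp [Ne.symm hir]
        have h2 : (i < r + 1) ↔ i < r := by omega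
        simp only [Pi.add_apply, h1, add_zero, h2, mul_assoc]
  have := (key x.length).1
  rw [if_pos hi] at this
  simpa [powWord] using this

/-- Increasing one exponent multiplies the value by a conjugate of one of the `x_i`. -/
theorem val_patWord_add_single [A.Normal] (hA : ∀ a ∈ A, ∀ b ∈ A, a * b = b * a)
    (hx : ∀ u ∈ x, val s u ∈ A) (π : List ℕ) {l i : ℕ}
    (hl : l ≤ π.length) (hi : i < x.length) (w : ℕ → ℕ) :
    val s (patWord x y π (w + Pi.single (l * x.length + i) 1)) =
      patPrefix y s π l * val s (x.getD i []) * (patPrefix y s π l)⁻¹ *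
        val s (patWord x y π w) := by
  induction π generalizing l w with
  | nil =>
    obtain rfl : l = 0 := by simpa using hl
    simp [patWord_nil, patPrefix_zero, val_powWord_add_single x A s hA hx w hi]
  | cons p π ih =>
    rw [patWord_cons, patWord_cons, val_append, val_append, val_append, val_append]
    rcases l with _ | l
    · have e : (fun j => (w + Pi.single (0 * x.length + i) 1 : ℕ → ℕ) (j + x.length)) =
          fun j => w (j + x.length) := by
        funext j
        have : j + x.length ≠ i := by omega
        simp [this]
      rw [e, zero_mul, zero_add, val_powWord_add_single x A s hA hx w hi, patPrefix_zero]
      simp [mul_assoc]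
    · have e1 : (fun j => (w + Pi.single ((l + 1) * x.length + i) 1 : ℕ → ℕ) (j + x.length)) =
          (fun j => w (j + x.length)) + Pi.single (l * x.length + i) 1 := by
        funext j
        have : (j + x.length = (l + 1) * x.length + i) ↔ j = l * x.length + i := by
          rw [add_mul]; omega
        simp [Pi.single_apply, this]
      have e2 : powWord x (w + Pi.single ((l + 1) * x.length + i) 1) 0 = powWord x w 0 := by
        unfold powWord
        simp only [List.flatMap]
        congr 1
        refine List.map_congr_left fun j hj => ?_
        have hj : j < x.length := by simpa using hj
        have : 0 * x.length + j ≠ (l + 1) * x.length + i := by rw [add_mul]; omega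
        simp only [Pi.add_apply, Pi.single_apply, if_neg this, add_zero]
      rw [e1, e2, ih (by simpa using hl), patPrefix_cons]
      set β := val s (powWord x w 0)
      set η := val s (y.getD p [])
      set P := patPrefix y s π l
      set ξ := val s (x.getD i [])
      have hβ : β ∈ A := val_powWord_mem x A s hx w 0
      have hξ : ξ ∈ A := by
        simp only [ξ]
        rw [List.getD_eq_getElem _ _ hi]; exact hx _ (List.getElem_mem _)
      -- By normality the conjugate lies in `A`, so it commutes with the block `β` in front of it.
      have hc : η * P * ξ * (η * P)⁻¹ ∈ A := Subgroup.Normal.conj_mem inferInstance _ hξ _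
      rw [← mul_assoc (η * P * ξ * (η * P)⁻¹), hA _ hc _ hβ]
      simp [mul_assoc]

end PatternedWords

end VirtAbelian

/-! ### Every element has an optimal patterned word -/

namespace VirtAbelian

/-! ### The value of a patterned word is affine in its exponents -/

section Affine

variable {G : Type*} [Group G] (D : Description G) (x y : List (List ℕ)) (s : ℕ → G)

theorem exists_affine_powWord (hx : ∀ u ∈ x, val s u ∈ D.A) :
    ∃ F : (ℕ → ℕ) →+ (Fin D.rank → ℤ), ∀ w, val s (powWord x w 0) = D.avec (F w) := by
  have h : ∀ i, ∃ z, D.avec z = val s (x.getD i []) := fun i => by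
    refine D.exists_avec ?_
    by_cases hi : i < x.length
    · rw [List.getD_eq_getElem _ _ hi]; exact hx _ (List.getElem_mem _)
    · rw [List.getD_eq_default _ _ (by omega)]; exact D.A.one_mem
  choose z hz using h
  refine ⟨{ toFun := fun w => ∑ i ∈ Finset.range x.length, (w i : ℤ) • z i
            map_zero' := by simp
            map_add' := fun w w' => by
              rw [← Finset.sum_add_distrib]
              exact Finset.sum_congr rfl fun i _ => by simp [add_smul] }, fun w => ?_⟩
  have hrep : ∀ n i, val s (List.replicate n (x.getD i [])).flatten = D.avec ((n : ℤ) • z i) := by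
    intro n i
    induction n with
    | zero => simp [val, D.avec_zero]
    | succ n ih =>
      rw [List.replicate_succ, List.flatten_cons, val_append, ih, ← hz, ← D.avec_add]
      congr 1
      push_cast
      rw [add_smul, one_smul, add_comm]
  have key : ∀ r : ℕ, val s ((List.range r).flatMap fun j =>
      (List.replicate (w j) (x.getD j [])).flatten) =
      D.avec (∑ i ∈ Finset.range r, (w i : ℤ) • z i) := by
    intro r
    induction r with
    | zero => simp [val_nil, D.avec_zero]
    | succ r ih =>
      rw [List.range_succ, List.flatMap_append, val_append, ih, List.flatMap_singleton, hrep,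
        Finset.sum_range_succ, D.avec_add]
  simpa [powWord] using key x.length

def shiftHom (r : ℕ) : (ℕ → ℕ) →+ (ℕ → ℕ) where
  toFun w i := w (i + r)
  map_zero' := rfl
  map_add' _ _ := rfl

/-- Moving all power blocks to the front conjugates them by pattern letters, and conjugation acts
additively on the exponent vectors of `A`. -/
theorem exists_affine_patWord (hx : ∀ u ∈ x, val s u ∈ D.A) (π : List ℕ) :
    ∃ F : (ℕ → ℕ) →+ (Fin D.rank → ℤ), ∀ w,
      val s (patWord x y π w) = D.avec (F w) * val s (patWord x y π 0) := by
  obtain ⟨F₀, hF₀⟩ := exists_affine_powWord D x s hx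
  induction π with
  | nil => exact ⟨F₀, fun w => by simp [patWord_nil, hF₀, powWord_zero, val_nil]⟩
  | cons p π ih =>
    obtain ⟨F, hF⟩ := ih
    obtain ⟨C, hC⟩ := D.exists_conj (val s (y.getD p []))
    refine ⟨F₀ + C.comp (F.comp (shiftHom x.length)), fun w => ?_⟩
    have e : (fun i => (0 : ℕ → ℕ) (i + x.length)) = 0 := rfl
    rw [patWord_cons, patWord_cons, e, powWord_zero, val_append, val_append, hF₀, hF,
      List.nil_append, val_append, ← mul_assoc (val s _) (D.avec _), hC]
    simp only [AddMonoidHom.add_apply, AddMonoidHom.comp_apply, D.avec_add, mul_assoc]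
    rfl

end Affine

/-! ### Reduction of a word to a patterned word -/

section Optimal

variable {G : Type*} [Group G] {A : Subgroup G} {x y : List (List ℕ)} {s : ℕ → G}

/-- A path with pairwise distinct vertices in `G ⧸ A` is shorter than the index. This bounds every
word that is replaced by some `x_i` or `y_j`. -/
theorem succ_le_card_of_injOn {Q : Type*} [Finite Q] {f : ℕ → Q} {m : ℕ}
    (h : Set.InjOn f (Set.Iic m)) : m + 1 ≤ Nat.card Q := by
  have := Nat.card_le_card_of_injective (fun i : Fin (m + 1) => f i) fun i j hij =>
    Fin.ext (h (Set.mem_Iic.2 (by omega)) (Set.mem_Iic.2 (by omega)) hij)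
  simpa using this

theorem weight_patWord_add_single {o : ℕ → ℕ} {π : List ℕ} {l i : ℕ} (hl : l ≤ π.length)
    (hi : i < x.length) (w : ℕ → ℕ) :
    weight o (patWord x y π (w + Pi.single (l * x.length + i) 1)) =
      weight o (patWord x y π w) + weight o (x.getD i []) := by
  rw [weight_patWord, weight_patWord (w := w), add_assoc]
  congr 1
  have hlt : l * x.length + i < (π.length + 1) * x.length := by
    calc l * x.length + i < (l + 1) * x.length := by rw [add_mul]; omega
      _ ≤ _ := Nat.mul_le_mul_right _ (by omega)
  simp only [Pi.add_apply, add_mul, Finset.sum_add_distrib]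
  congr 1
  rw [Finset.sum_eq_single (l * x.length + i)]
  · rw [Pi.single_eq_same, one_mul, mul_comm l, Nat.mul_add_mod, Nat.mod_eq_of_lt hi]
  · intro j _ hj
    rw [Pi.single_eq_of_ne hj, zero_mul]
  · intro h
    exact absurd (by rw [← add_mul]; exact Finset.mem_range.2 hlt) h

theorem patPrefix_append {π : List ℕ} {l : ℕ} (h : l ≤ π.length) (p : ℕ) :
    patPrefix y s (π ++ [p]) l = patPrefix y s π l := by
  simp [patPrefix, List.take_append_of_le_length h]

theorem patPrefix_append_last (π : List ℕ) (p : ℕ) :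
    patPrefix y s (π ++ [p]) (π.length + 1) =
      patPrefix y s π π.length * val s (y.getD p []) := by
  simp [patPrefix]

theorem exists_patWord_append (π : List ℕ) (p : ℕ) (w : ℕ → ℕ) :
    ∃ w', patWord x y (π ++ [p]) w' = patWord x y π w ++ y.getD p [] := by
  refine ⟨fun i => if i < (π.length + 1) * x.length then w i else 0, ?_⟩
  rw [patWord_append_singleton]
  congr 1
  · exact patWord_congr _ _ fun i hi => if_pos hi
  · have : powWord x (fun i => if i < (π.length + 1) * x.length then w i else 0)
        (π.length + 1) = powWord x 0 (π.length + 1) := by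
      unfold powWord
      simp
    rw [this, powWord_zero, List.append_nil]

/-- A state of the reduction of a word `u`: a pattern with pairwise distinct vertices, and a
simple path `τ` that starts at its last vertex and stays among its vertices. -/
structure Reduction (A : Subgroup G) (x y : List (List ℕ)) (s : ℕ → G) (o : ℕ → ℕ) (k : ℕ)
    (u π : List ℕ) (w : ℕ → ℕ) (τ : List ℕ) : Prop where
  lt_tail : ∀ a ∈ τ, a < k
  lt_pat : ∀ p ∈ π, p < y.length
  val_eq : val s (patWord x y π w) * val s τ = val s u
  weight_le : weight o (patWord x y π w) + weight o τ ≤ weight o u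
  injOn_pat : Set.InjOn (fun l => ((patPrefix y s π l : G) : G ⧸ A)) (Set.Iic π.length)
  injOn_tail : Set.InjOn (fun i => ((patPrefix y s π π.length * val s (τ.take i) : G) : G ⧸ A))
    (Set.Iic τ.length)
  mem : ∀ i ≤ τ.length, ∃ l ≤ π.length,
    ((patPrefix y s π π.length * val s (τ.take i) : G) : G ⧸ A) = ((patPrefix y s π l : G) : G ⧸ A)

variable {o : ℕ → ℕ} {k : ℕ}

/-- The new letter leads to a vertex of the tail, to another vertex of the pattern, or to a new
vertex. In these cases a loop is cut off the tail and stored as an `x_i`, the tail grows, or the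
tail with the letter becomes a letter `y_j` of the pattern. All words replaced have length at most
the index, because the tail is a simple path. -/
theorem Reduction.exists_snoc [A.Normal] (hA : ∀ a ∈ A, ∀ b ∈ A, a * b = b * a)
    (hfin : A.index ≠ 0) (hx : ∀ u ∈ x, val s u ∈ A) (hy : ∀ u ∈ y, val s u ∉ A)
    (hcov : ∀ u : List ℕ, (∀ a ∈ u, a < k) → 1 ≤ u.length → u.length ≤ A.index →
      ∃ v ∈ x ++ y, val s v = val s u ∧ weight o v ≤ weight o u)
    {u π τ : List ℕ} {w : ℕ → ℕ} (h : Reduction A x y s o k u π w τ) {a : ℕ} (ha : a < k) :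
    ∃ π w τ, Reduction A x y s o k (u ++ [a]) π w τ := by
  have : Finite (G ⧸ A) := Nat.finite_of_card_ne_zero hfin
  have hτ : τ.length + 1 ≤ A.index := succ_le_card_of_injOn h.injOn_tail
  have hlt : ∀ b ∈ τ ++ [a], b < k := by
    intro b hb
    rcases List.mem_append.1 hb with hb | hb
    · exact h.lt_tail b hb
    · rw [List.mem_singleton.1 hb]; exact ha
  have hval := h.val_eq
  have hwt := h.weight_le
  by_cases hA1 : ∃ i ≤ τ.length, ((patPrefix y s π π.length * val s (τ.take i) : G) : G ⧸ A) =
      ((patPrefix y s π π.length * val s (τ ++ [a]) : G) : G ⧸ A)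
  -- The tail returns to its vertex `i₀`: the part after `i₀` together with `a` is a loop.
  · obtain ⟨i₀, hi₀, hi⟩ := hA1
    have hsplit : τ = τ.take i₀ ++ τ.drop i₀ := (List.take_append_drop _ _).symm
    have hloop : val s (τ.drop i₀ ++ [a]) ∈ A := by
      have := QuotientGroup.eq.1 hi
      rw [show τ ++ [a] = τ.take i₀ ++ (τ.drop i₀ ++ [a]) by
        rw [← List.append_assoc, ← hsplit], val_append s (τ.take i₀)] at this
      simpa [mul_assoc] using this
    obtain ⟨v, hv, hvv, hvw⟩ := hcov (τ.drop i₀ ++ [a])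
      (fun b hb => by
        rcases List.mem_append.1 hb with hb | hb
        · exact h.lt_tail b (List.mem_of_mem_drop hb)
        · rw [List.mem_singleton.1 hb]; exact ha)
      (by simp) (by simp; omega)
    rcases List.mem_append.1 hv with hv | hv
    swap
    · exact absurd (hvv ▸ hloop) (hy v hv)
    obtain ⟨i, hil, rfl⟩ := List.getElem_of_mem hv
    -- The base of the loop is also the vertex number `l` of the pattern, where the exponent of
    -- `x_i` is raised by one.
    obtain ⟨l, hl, hle⟩ := h.mem i₀ hi₀
    have hgi : x.getD i [] = x[i] := List.getD_eq_getElem _ _ hil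
    refine ⟨π, w + Pi.single (l * x.length + i) 1, τ.take i₀,
      ⟨fun b hb => h.lt_tail b (List.mem_of_mem_take hb), h.lt_pat, ?_, ?_, h.injOn_pat, ?_, ?_⟩⟩
    · rw [val_patWord_add_single x y A s hA hx π hl hil, hgi, hvv, val_append s u, ← hval]
      conv_rhs => rw [hsplit, val_append s (τ.take i₀)]
      rw [← mul_assoc, mul_assoc _ (val s (List.drop i₀ τ)), ← val_append s (τ.drop i₀)]
      set ξ := val s (τ.drop i₀ ++ [a])
      set W := val s (patWord x y π w)
      set τ₀ := val s (τ.take i₀)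
      have h1 : ((W * τ₀ : G) : G ⧸ A) = (patPrefix y s π l : G) := by
        rw [← hle, QuotientGroup.mk_mul, mk_val_patWord x y A s hx π w, ← QuotientGroup.mk_mul]
      -- The two approaches to the base vertex differ by some `α ∈ A`, which commutes with the loop
      -- `ξ ∈ A`. So inserting the loop at either visit has the same effect.
      obtain ⟨α, hα, hαe⟩ : ∃ α ∈ A, patPrefix y s π l = W * τ₀ * α :=
        ⟨(W * τ₀)⁻¹ * patPrefix y s π l, QuotientGroup.eq.1 h1, (mul_inv_cancel_left _ _).symm⟩
      have h2 : α * ξ * α⁻¹ = ξ := by rw [hA _ hα _ hloop, mul_inv_cancel_right]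
      calc patPrefix y s π l * ξ * (patPrefix y s π l)⁻¹ * W * τ₀
          = (W * τ₀) * (α * ξ * α⁻¹) * (W * τ₀)⁻¹ * (W * τ₀) := by
            rw [hαe]; simp [mul_assoc]
        _ = W * τ₀ * ξ := by rw [h2, inv_mul_cancel_right]
    · rw [weight_patWord_add_single hl hil, hgi, weight_append o u]
      rw [weight_append o (τ.drop i₀)] at hvw
      have : weight o τ = weight o (τ.take i₀) + weight o (τ.drop i₀) := by
        conv_lhs => rw [hsplit, weight_append]
      omega
    · intro p hp q hq hpq
      have hp' : p ≤ i₀ := by simpa [hi₀] using hp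
      have hq' : q ≤ i₀ := by simpa [hi₀] using hq
      simp only [List.take_take, min_eq_left hp', min_eq_left hq'] at hpq
      exact h.injOn_tail (Set.mem_Iic.2 (hp'.trans hi₀)) (Set.mem_Iic.2 (hq'.trans hi₀)) hpq
    · intro p hp
      have hp' : p ≤ i₀ := by simpa [hi₀] using hp
      rw [List.take_take, min_eq_left hp']
      exact h.mem p (hp'.trans hi₀)
  · push Not at hA1
    by_cases hB : ∃ l ≤ π.length, ((patPrefix y s π π.length * val s (τ ++ [a]) : G) : G ⧸ A) =
        (patPrefix y s π l : G)
    -- The new vertex lies on the pattern but not on the tail, so the longer tail is still simple.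
    · have htake : ∀ i ≤ τ.length, (τ ++ [a]).take i = τ.take i := fun i hi =>
        List.take_append_of_le_length hi
      have hfull : (τ ++ [a]).take (τ.length + 1) = τ ++ [a] := List.take_of_length_le (by simp)
      refine ⟨π, w, τ ++ [a], ⟨hlt, h.lt_pat, ?_, ?_, h.injOn_pat, ?_, ?_⟩⟩
      · rw [val_append s τ, ← mul_assoc, hval, ← val_append]
      · rw [weight_append o τ, weight_append o u]; omega
      · intro p hp q hq hpq
        have hp : p ≤ τ.length + 1 := by simpa using hp
        have hq : q ≤ τ.length + 1 := by simpa using hq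
        rcases Nat.lt_or_ge τ.length p with hp1 | hp1 <;>
          rcases Nat.lt_or_ge τ.length q with hq1 | hq1
        · omega
        · obtain rfl : p = τ.length + 1 := by omega
          simp only [hfull, htake q hq1] at hpq
          exact absurd hpq.symm (hA1 q hq1)
        · obtain rfl : q = τ.length + 1 := by omega
          simp only [hfull, htake p hp1] at hpq
          exact absurd hpq (hA1 p hp1)
        · simp only [htake p hp1, htake q hq1] at hpq
          exact h.injOn_tail hp1 hq1 hpq
      · intro p hp
        have hp : p ≤ τ.length + 1 := by simpa using hp
        rcases Nat.lt_or_ge τ.length p with hp1 | hp1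
        · obtain rfl : p = τ.length + 1 := by omega
          rw [hfull]; exact hB
        · rw [htake p hp1]; exact h.mem p hp1
    · push Not at hB
      -- A vertex outside the pattern is reached: the whole path since the last pattern vertex is
      -- turned into one letter, and the tail restarts empty.
      obtain ⟨v, hv, hvv, hvw⟩ := hcov (τ ++ [a]) hlt (by simp) (by simpa using hτ)
      rcases List.mem_append.1 hv with hv | hv
      -- Were this path in `A`, it would end at the starting vertex of the tail.
      · refine absurd ?_ (hA1 0 (Nat.zero_le _))
        have := hx v hv
        rw [hvv] at this
        rw [QuotientGroup.eq, List.take_zero, val_nil]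
        simpa using this
      obtain ⟨j, hj, rfl⟩ := List.getElem_of_mem hv
      have hgj : y.getD j [] = y[j] := List.getD_eq_getElem _ _ hj
      obtain ⟨w', hw'⟩ := exists_patWord_append (x := x) (y := y) π j w
      refine ⟨π ++ [j], w', [], ⟨by simp, ?_, ?_, ?_, ?_, ?_, ?_⟩⟩
      · intro p hp
        rcases List.mem_append.1 hp with hp | hp
        · exact h.lt_pat p hp
        · rw [List.mem_singleton.1 hp]; exact hj
      · rw [hw', hgj, val_append, hvv, val_nil, mul_one, val_append, val_append s u, ← hval,
          mul_assoc]
      · rw [hw', hgj, weight_append, weight_append o u, weight_nil]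
        rw [weight_append] at hvw
        omega
      · intro p hp q hq hpq
        have hp : p ≤ π.length + 1 := by simpa using hp
        have hq : q ≤ π.length + 1 := by simpa using hq
        rcases Nat.lt_or_ge π.length p with hp1 | hp1 <;>
          rcases Nat.lt_or_ge π.length q with hq1 | hq1
        · omega
        · obtain rfl : p = π.length + 1 := by omega
          simp only [patPrefix_append_last, patPrefix_append hq1, hgj, hvv] at hpq
          exact absurd hpq (hB q hq1)
        · obtain rfl : q = π.length + 1 := by omega
          simp only [patPrefix_append_last, patPrefix_append hp1, hgj, hvv] at hpq
          exact absurd hpq.symm (hB p hp1)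
        · simp only [patPrefix_append hp1, patPrefix_append hq1] at hpq
          exact h.injOn_pat hp1 hq1 hpq
      · intro p hp q hq _
        have hp : p = 0 := by simpa using hp
        have hq : q = 0 := by simpa using hq
        rw [hp, hq]
      · intro p _
        exact ⟨_, le_rfl, by simp [val_nil]⟩

/-- The reduction is run over the whole word, and a nonempty remaining tail becomes one last letter.
The pattern before it has distinct vertices and so fewer letters than the index; the last letter may
return to an old vertex, which is why the length bound is the index itself. -/
theorem exists_patWord_le [A.Normal] (hA : ∀ a ∈ A, ∀ b ∈ A, a * b = b * a)
    (hfin : A.index ≠ 0) (hx : ∀ u ∈ x, val s u ∈ A) (hy : ∀ u ∈ y, val s u ∉ A)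
    (hcov : ∀ u : List ℕ, (∀ a ∈ u, a < k) → 1 ≤ u.length → u.length ≤ A.index →
      ∃ v ∈ x ++ y, val s v = val s u ∧ weight o v ≤ weight o u)
    (u : List ℕ) (hu : ∀ a ∈ u, a < k) :
    ∃ π w, (∀ p ∈ π, p < y.length) ∧ π.length ≤ A.index ∧
      val s (patWord x y π w) = val s u ∧ weight o (patWord x y π w) ≤ weight o u := by
  have : Finite (G ⧸ A) := Nat.finite_of_card_ne_zero hfin
  obtain ⟨π, w, τ, h⟩ : ∃ π w τ, Reduction A x y s o k u π w τ := by
    induction u using List.reverseRecOn with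
    | nil =>
      refine ⟨[], 0, [], ⟨by simp, by simp, ?_, ?_, ?_, ?_, ?_⟩⟩
      · simp [patWord_nil, powWord_zero, val_nil]
      · simp [patWord_nil, powWord_zero, weight_nil]
      · intro p hp q hq _
        have hp : p = 0 := by simpa using hp
        have hq : q = 0 := by simpa using hq
        rw [hp, hq]
      · intro p hp q hq _
        have hp : p = 0 := by simpa using hp
        have hq : q = 0 := by simpa using hq
        rw [hp, hq]
      · exact fun p _ => ⟨0, le_rfl, by simp [val_nil]⟩
    | append_singleton u a ih =>
      obtain ⟨π, w, τ, h⟩ := ih fun b hb => hu b (by simp [hb])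
      exact h.exists_snoc hA hfin hx hy hcov (hu a (by simp))
  have hm : π.length + 1 ≤ A.index := succ_le_card_of_injOn h.injOn_pat
  have hτ : τ.length + 1 ≤ A.index := succ_le_card_of_injOn h.injOn_tail
  have hval := h.val_eq
  have hwt := h.weight_le
  by_cases hτ0 : τ = []
  · subst hτ0
    refine ⟨π, w, h.lt_pat, by omega, ?_, by omega⟩
    rwa [val_nil, mul_one] at hval
  have hpos : 0 < τ.length := List.length_pos_iff.2 hτ0
  obtain ⟨v, hv, hvv, hvw⟩ := hcov τ h.lt_tail hpos (by omega)
  rcases List.mem_append.1 hv with hv | hv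
  -- A tail with value in `A` would be a loop, against the distinctness of its vertices.
  · have h1 := hx v hv
    rw [hvv] at h1
    have h2 := h.injOn_tail (Set.mem_Iic.2 (Nat.zero_le _)) (Set.mem_Iic.2 le_rfl) (by
      simp only [List.take_zero, List.take_length, val_nil, mul_one]
      rw [QuotientGroup.eq]
      simpa using h1)
    omega
  obtain ⟨j, hj, rfl⟩ := List.getElem_of_mem hv
  have hgj : y.getD j [] = y[j] := List.getD_eq_getElem _ _ hj
  obtain ⟨w', hw'⟩ := exists_patWord_append (x := x) (y := y) π j w
  refine ⟨π ++ [j], w', ?_, by simpa using hm, ?_, ?_⟩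
  · intro p hp
    rcases List.mem_append.1 hp with hp | hp
    · exact h.lt_pat p hp
    · rw [List.mem_singleton.1 hp]; exact hj
  · rw [hw', hgj, val_append, hvv, hval]
  · rw [hw', hgj, weight_append]; omega

end Optimal

end VirtAbelian

/-! ### The checker -/

namespace VirtAbelian

def wordsLE (k d : ℕ) : List (List ℕ) :=
  Nat.rec [[]] (fun _ L => [] :: (List.range k).flatMap fun a => L.map fun u => a :: u) d

theorem mem_wordsLE {k d : ℕ} {u : List ℕ} :
    u ∈ wordsLE k d ↔ u.length ≤ d ∧ ∀ a ∈ u, a < k := by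
  induction d generalizing u with
  | zero => cases u <;> simp [wordsLE]
  | succ d ih =>
    have e : wordsLE k (d + 1) =
      [] :: (List.range k).flatMap fun a => (wordsLE k d).map fun u => a :: u := rfl
    rw [e]
    cases u with
    | nil => simp
    | cons a u => simp [ih]; tauto

/-- The label of a class, its pattern, and the linear set `a + B*`. -/
abbrev Piece : Type := ℕ × List ℕ × List ℕ × List (List ℕ)

def linPoint (a : List ℕ) (B : List (List ℕ)) (z : ℕ → ℕ) (i : ℕ) : ℕ :=
  a.getD i 0 + ∑ t ∈ Finset.range B.length, z t * (B.getD t []).getD i 0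

def Piece.word (P : Piece) (x y : List (List ℕ)) (z : ℕ → ℕ) : List ℕ :=
  patWord x y P.2.1 (linPoint P.2.2.1 P.2.2.2 z)

def pieces (cls : List ClassCode) : List Piece :=
  (List.range cls.length).flatMap fun j => (cls.getD j ([], [], [], 0)).2.1.map fun p =>
    (j, (cls.getD j ([], [], [], 0)).1, p.1, p.2)

/-- All `w ∈ ℕ^m`, as a piece. -/
def fullPiece (r : ℕ) (π : List ℕ) : Piece :=
  (0, π, [], (List.range ((π.length + 1) * r)).map fun t =>
    (List.range ((π.length + 1) * r)).map fun i => bif i == t then 1 else 0)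

structure WellFormedClass (x y : List (List ℕ)) (o : ℕ → ℕ) (d : ℕ) (c : ClassCode) : Prop where
  length_le : c.1.length ≤ d
  lt : ∀ p ∈ c.1, p < y.length
  nonempty : 0 < c.2.1.length
  length_eq : ∀ p ∈ c.2.1, p.1.length = (c.1.length + 1) * x.length ∧
    ∀ b ∈ p.2, b.length = (c.1.length + 1) * x.length
  coeff_eq : c.2.2.1 = (List.range ((c.1.length + 1) * x.length)).map fun i =>
    weight o (x.getD (i % x.length) [])
  const_eq : c.2.2.2 = weight o (patWord x y c.1 fun i => ([] : List ℕ).getD i 0)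

/-- The conditions on the list of words `x` and `y` of the output. -/
structure GoodWords {G : Type*} [Group G] (A : Subgroup G) (s : ℕ → G) (o : ℕ → ℕ) (k : ℕ)
    (x y : List (List ℕ)) : Prop where
  short : ∀ u ∈ x ++ y, (∀ a ∈ u, a < k) ∧ 1 ≤ u.length ∧ u.length ≤ A.index
  mem : ∀ u ∈ x, val s u ∈ A
  notMem : ∀ u ∈ y, val s u ∉ A
  injOn_left : ∀ i < x.length, ∀ j < x.length, val s (x.getD i []) = val s (x.getD j []) → i = j
  injOn_right : ∀ i < y.length, ∀ j < y.length, val s (y.getD i []) = val s (y.getD j []) → i = j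
  cover : ∀ u : List ℕ, (∀ a ∈ u, a < k) → 1 ≤ u.length → u.length ≤ A.index →
    ∃ v ∈ x ++ y, val s v = val s u ∧ weight o v ≤ weight o u

/-- `dom` and `sep` replace any mention of geodesics. Given any word, a listed word dominates it by
`dom` and is the only listed word of that value by `sep`, hence has least weight. In this form both
conditions are statements about linear inequalities. -/
structure GoodClasses {G : Type*} [Group G] (s : ℕ → G) (o : ℕ → ℕ) (d : ℕ)
    (x y : List (List ℕ)) (cls : List ClassCode) : Prop where
  pattern_inj : ∀ i < cls.length, ∀ j < cls.length,
    (cls.getD i ([], [], [], 0)).1 = (cls.getD j ([], [], [], 0)).1 → i = j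
  wf : ∀ c ∈ cls, WellFormedClass x y o d c
  dom : ∀ π : List ℕ, π.length ≤ d → (∀ p ∈ π, p < y.length) → ∀ w : ℕ → ℕ,
    ∃ P ∈ pieces cls, ∃ z, val s (P.word x y z) = val s (patWord x y π w) ∧
      weight o (P.word x y z) ≤ weight o (patWord x y π w)
  sep : ∀ P ∈ pieces cls, ∀ Q ∈ pieces cls, ∀ z z',
    val s (P.word x y z) = val s (Q.word x y z') → P.1 = Q.1 ∧
      ∀ i < (P.2.1.length + 1) * x.length,
        linPoint P.2.2.1 P.2.2.2 z i = linPoint Q.2.2.1 Q.2.2.2 z' i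

/-! #### Affine forms -/

/-- An affine form: its linear part and its constant. -/
abbrev AffForm : Type := List ℤ × ℤ

def AffForm.eval (f : AffForm) (z : ℕ → ℕ) : ℤ := dot f.1 z + f.2

def negList (u : List ℤ) : List ℤ := u.map fun c => -c

theorem dot_negList (u : List ℤ) (x : ℕ → ℕ) : dot (negList u) x = -dot u x := by
  simp only [dot, negList, List.length_map, ← Finset.sum_neg_distrib]
  refine Finset.sum_congr rfl fun i hi => ?_
  have hi : i < u.length := by simpa using hi
  simp [List.getD_eq_getElem?_getD, hi]

theorem dot_append (u v : List ℤ) (x : ℕ → ℕ) :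
    dot (u ++ v) x = dot u x + dot v fun i => x (i + u.length) := by
  simp only [dot, List.length_append]
  rw [Finset.sum_range_add]
  congr 1
  · refine Finset.sum_congr rfl fun i hi => ?_
    rw [List.getD_append _ _ _ _ (by simpa using hi)]
  · refine Finset.sum_congr rfl fun i _ => ?_
    rw [List.getD_append_right _ _ _ _ (by omega), Nat.add_sub_cancel_left, add_comm i]

/-- `f(x) ≥ g(z)`. -/
def AffForm.ge (f g : AffForm) : Constr := (f.1, negList g.1, f.2 - g.2)

/-- `f(x) ≤ g(z)`. -/
def AffForm.le (f g : AffForm) : Constr := (negList f.1, g.1, g.2 - f.2)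

/-- The form `f(x) - g(x')` in the concatenation of `x` and `x'`. -/
def AffForm.diff (f g : AffForm) : AffForm := (f.1 ++ negList g.1, f.2 - g.2)

theorem AffForm.val_ge (f g : AffForm) (x z : ℕ → ℕ) :
    Constr.val (f.ge g) x z = f.eval x - g.eval z := by
  simp only [Constr.val, AffForm.ge, AffForm.eval, dot_negList]; ring

theorem AffForm.val_le (f g : AffForm) (x z : ℕ → ℕ) :
    Constr.val (f.le g) x z = g.eval z - f.eval x := by
  simp only [Constr.val, AffForm.le, AffForm.eval, dot_negList]; ring

theorem AffForm.eval_diff (f g : AffForm) (x : ℕ → ℕ) :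
    (f.diff g).eval x = f.eval x - g.eval fun i => x (i + f.1.length) := by
  simp only [AffForm.diff, AffForm.eval, dot_negList, dot_append]; ring

/-- `f(x) ≥ c`. -/
def AffForm.geConst (f : AffForm) (c : ℤ) : Constr := (f.1, [], f.2 - c)

/-- `f(x) ≤ -c`. -/
def AffForm.leNegConst (f : AffForm) (c : ℤ) : Constr := (negList f.1, [], -f.2 - c)

theorem AffForm.val_geConst (f : AffForm) (c : ℤ) (x z : ℕ → ℕ) :
    Constr.val (f.geConst c) x z = f.eval x - c := by
  simp only [Constr.val, AffForm.geConst, AffForm.eval]; simp [dot]; ring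

theorem AffForm.val_leNegConst (f : AffForm) (c : ℤ) (x z : ℕ → ℕ) :
    Constr.val (f.leNegConst c) x z = -f.eval x - c := by
  simp only [Constr.val, AffForm.leNegConst, AffForm.eval, dot_negList]; simp [dot]; ring

/-! #### Coordinates of patterned words -/

def patWordCode (x y : List (List ℕ)) (π w : List ℕ) : List ℕ := patWord x y π fun i => w.getD i 0

def weightCode (I : InputCode) (u : List ℕ) : ℕ := weight (fun a => I.2.2.getD a 0) u

/-- The `i`-th exponent of the normal form of a word; its weight if `i` is the rank. -/
def coordCode (I : InputCode) (u : List ℕ) (i : ℕ) : ℤ :=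
  bif i == inputRank I then (weightCode I u : ℤ) else (wordCode I u).1.getD i 0

/-- A coordinate is affine in the exponents of the pattern: its value at `b` minus its value at
exponent zero is the coefficient of the period `b`, and its value at the base point is the constant.
-/
def pieceForm (I : InputCode) (x y : List (List ℕ)) (P : Piece) (i : ℕ) : AffForm :=
  (P.2.2.2.map fun b => coordCode I (patWordCode x y P.2.1 b) i -
      coordCode I (patWordCode x y P.2.1 []) i,
    coordCode I (patWordCode x y P.2.1 P.2.2.1) i)

/-- The `i`-th coordinate of the points of a piece. -/
def pointForm (P : Piece) (i : ℕ) : AffForm :=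
  (P.2.2.2.map fun b => (b.getD i 0 : ℤ), (P.2.2.1.getD i 0 : ℤ))

/-- The coset does not depend on the exponents, so they are set to zero. -/
def pieceCoset (I : InputCode) (x y : List (List ℕ)) (P : Piece) : ℕ :=
  (wordCode I (patWordCode x y P.2.1 [])).2

/-- Every element of `P` is dominated by an element of one of the pieces `L`. -/
def domGoal (I : InputCode) (x y : List (List ℕ)) (L : List Piece) (P : Piece) : Goal :=
  L.flatMap fun Q => bif pieceCoset I x y P == pieceCoset I x y Q then
    [(pieceForm I x y P (inputRank I)).ge (pieceForm I x y Q (inputRank I)) ::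
      (List.range (inputRank I)).flatMap fun i =>
        [(pieceForm I x y P i).ge (pieceForm I x y Q i),
          (pieceForm I x y P i).le (pieceForm I x y Q i)]] else []

/-- If elements of `P` and `Q` have the same exponents then they have the same
parameters. -/
def sepGoal (I : InputCode) (x y : List (List ℕ)) (P Q : Piece) : Goal :=
  -- The implication becomes a disjunction: all parameters agree (offered only when the labels
  -- agree), or some exponent of the normal forms differs by at least `1` in one direction. The
  -- parameters of `P` and `Q` are concatenated, and no unknowns remain.
  (bif P.1 == Q.1 then
    [(List.range ((P.2.1.length + 1) * x.length)).flatMap fun i =>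
      [((pointForm P i).diff (pointForm Q i)).geConst 0,
        ((pointForm P i).diff (pointForm Q i)).leNegConst 0]] else []) ++
  (List.range (inputRank I)).flatMap fun i =>
    [[((pieceForm I x y P i).diff (pieceForm I x y Q i)).geConst 1],
      [((pieceForm I x y P i).diff (pieceForm I x y Q i)).leNegConst 1]]

/-- Domination is required for every pattern of admissible length. Pieces in different cosets never
share a value and need no separation. -/
def classGoals (I : InputCode) (o : OutputCode) : List Goal :=
  ((wordsLE o.1.2.length (inputIndex I)).map fun π =>
    domGoal I o.1.1 o.1.2 (pieces o.2) (fullPiece o.1.1.length π)) ++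
  (pieces o.2).flatMap fun P => (pieces o.2).flatMap fun Q =>
    bif pieceCoset I o.1.1 o.1.2 P == pieceCoset I o.1.1 o.1.2 Q then
      [sepGoal I o.1.1 o.1.2 P Q] else []

def checkWords (I : InputCode) (x y : List (List ℕ)) : Bool :=
  ((x ++ y).all fun u => (u.all fun a => decide (a < I.2.1.length)) &&
    (decide (1 ≤ u.length) && decide (u.length ≤ inputIndex I))) &&
  ((x.all fun u => (wordCode I u).2 == (oneCode I).2) &&
  ((y.all fun u => !((wordCode I u).2 == (oneCode I).2)) &&
  (((List.range x.length).all fun i => (List.range x.length).all fun j =>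
    !decide (wordCode I (x.getD i []) = wordCode I (x.getD j [])) || i == j) &&
  (((List.range y.length).all fun i => (List.range y.length).all fun j =>
    !decide (wordCode I (y.getD i []) = wordCode I (y.getD j [])) || i == j) &&
  (wordsLE I.2.1.length (inputIndex I)).all fun u => !decide (1 ≤ u.length) ||
    (x ++ y).any fun v => decide (wordCode I v = wordCode I u) &&
      decide (weightCode I v ≤ weightCode I u)))))

def checkClass (I : InputCode) (x y : List (List ℕ)) (c : ClassCode) : Bool :=
  decide (c.1.length ≤ inputIndex I) && ((c.1.all fun p => decide (p < y.length)) &&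
  (decide (0 < c.2.1.length) &&
  ((c.2.1.all fun p => p.1.length == (c.1.length + 1) * x.length &&
    p.2.all fun b => b.length == (c.1.length + 1) * x.length) &&
  (decide (c.2.2.1 = (List.range ((c.1.length + 1) * x.length)).map fun i =>
    weightCode I (x.getD (i % x.length) [])) &&
  c.2.2.2 == weightCode I (patWordCode x y c.1 [])))))

/-- The conditions that can be decided directly; domination and separation are left to certificates.
-/
def checkOutput (I : InputCode) (o : OutputCode) : Bool :=
  checkWords I o.1.1 o.1.2 &&
  (((List.range o.2.length).all fun i => (List.range o.2.length).all fun j =>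
    !decide ((o.2.getD i ([], [], [], 0)).1 = (o.2.getD j ([], [], [], 0)).1) || i == j) &&
  o.2.all (checkClass I o.1.1 o.1.2))

theorem Prim.decide_eq {α β : Type*} [Primcodable α] [Primcodable β] [DecidableEq β] {f g : α → β}
    (hf : Primrec f) (hg : Primrec g) : Primrec fun x => decide (f x = g x) :=
  (Primrec.beq.comp hf hg).of_eq fun _ => beq_eq_decide _ _

attribute [fun_prop] Prim.decide_eq

/-! ### The checker is primitive recursive -/

section Primrec

variable {α : Type*} [Primcodable α]

@[fun_prop] theorem primrec_wordsLE {f g : α → ℕ} (hf : Primrec f) (hg : Primrec g) :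
    Primrec fun x => wordsLE (f x) (g x) := by
  unfold wordsLE; fun_prop

@[fun_prop] theorem primrec_pieces {f : α → List ClassCode} (hf : Primrec f) :
    Primrec fun x => pieces (f x) := by
  unfold pieces; fun_prop

@[fun_prop] theorem primrec_fullPiece {f : α → ℕ} {g : α → List ℕ} (hf : Primrec f)
    (hg : Primrec g) : Primrec fun x => fullPiece (f x) (g x) := by
  unfold fullPiece; fun_prop

@[fun_prop] theorem primrec_patWordCode {x y : α → List (List ℕ)} {π w : α → List ℕ}
    (hx : Primrec x) (hy : Primrec y) (hπ : Primrec π) (hw : Primrec w) :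
    Primrec fun a => patWordCode (x a) (y a) (π a) (w a) := by
  unfold patWordCode patWord powWord; fun_prop

@[fun_prop] theorem primrec_weightCode {I : α → InputCode} {u : α → List ℕ}
    (hI : Primrec I) (hu : Primrec u) : Primrec fun a => weightCode (I a) (u a) := by
  unfold weightCode weight; fun_prop

@[fun_prop] theorem primrec_inputRank {I : α → InputCode} (hI : Primrec I) :
    Primrec fun a => inputRank (I a) := by
  unfold inputRank; fun_prop

@[fun_prop] theorem primrec_inputIndex {I : α → InputCode} (hI : Primrec I) :
    Primrec fun a => inputIndex (I a) := by
  unfold inputIndex; fun_prop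

@[fun_prop] theorem primrec_oneCode {I : α → InputCode} (hI : Primrec I) :
    Primrec fun a => oneCode (I a) := by
  unfold oneCode tableEntry; fun_prop

@[fun_prop] theorem primrec_coordCode {I : α → InputCode} {u : α → List ℕ} {i : α → ℕ}
    (hI : Primrec I) (hu : Primrec u) (hi : Primrec i) :
    Primrec fun a => coordCode (I a) (u a) (i a) := by
  unfold coordCode; fun_prop

@[fun_prop] theorem primrec_pieceCoset {I : α → InputCode} {x y : α → List (List ℕ)}
    {P : α → Piece} (hI : Primrec I) (hx : Primrec x) (hy : Primrec y) (hP : Primrec P) :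
    Primrec fun a => pieceCoset (I a) (x a) (y a) (P a) := by
  unfold pieceCoset; fun_prop

@[fun_prop] theorem primrec_domGoal {I : α → InputCode} {x y : α → List (List ℕ)}
    {L : α → List Piece} {P : α → Piece} (hI : Primrec I) (hx : Primrec x) (hy : Primrec y)
    (hL : Primrec L) (hP : Primrec P) :
    Primrec fun a => domGoal (I a) (x a) (y a) (L a) (P a) := by
  unfold domGoal AffForm.ge AffForm.le negList; fun_prop

@[fun_prop] theorem primrec_sepGoal {I : α → InputCode} {x y : α → List (List ℕ)}
    {P Q : α → Piece} (hI : Primrec I) (hx : Primrec x) (hy : Primrec y)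
    (hP : Primrec P) (hQ : Primrec Q) :
    Primrec fun a => sepGoal (I a) (x a) (y a) (P a) (Q a) := by
  unfold sepGoal AffForm.geConst AffForm.leNegConst AffForm.diff negList; fun_prop

@[fun_prop] theorem primrec_classGoals {I : α → InputCode} {o : α → OutputCode}
    (hI : Primrec I) (ho : Primrec o) : Primrec fun a => classGoals (I a) (o a) := by
  unfold classGoals; fun_prop

@[fun_prop] theorem primrec_checkWords {I : α → InputCode} {x y : α → List (List ℕ)}
    (hI : Primrec I) (hx : Primrec x) (hy : Primrec y) :
    Primrec fun a => checkWords (I a) (x a) (y a) := by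
  unfold checkWords; fun_prop

@[fun_prop] theorem primrec_checkClass {I : α → InputCode} {x y : α → List (List ℕ)}
    {c : α → ClassCode} (hI : Primrec I) (hx : Primrec x) (hy : Primrec y) (hc : Primrec c) :
    Primrec fun a => checkClass (I a) (x a) (y a) (c a) := by
  unfold checkClass; fun_prop

@[fun_prop] theorem primrec_checkOutput {I : α → InputCode} {o : α → OutputCode}
    (hI : Primrec I) (ho : Primrec o) : Primrec fun a => checkOutput (I a) (o a) := by
  unfold checkOutput; fun_prop

end Primrec

end VirtAbelian

/-! ### Correctness of the checker -/

namespace VirtAbelian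

def letters {G : Type*} [Group G] {k : ℕ} (σ : Fin k → G) (a : ℕ) : G :=
  if h : a < k then σ ⟨a, h⟩ else 1

def letterWeights (I : InputCode) (a : ℕ) : ℕ := I.2.2.getD a 0

theorem exists_map_val {k : ℕ} {u : List ℕ} (hu : ∀ a ∈ u, a < k) :
    ∃ v : List (Fin k), v.map (fun i : Fin k => (i : ℕ)) = u :=
  ⟨u.pmap (fun a h => ⟨a, h⟩) hu, by simp [List.map_pmap]⟩

theorem val_letters {G : Type*} [Group G] {k : ℕ} (σ : Fin k → G) (v : List (Fin k)) :
    val (letters σ) (v.map fun i : Fin k => (i : ℕ)) = wordValue σ v := by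
  simp [val, wordValue, letters, Function.comp_def]

section

variable {G : Type*} [Group G] (D : Description G) {k : ℕ}
  (gen : Fin k → NormalForm D.rank D.numT) (ω : Fin k → ℕ)

local notation "II" => D.inputCode gen ω
local notation "ss" => letters fun i => nfValue D.b D.t (gen i)

theorem weight_letterWeights (v : List (Fin k)) :
    weight (letterWeights II) (v.map fun i : Fin k => (i : ℕ)) = wordWeight ω v := by
  simp [weight, wordWeight, letterWeights, Description.inputCode, Function.comp_def,
    List.getD_eq_getElem?_getD]

theorem wordCode_eq {u : List ℕ} (hu : ∀ a ∈ u, a < k) :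
    wordCode II u = nfCode (D.nf (val ss u)) := by
  obtain ⟨v, rfl⟩ := exists_map_val hu
  rw [wordCode_nf, val_letters]

theorem wordCode_inj {u v : List ℕ} (hu : ∀ a ∈ u, a < k) (hv : ∀ a ∈ v, a < k) :
    wordCode II u = wordCode II v ↔ val ss u = val ss v := by
  rw [wordCode_eq D gen ω hu, wordCode_eq D gen ω hv, nfCode_injective.eq_iff,
    D.nf_injective.eq_iff]

theorem wordCode_coset {u : List ℕ} (hu : ∀ a ∈ u, a < k) :
    (wordCode II u).2 = (oneCode II).2 ↔ val ss u ∈ D.A := by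
  rw [wordCode_eq D gen ω hu, oneCode_nf, D.mem_A_iff_nf, Fin.ext_iff]
  rfl

theorem checkWords_iff (x y : List (List ℕ)) :
    checkWords II x y = true ↔ GoodWords D.A ss (letterWeights II) k x y := by
  have hk : (II).2.1.length = k := by simp [Description.inputCode]
  have hd : inputIndex II = D.A.index := D.index_eq.symm
  have hget : ∀ {L : List (List ℕ)} {i}, i < L.length → L.getD i [] ∈ L := fun h => by
    rw [List.getD_eq_getElem _ _ h]; exact List.getElem_mem _
  simp only [checkWords, Bool.and_eq_true, List.all_eq_true, decide_eq_true_eq, hk, hd,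
    beq_iff_eq, Bool.not_eq_true', beq_eq_false_iff_ne, ne_eq, Bool.or_eq_true,
    decide_eq_false_iff_not, List.any_eq_true, List.mem_range, mem_wordsLE, not_le]
  constructor
  · rintro ⟨h1, h2, h3, h4, h5, h6⟩
    have hx : ∀ u ∈ x, ∀ a ∈ u, a < k := fun u hu => (h1 u (List.mem_append_left _ hu)).1
    have hy : ∀ u ∈ y, ∀ a ∈ u, a < k := fun u hu => (h1 u (List.mem_append_right _ hu)).1
    refine ⟨h1, fun u hu => (wordCode_coset D gen ω (hx u hu)).1 (h2 u hu),
      fun u hu => (wordCode_coset D gen ω (hy u hu)).not.1 (h3 u hu),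
      fun i hi j hj h => ?_, fun i hi j hj h => ?_, fun u hu hu1 hud => ?_⟩
    · exact (h4 i hi j hj).resolve_left
        (not_not.2 ((wordCode_inj D gen ω (hx _ (hget hi)) (hx _ (hget hj))).2 h))
    · exact (h5 i hi j hj).resolve_left
        (not_not.2 ((wordCode_inj D gen ω (hy _ (hget hi)) (hy _ (hget hj))).2 h))
    · obtain ⟨v, hv, hvu, hvw⟩ := (h6 u ⟨hud, hu⟩).resolve_left (by omega)
      exact ⟨v, hv, (wordCode_inj D gen ω (h1 v hv).1 hu).1 hvu, hvw⟩
  · rintro ⟨h1, h2, h3, h4, h5, h6⟩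
    have hx : ∀ u ∈ x, ∀ a ∈ u, a < k := fun u hu => (h1 u (List.mem_append_left _ hu)).1
    have hy : ∀ u ∈ y, ∀ a ∈ u, a < k := fun u hu => (h1 u (List.mem_append_right _ hu)).1
    refine ⟨h1, fun u hu => (wordCode_coset D gen ω (hx u hu)).2 (h2 u hu),
      fun u hu => (wordCode_coset D gen ω (hy u hu)).not.2 (h3 u hu),
      fun i hi j hj => ?_, fun i hi j hj => ?_, fun u hu => ?_⟩
    · rw [wordCode_inj D gen ω (hx _ (hget hi)) (hx _ (hget hj)), ← imp_iff_not_or]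
      exact h4 i hi j hj
    · rw [wordCode_inj D gen ω (hy _ (hget hi)) (hy _ (hget hj)), ← imp_iff_not_or]
      exact h5 i hi j hj
    · rcases Nat.lt_or_ge u.length 1 with h | h
      · exact Or.inl h
      · obtain ⟨v, hv, hvu, hvw⟩ := h6 u hu.2 h hu.1
        exact Or.inr ⟨v, hv, (wordCode_inj D gen ω (h1 v hv).1 hu.2).2 hvu, hvw⟩

theorem checkClass_iff (x y : List (List ℕ)) (c : ClassCode) :
    checkClass II x y c = true ↔ WellFormedClass x y (letterWeights II) D.A.index c := by
  have hd : inputIndex II = D.A.index := D.index_eq.symm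
  simp only [checkClass, Bool.and_eq_true, List.all_eq_true, decide_eq_true_eq, hd, beq_iff_eq]
  constructor
  · rintro ⟨h1, h2, h3, h4, h5, h6⟩
    exact ⟨h1, h2, h3, h4, h5, h6⟩
  · rintro ⟨h1, h2, h3, h4, h5, h6⟩
    exact ⟨h1, h2, h3, h4, h5, h6⟩

variable {x y : List (List ℕ)}

theorem lt_of_mem_patWord (hxy : ∀ u ∈ x ++ y, ∀ a ∈ u, a < k) (π : List ℕ) (w : ℕ → ℕ) :
    ∀ a ∈ patWord x y π w, a < k := fun _ ha => by
  obtain ⟨u, hu, hau⟩ := mem_patWord x y ha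
  exact hxy u hu _ hau

/-- Index `D.rank` stands for the weight, smaller indices for exponents of the normal form, and
larger ones give the default `0`. -/
theorem exists_affine_coordCode (hxy : ∀ u ∈ x ++ y, ∀ a ∈ u, a < k)
    (hx : ∀ u ∈ x, val ss u ∈ D.A) (π : List ℕ) (i : ℕ) :
    ∃ F : (ℕ → ℕ) →+ ℤ, ∀ w, coordCode II (patWord x y π w) i =
      F w + coordCode II (patWord x y π 0) i := by
  by_cases hi : i = D.rank
  · refine ⟨{ toFun := fun w => ∑ i ∈ Finset.range ((π.length + 1) * x.length),
        (w i : ℤ) * weight (letterWeights II) (x.getD (i % x.length) [])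
              map_zero' := by simp
              map_add' := fun w w' => by
                rw [← Finset.sum_add_distrib]
                exact Finset.sum_congr rfl fun i _ => by simp [add_mul] }, fun w => ?_⟩
    have hr : (i == inputRank II) = true := by simpa [inputRank, Description.inputCode, Description.code] using hi
    have e := weight_patWord x y (letterWeights II) π w
    simp only [coordCode, hr, cond_true]
    change (weight (letterWeights II) _ : ℤ) = _ + (weight (letterWeights II) _ : ℤ)
    rw [e]
    simp [add_comm]
  · have hr : (i == inputRank II) = false := by simpa [inputRank, Description.inputCode, Description.code] using hi
    obtain ⟨F, hF⟩ := exists_affine_patWord D x y ss hx π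
    simp only [coordCode, hr, cond_false]
    by_cases hir : i < D.rank
    · refine ⟨(Pi.evalAddMonoidHom _ ⟨i, hir⟩).comp F, fun w => ?_⟩
      rw [wordCode_eq D gen ω (lt_of_mem_patWord hxy π w),
        wordCode_eq D gen ω (lt_of_mem_patWord hxy π 0), hF w, D.nf_avec_mul]
      have g := fun c => getD_nfCode D c ⟨i, hir⟩
      simp only at g
      rw [g, g]
      rfl
    · refine ⟨0, fun w => ?_⟩
      have h0 : ∀ u : List ℕ, (∀ a ∈ u, a < k) → (wordCode II u).1.getD i 0 = 0 := fun u hu => by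
        rw [wordCode_eq D gen ω hu, List.getD_eq_default]
        simpa [nfCode] using hir
      rw [h0 _ (lt_of_mem_patWord hxy π w), h0 _ (lt_of_mem_patWord hxy π 0)]
      rfl

theorem linPoint_eq (a : List ℕ) (B : List (List ℕ)) (z : ℕ → ℕ) :
    linPoint a B z = (fun i => a.getD i 0) +
      ∑ t ∈ Finset.range B.length, z t • fun i => (B.getD t []).getD i 0 := by
  funext i
  simp [linPoint, Finset.sum_apply]

theorem map_linPoint (F : (ℕ → ℕ) →+ ℤ) (a : List ℕ) (B : List (List ℕ)) (z : ℕ → ℕ) :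
    F (linPoint a B z) = F (fun i => a.getD i 0) +
      dot (B.map fun b => F fun i => b.getD i 0) z := by
  rw [linPoint_eq, map_add, map_sum, dot, List.length_map]
  congr 1
  refine Finset.sum_congr rfl fun t ht => ?_
  have ht : t < B.length := by simpa using ht
  rw [map_nsmul, nsmul_eq_mul, mul_comm]
  simp [List.getD_eq_getElem?_getD, ht]

theorem getD_nil_fun : (fun i => ([] : List ℕ).getD i 0) = 0 := by funext i; simp

theorem pieceForm_eval (hxy : ∀ u ∈ x ++ y, ∀ a ∈ u, a < k)
    (hx : ∀ u ∈ x, val ss u ∈ D.A) (P : Piece) (i : ℕ) (z : ℕ → ℕ) :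
    (pieceForm II x y P i).eval z = coordCode II (P.word x y z) i := by
  obtain ⟨F, hF⟩ := exists_affine_coordCode D gen ω hxy hx P.2.1 i
  simp only [AffForm.eval, pieceForm, patWordCode, Piece.word, hF (linPoint _ _ _), map_linPoint,
    getD_nil_fun]
  simp only [hF (fun i => List.getD _ i 0)]
  simp only [add_sub_cancel_right]
  ring

theorem pointForm_eval (P : Piece) (i : ℕ) (z : ℕ → ℕ) :
    (pointForm P i).eval z = linPoint P.2.2.1 P.2.2.2 z i := by
  have := map_linPoint ((Nat.castAddMonoidHom ℤ).comp (Pi.evalAddMonoidHom (fun _ : ℕ => ℕ) i)) P.2.2.1 P.2.2.2 z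
  simp only [AddMonoidHom.comp_apply, Pi.evalAddMonoidHom_apply, Nat.coe_castAddMonoidHom] at this
  rw [this, AffForm.eval, pointForm]
  ring

theorem pieceCoset_eq (hxy : ∀ u ∈ x ++ y, ∀ a ∈ u, a < k)
    (hx : ∀ u ∈ x, val ss u ∈ D.A) (P : Piece) (z : ℕ → ℕ) :
    pieceCoset II x y P = (wordCode II (P.word x y z)).2 := by
  obtain ⟨F, hF⟩ := exists_affine_patWord D x y ss hx P.2.1
  rw [pieceCoset, patWordCode, getD_nil_fun, Piece.word,
    wordCode_eq D gen ω (lt_of_mem_patWord hxy _ _),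
    wordCode_eq D gen ω (lt_of_mem_patWord hxy _ _), hF (linPoint _ _ _), D.nf_avec_mul]
  rfl

theorem val_eq_iff {u v : List ℕ} (hu : ∀ a ∈ u, a < k) (hv : ∀ a ∈ v, a < k) :
    val ss u = val ss v ↔ (wordCode II u).2 = (wordCode II v).2 ∧
      ∀ i < inputRank II, coordCode II u i = coordCode II v i := by
  rw [← wordCode_inj D gen ω hu hv]
  have hc : ∀ {u : List ℕ} {i}, i < inputRank II →
      coordCode II u i = (wordCode II u).1.getD i 0 := fun {u i} hi => by
    have : (i == inputRank II) = false := by simpa using hi.ne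
    simp [coordCode, this]
  constructor
  · intro h
    refine ⟨by rw [h], fun i hi => by rw [hc hi, hc hi, h]⟩
  · rintro ⟨h1, h2⟩
    refine Prod.ext (List.ext_getElem ?_ fun i hi hi' => ?_) h1
    · rw [wordCode_eq D gen ω hu, wordCode_eq D gen ω hv]; simp [nfCode]
    · have hir : i < inputRank II := by
        rw [wordCode_eq D gen ω hu] at hi
        simpa [nfCode, inputRank, Description.inputCode, Description.code] using hi
      have := h2 i hir
      rwa [hc hir, hc hir, List.getD_eq_getElem _ _ hi, List.getD_eq_getElem _ _ hi'] at this

theorem coordCode_rank (u : List ℕ) :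
    coordCode II u (inputRank II) = (weight (letterWeights II) u : ℤ) := by
  simp [coordCode]; rfl

theorem domGoal_valid (hxy : ∀ u ∈ x ++ y, ∀ a ∈ u, a < k)
    (hx : ∀ u ∈ x, val ss u ∈ D.A) (L : List Piece) (P : Piece) :
    (domGoal II x y L P).Valid ↔ ∀ w, ∃ Q ∈ L, ∃ z,
      val ss (Q.word x y z) = val ss (P.word x y w) ∧
      weight (letterWeights II) (Q.word x y z) ≤ weight (letterWeights II) (P.word x y w) := by
  refine forall_congr' fun w => ?_
  simp only [domGoal, List.mem_flatMap]
  have key : ∀ Q z, (∀ κ ∈ (pieceForm II x y P (inputRank II)).ge (pieceForm II x y Q (inputRank II)) ::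
      (List.range (inputRank II)).flatMap fun i =>
        [(pieceForm II x y P i).ge (pieceForm II x y Q i),
          (pieceForm II x y P i).le (pieceForm II x y Q i)], 0 ≤ Constr.val κ w z) ↔
      (weight (letterWeights II) (Q.word x y z) ≤ weight (letterWeights II) (P.word x y w) ∧
       ∀ i < inputRank II, coordCode II (Q.word x y z) i = coordCode II (P.word x y w) i) := by
    intro Q z
    simp only [List.forall_mem_cons, List.mem_flatMap, List.mem_range, AffForm.val_ge,
      pieceForm_eval D gen ω hxy hx, coordCode_rank, forall_exists_index, and_imp]
    refine and_congr (by omega) ⟨fun h i hi => ?_, fun h κ i hi hκ => ?_⟩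
    · have h1 := h _ i hi List.mem_cons_self
      have h2 := h _ i hi (List.mem_cons_of_mem _ List.mem_cons_self)
      rw [AffForm.val_ge, pieceForm_eval D gen ω hxy hx, pieceForm_eval D gen ω hxy hx] at h1
      rw [AffForm.val_le, pieceForm_eval D gen ω hxy hx, pieceForm_eval D gen ω hxy hx] at h2
      omega
    · have := h i hi
      simp only [List.mem_cons, List.not_mem_nil, or_false] at hκ
      rcases hκ with rfl | rfl
      · rw [AffForm.val_ge, pieceForm_eval D gen ω hxy hx, pieceForm_eval D gen ω hxy hx]; omega
      · rw [AffForm.val_le, pieceForm_eval D gen ω hxy hx, pieceForm_eval D gen ω hxy hx]; omega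
  have hlt : ∀ (P : Piece) z, ∀ a ∈ P.word x y z, a < k := fun P z => lt_of_mem_patWord hxy _ _
  constructor
  · rintro ⟨E, ⟨Q, hQ, hE⟩, z, hz⟩
    by_cases hc : pieceCoset II x y P = pieceCoset II x y Q
    · have : (pieceCoset II x y P == pieceCoset II x y Q) = true := by simpa using hc
      rw [this, cond_true, List.mem_singleton] at hE
      rw [hE, key Q z] at hz
      refine ⟨Q, hQ, z, (val_eq_iff D gen ω (hlt _ _) (hlt _ _)).2 ⟨?_, hz.2⟩, hz.1⟩
      rw [← pieceCoset_eq D gen ω hxy hx, ← pieceCoset_eq D gen ω hxy hx, hc]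
    · have : (pieceCoset II x y P == pieceCoset II x y Q) = false := by simpa using hc
      rw [this, cond_false] at hE
      exact absurd hE List.not_mem_nil
  · rintro ⟨Q, hQ, z, hval, hw⟩
    rw [val_eq_iff D gen ω (hlt _ _) (hlt _ _), ← pieceCoset_eq D gen ω hxy hx,
      ← pieceCoset_eq D gen ω hxy hx] at hval
    have : (pieceCoset II x y P == pieceCoset II x y Q) = true := by simpa using hval.1.symm
    exact ⟨_, ⟨Q, hQ, by rw [this, cond_true]; exact List.mem_singleton_self _⟩, z,
      (key Q z).2 ⟨hw, hval.2⟩⟩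

theorem linPoint_congr {a : List ℕ} {B : List (List ℕ)} {z z' : ℕ → ℕ}
    (h : ∀ t < B.length, z t = z' t) : linPoint a B z = linPoint a B z' := by
  funext i
  unfold linPoint
  congr 1
  exact Finset.sum_congr rfl fun t ht => by rw [h t (by simpa using ht)]

theorem sepGoal_valid (hxy : ∀ u ∈ x ++ y, ∀ a ∈ u, a < k)
    (hx : ∀ u ∈ x, val ss u ∈ D.A) (P Q : Piece)
    (hc : pieceCoset II x y P = pieceCoset II x y Q) :
    (sepGoal II x y P Q).Valid ↔ ∀ z z',
    val ss (P.word x y z) = val ss (Q.word x y z') → P.1 = Q.1 ∧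
      ∀ i < (P.2.1.length + 1) * x.length,
        linPoint P.2.2.1 P.2.2.2 z i = linPoint Q.2.2.1 Q.2.2.2 z' i := by
  have hlt : ∀ (P : Piece) z, ∀ a ∈ P.word x y z, a < k := fun P z => lt_of_mem_patWord hxy _ _
  have hlen : ∀ i, (pieceForm II x y P i).1.length = P.2.2.2.length := fun i => List.length_map _
  have hlen' : ∀ i, (pointForm P i).1.length = P.2.2.2.length := fun i => List.length_map _
  have hev : ∀ X i, ((pieceForm II x y P i).diff (pieceForm II x y Q i)).eval X =
      coordCode II (P.word x y X) i -
        coordCode II (Q.word x y fun t => X (t + P.2.2.2.length)) i := fun X i => by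
    rw [AffForm.eval_diff, pieceForm_eval D gen ω hxy hx, pieceForm_eval D gen ω hxy hx, hlen]
  have hpt : ∀ X i, ((pointForm P i).diff (pointForm Q i)).eval X =
      (linPoint P.2.2.1 P.2.2.2 X i : ℤ) -
        (linPoint Q.2.2.1 Q.2.2.2 (fun t => X (t + P.2.2.2.length)) i : ℕ) := fun X i => by
    rw [AffForm.eval_diff, pointForm_eval, pointForm_eval, hlen']
  have h1 : (sepGoal II x y P Q).Valid ↔ ∀ X : ℕ → ℕ,
      val ss (P.word x y X) = val ss (Q.word x y fun t => X (t + P.2.2.2.length)) → P.1 = Q.1 ∧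
      ∀ i < (P.2.1.length + 1) * x.length,
        linPoint P.2.2.1 P.2.2.2 X i =
          linPoint Q.2.2.1 Q.2.2.2 (fun t => X (t + P.2.2.2.length)) i := by
    refine forall_congr' fun X => ?_
    rw [val_eq_iff D gen ω (hlt _ _) (hlt _ _), ← pieceCoset_eq D gen ω hxy hx,
      ← pieceCoset_eq D gen ω hxy hx]
    simp only [sepGoal, List.mem_append, List.mem_flatMap, List.mem_range]
    constructor
    · rintro ⟨E, hE | ⟨i, hi, hE⟩, z, hz⟩ ⟨-, hval⟩
      · by_cases hPQ : P.1 = Q.1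
        · have : (P.1 == Q.1) = true := by simpa using hPQ
          rw [this, cond_true, List.mem_singleton] at hE
          subst hE
          refine ⟨hPQ, fun i hi => ?_⟩
          have h1 := hz _ (List.mem_flatMap.2 ⟨i, List.mem_range.2 hi, List.mem_cons_self⟩)
          have h2 := hz _ (List.mem_flatMap.2 ⟨i, List.mem_range.2 hi,
            List.mem_cons_of_mem _ List.mem_cons_self⟩)
          rw [AffForm.val_geConst, hpt] at h1
          rw [AffForm.val_leNegConst, hpt] at h2
          omega
        · have : (P.1 == Q.1) = false := by simpa using hPQ
          rw [this, cond_false] at hE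
          exact absurd hE List.not_mem_nil
      · have := hval i hi
        simp only [List.mem_cons, List.not_mem_nil, or_false] at hE
        rcases hE with rfl | rfl
        · have h1 := hz _ List.mem_cons_self
          rw [AffForm.val_geConst, hev] at h1
          omega
        · have h1 := hz _ List.mem_cons_self
          rw [AffForm.val_leNegConst, hev] at h1
          omega
    · intro h
      by_cases hval : ∀ i < inputRank II, coordCode II (P.word x y X) i =
          coordCode II (Q.word x y fun t => X (t + P.2.2.2.length)) i
      · obtain ⟨hPQ, hp⟩ := h ⟨hc, hval⟩
        have : (P.1 == Q.1) = true := by simpa using hPQ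
        rw [this, cond_true]
        refine ⟨_, Or.inl (List.mem_singleton_self _), 0, fun κ hκ => ?_⟩
        obtain ⟨i, hi, hκ⟩ := List.mem_flatMap.1 hκ
        have := hp i (List.mem_range.1 hi)
        simp only [List.mem_cons, List.not_mem_nil, or_false] at hκ
        rcases hκ with rfl | rfl
        · rw [AffForm.val_geConst, hpt]; omega
        · rw [AffForm.val_leNegConst, hpt]; omega
      · push Not at hval
        obtain ⟨i, hi, hne⟩ := hval
        rcases lt_or_gt_of_ne hne with hlt | hlt
        · refine ⟨_, Or.inr ⟨i, hi, List.mem_cons_of_mem _ List.mem_cons_self⟩, 0,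
            List.forall_mem_singleton.2 ?_⟩
          rw [AffForm.val_leNegConst, hev]; omega
        · refine ⟨_, Or.inr ⟨i, hi, List.mem_cons_self⟩, 0, List.forall_mem_singleton.2 ?_⟩
          rw [AffForm.val_geConst, hev]; omega
  rw [h1]
  refine ⟨fun h z z' => ?_, fun h X => h _ _⟩
  -- Conversely, independent parameters `z` and `z'` are read off one concatenated sequence.
  have := h fun t => if t < P.2.2.2.length then z t else z' (t - P.2.2.2.length)
  have e1 : linPoint P.2.2.1 P.2.2.2
      (fun t => if t < P.2.2.2.length then z t else z' (t - P.2.2.2.length)) =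
      linPoint P.2.2.1 P.2.2.2 z := linPoint_congr fun t ht => if_pos ht
  have e2 : (fun t => (fun t => if t < P.2.2.2.length then z t else z' (t - P.2.2.2.length))
      (t + P.2.2.2.length)) = z' := by
    funext t
    simp
  rw [e2, Piece.word, e1] at this
  exact this

theorem fullPiece_word (π : List ℕ) (w : ℕ → ℕ) :
    (fullPiece x.length π).word x y w = patWord x y π w := by
  refine patWord_congr _ _ fun i hi => ?_
  have hi : i < (π.length + 1) * x.length := hi
  simp only [fullPiece, linPoint, List.length_map, List.length_range]
  rw [Finset.sum_eq_single i]
  · simp [List.getD_eq_getElem?_getD, hi]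
  · intro t ht hti
    have ht : t < (π.length + 1) * x.length := by simpa using ht
    have : (i == t) = false := by simpa using Ne.symm hti
    simp [List.getD_eq_getElem?_getD, hi, ht, this]
  · intro h
    exact absurd (Finset.mem_range.2 hi) h

theorem classGoals_valid (cls : List ClassCode) (hxy : ∀ u ∈ x ++ y, ∀ a ∈ u, a < k)
    (hx : ∀ u ∈ x, val ss u ∈ D.A) :
    (∀ g ∈ classGoals II ((x, y), cls), g.Valid) ↔
      (∀ π : List ℕ, π.length ≤ D.A.index → (∀ p ∈ π, p < y.length) → ∀ w : ℕ → ℕ,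
        ∃ P ∈ pieces cls, ∃ z, val ss (P.word x y z) = val ss (patWord x y π w) ∧
          weight (letterWeights II) (P.word x y z) ≤
            weight (letterWeights II) (patWord x y π w)) ∧
      ∀ P ∈ pieces cls, ∀ Q ∈ pieces cls, ∀ z z',
        val ss (P.word x y z) = val ss (Q.word x y z') → P.1 = Q.1 ∧
          ∀ i < (P.2.1.length + 1) * x.length,
            linPoint P.2.2.1 P.2.2.2 z i = linPoint Q.2.2.1 Q.2.2.2 z' i := by
  have hd : inputIndex II = D.A.index := D.index_eq.symm
  have hlt : ∀ (P : Piece) z, ∀ a ∈ P.word x y z, a < k := fun P z => lt_of_mem_patWord hxy _ _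
  rw [classGoals, List.forall_mem_append, List.forall_mem_map]
  simp only [List.mem_flatMap, forall_exists_index, and_imp, mem_wordsLE, hd,
    domGoal_valid D gen ω hxy hx, fullPiece_word]
  refine and_congr Iff.rfl ⟨fun h P hP Q hQ z z' hval => ?_, fun h g P hP Q hQ hg => ?_⟩
  · have hc : pieceCoset II x y P = pieceCoset II x y Q := by
      rw [pieceCoset_eq D gen ω hxy hx P z, pieceCoset_eq D gen ω hxy hx Q z']
      exact ((val_eq_iff D gen ω (hlt _ _) (hlt _ _)).1 hval).1
    have hb : (pieceCoset II x y P == pieceCoset II x y Q) = true := by simpa using hc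
    exact (sepGoal_valid D gen ω hxy hx P Q hc).1
      (h _ P hP Q hQ (by rw [hb, cond_true]; exact List.mem_singleton_self _)) z z' hval
  · by_cases hc : pieceCoset II x y P = pieceCoset II x y Q
    · have hb : (pieceCoset II x y P == pieceCoset II x y Q) = true := by simpa using hc
      rw [hb, cond_true, List.mem_singleton] at hg
      rw [hg]
      exact (sepGoal_valid D gen ω hxy hx P Q hc).2 (h P hP Q hQ)
    · have hb : (pieceCoset II x y P == pieceCoset II x y Q) = false := by simpa using hc
      rw [hb, cond_false] at hg
      exact absurd hg List.not_mem_nil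

/-- The direction to the right makes every output of the search trustworthy; the direction to the
left makes the search terminate. -/
theorem check_iff (o : OutputCode) :
    (checkOutput II o = true ∧ ∃ l, runCert (classGoals II o) l = []) ↔
      GoodWords D.A ss (letterWeights II) k o.1.1 o.1.2 ∧
      GoodClasses ss (letterWeights II) D.A.index o.1.1 o.1.2 o.2 := by
  obtain ⟨⟨x, y⟩, cls⟩ := o
  simp only [checkOutput, Bool.and_eq_true, checkWords_iff, List.all_eq_true, List.mem_range,
    Bool.or_eq_true, Bool.not_eq_true', decide_eq_false_iff_not, beq_iff_eq, checkClass_iff,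
    ← imp_iff_not_or, exists_runCert_iff, and_assoc]
  refine and_congr_right fun hw => ?_
  rw [classGoals_valid D gen ω cls (fun u hu => (hw.short u hu).1) hw.mem]
  constructor
  · rintro ⟨h1, h2, h3, h4⟩
    exact ⟨h1, h2, h3, h4⟩
  · rintro ⟨h1, h2, h3, h4⟩
    exact ⟨h1, h2, h3, h4⟩

end

end VirtAbelian

/-! ### Existence of a good output -/

namespace VirtAbelian

/-! #### Semilinear expressions -/

theorem mem_closure_list {M : Type*} [AddCommMonoid M] (B : List M) (v : M) :
    v ∈ AddSubmonoid.closure {v | v ∈ B} ↔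
      ∃ z : ℕ → ℕ, v = ∑ t ∈ Finset.range B.length, z t • B.getD t 0 := by
  constructor
  · intro h
    induction h using AddSubmonoid.closure_induction with
    | mem v hv =>
      obtain ⟨t, ht, rfl⟩ := List.getElem_of_mem hv
      refine ⟨Pi.single t 1, ?_⟩
      rw [Finset.sum_eq_single t]
      · simp [List.getD_eq_getElem?_getD, ht]
      · intro j _ hj; simp [Pi.single_eq_of_ne hj]
      · intro h; exact absurd (Finset.mem_range.2 ht) h
    | zero => exact ⟨0, by simp⟩
    | add v w _ _ ihv ihw =>
      obtain ⟨z, rfl⟩ := ihv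
      obtain ⟨z', rfl⟩ := ihw
      exact ⟨z + z', by simp [add_smul, Finset.sum_add_distrib]⟩
  · rintro ⟨z, rfl⟩
    refine AddSubmonoid.sum_mem _ fun t ht => AddSubmonoid.nsmul_mem _ ?_ _
    rw [List.getD_eq_getElem _ _ (Finset.mem_range.1 ht)]
    exact AddSubmonoid.subset_closure (List.getElem_mem _)

def SemilinearExpr.code {m : ℕ} (E : SemilinearExpr m) : List (List ℕ × List (List ℕ)) :=
  E.map fun p => (List.ofFn p.1, p.2.map List.ofFn)

theorem getD_ofFn {m : ℕ} (f : Fin m → ℕ) (i : Fin m) : (List.ofFn f).getD i 0 = f i := by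
  simp [List.getD_eq_getElem?_getD]

theorem SemilinearExpr.mem_toSet {m : ℕ} (E : SemilinearExpr m) (v : Fin m → ℕ) :
    v ∈ E.toSet ↔ ∃ p ∈ E.code, ∃ z, ∀ i : Fin m, v i = linPoint p.1 p.2 z i := by
  have key : ∀ (p : (Fin m → ℕ) × List (Fin m → ℕ)) z, (∀ i : Fin m,
      v i = linPoint (List.ofFn p.1) (p.2.map List.ofFn) z i) ↔
      v = p.1 + ∑ t ∈ Finset.range p.2.length, z t • p.2.getD t 0 := by
    intro p z
    rw [funext_iff]
    refine forall_congr' fun i => ?_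
    rw [linPoint, getD_ofFn, Pi.add_apply, Finset.sum_apply, List.length_map]
    have : ∀ t ∈ Finset.range p.2.length, z t * ((p.2.map List.ofFn).getD t []).getD i 0 =
        (z t • p.2.getD t 0) i := fun t ht => by
      have ht : t < p.2.length := by simpa using ht
      simp [List.getD_eq_getElem?_getD, ht]
    rw [Finset.sum_congr rfl this]
  simp only [SemilinearExpr.toSet, SemilinearExpr.code, Set.mem_iUnion, List.mem_map,
    exists_prop, exists_exists_and_eq_and, key]
  refine exists_congr fun p => and_congr_right fun _ => ?_
  rw [Set.mem_vadd_set]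
  simp only [SetLike.mem_coe, mem_closure_list, vadd_eq_add]
  constructor
  · rintro ⟨_, ⟨z, rfl⟩, rfl⟩; exact ⟨z, rfl⟩
  · rintro ⟨z, rfl⟩; exact ⟨_, ⟨z, rfl⟩, rfl⟩

theorem exists_semilinearExpr {m : ℕ} {s : Set (Fin m → ℕ)} (hs : IsSemilinearSet s) :
    ∃ E : SemilinearExpr m, E.toSet = s := by
  obtain ⟨S, hS, hlin, rfl⟩ := hs
  have h : ∀ t : S, ∃ p : (Fin m → ℕ) × List (Fin m → ℕ),
      (t : Set (Fin m → ℕ)) = p.1 +ᵥ (AddSubmonoid.closure {v | v ∈ p.2} : Set (Fin m → ℕ)) := by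
    intro t
    obtain ⟨a, B, hB, h⟩ := hlin t t.2
    refine ⟨(a, hB.toFinset.toList), ?_⟩
    rw [h]
    simp
  choose p hp using h
  have := hS.fintype
  refine ⟨(Finset.univ : Finset S).toList.map p, ?_⟩
  ext v
  simp only [SemilinearExpr.toSet, Set.mem_iUnion, List.mem_map, Finset.mem_toList,
    Finset.mem_univ, true_and, exists_prop, Set.mem_sUnion]
  constructor
  · rintro ⟨_, ⟨t, rfl⟩, hv⟩
    exact ⟨t, t.2, by rwa [hp t]⟩
  · rintro ⟨t, ht, hv⟩
    exact ⟨_, ⟨⟨t, ht⟩, rfl⟩, by rwa [← hp ⟨t, ht⟩]⟩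

/-! #### Words for the extended generators -/

/-- Representatives of least `o` for each value of `f`, collected by running through the list and
exchanging a representative whenever a lighter one appears. -/
theorem exists_representatives {α H : Type*} (L : List α) (f : α → H) (o : α → ℕ) (e : α) :
    ∃ x : List α, (∀ u ∈ x, u ∈ L) ∧
      (∀ i < x.length, ∀ j < x.length, f (x.getD i e) = f (x.getD j e) → i = j) ∧
      ∀ u ∈ L, ∃ v ∈ x, f v = f u ∧ o v ≤ o u := by
  induction L with
  | nil => exact ⟨[], by simp, by simp, by simp⟩
  | cons a L ih =>
    obtain ⟨x, h1, h2, h3⟩ := ih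
    by_cases ha : ∃ i < x.length, f (x.getD i e) = f a
    · obtain ⟨i, hi, hia⟩ := ha
      have hxi : x.getD i e ∈ x := by rw [List.getD_eq_getElem _ _ hi]; exact List.getElem_mem _
      by_cases ho : o (x.getD i e) ≤ o a
      · refine ⟨x, fun u hu => List.mem_cons_of_mem _ (h1 u hu), h2, fun u hu => ?_⟩
        rcases List.mem_cons.1 hu with rfl | hu
        · exact ⟨_, hxi, hia, ho⟩
        · exact h3 u hu
      -- Exchanging in place leaves the list of values unchanged, so distinctness persists.
      · have hf : ∀ j < x.length, f ((x.set i a).getD j e) = f (x.getD j e) := fun j hj => by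
          by_cases hij : i = j
          · subst hij
            rw [hia]
            simp [List.getD_eq_getElem?_getD, hj]
          · simp [List.getD_eq_getElem?_getD, List.getElem?_set_ne hij]
        refine ⟨x.set i a, fun u hu => ?_, fun p hp q hq hpq => ?_, fun u hu => ?_⟩
        · rcases List.mem_or_eq_of_mem_set hu with hu | rfl
          · exact List.mem_cons_of_mem _ (h1 u hu)
          · exact List.mem_cons_self
        · rw [List.length_set] at hp hq
          rw [hf p hp, hf q hq] at hpq
          exact h2 p hp q hq hpq
        · rcases List.mem_cons.1 hu with rfl | hu
          · exact ⟨u, List.mem_set hi u, rfl, le_rfl⟩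
          · obtain ⟨v, hv, hvu, hvo⟩ := h3 u hu
            obtain ⟨j, hj, rfl⟩ := List.getElem_of_mem hv
            by_cases hij : i = j
            · subst hij
              rw [List.getD_eq_getElem _ _ hj] at hia ho
              exact ⟨a, List.mem_set hi a, by rw [← hia, hvu], by omega⟩
            · refine ⟨x[j], ?_, hvu, hvo⟩
              rw [← List.getElem_set_ne hij (a := a) (by simpa using hj)]
              exact List.getElem_mem _
    · push Not at ha
      refine ⟨a :: x, fun u hu => ?_, fun p hp q hq hpq => ?_, fun u hu => ?_⟩
      · rcases List.mem_cons.1 hu with rfl | hu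
        · exact List.mem_cons_self
        · exact List.mem_cons_of_mem _ (h1 u hu)
      · rcases p with _ | p <;> rcases q with _ | q
        · rfl
        · exact absurd hpq.symm (ha q (by simpa using hq))
        · exact absurd hpq (ha p (by simpa using hp))
        · rw [h2 p (by simpa using hp) q (by simpa using hq) hpq]
      · rcases List.mem_cons.1 hu with rfl | hu
        · exact ⟨u, List.mem_cons_self, rfl, le_rfl⟩
        · obtain ⟨v, hv, h⟩ := h3 u hu
          exact ⟨v, List.mem_cons_of_mem _ hv, h⟩

theorem exists_goodWords {G : Type*} [Group G] (A : Subgroup G) (s : ℕ → G) (o : ℕ → ℕ) (k : ℕ) :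
    ∃ x y, GoodWords A s o k x y := by
  classical
  let L := (wordsLE k A.index).filter fun u => 1 ≤ u.length
  have hL : ∀ u, u ∈ L ↔ (∀ a ∈ u, a < k) ∧ 1 ≤ u.length ∧ u.length ≤ A.index := fun u => by
    simp only [L, List.mem_filter, mem_wordsLE, decide_eq_true_eq]; tauto
  obtain ⟨x, hx1, hx2, hx3⟩ := exists_representatives (L.filter fun u => val s u ∈ A) (val s)
    (weight o) []
  obtain ⟨y, hy1, hy2, hy3⟩ := exists_representatives (L.filter fun u => val s u ∉ A) (val s)
    (weight o) []
  simp only [List.mem_filter, decide_eq_true_eq] at hx1 hx3 hy1 hy3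
  refine ⟨x, y, ⟨fun u hu => ?_, fun u hu => (hx1 u hu).2, fun u hu => (hy1 u hu).2, hx2, hy2,
    fun u hu hu1 hu2 => ?_⟩⟩
  · rcases List.mem_append.1 hu with hu | hu
    · exact (hL u).1 (hx1 u hu).1
    · exact (hL u).1 (hy1 u hu).1
  · have huL := (hL u).2 ⟨hu, hu1, hu2⟩
    by_cases hA : val s u ∈ A
    · obtain ⟨v, hv, h⟩ := hx3 u ⟨huL, hA⟩
      exact ⟨v, List.mem_append_left _ hv, h⟩
    · obtain ⟨v, hv, h⟩ := hy3 u ⟨huL, hA⟩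
      exact ⟨v, List.mem_append_right _ hv, h⟩

/-! #### Minimal parameters -/

section Minimal

variable {G : Type*} [Group G] (x y : List (List ℕ)) (s : ℕ → G) (o : ℕ → ℕ)

/-- The number of parameters of a pattern. -/
abbrev patDim (π : List ℕ) : ℕ := (π.length + 1) * x.length

def vecWord (π : List ℕ) (w : Fin (patDim x π) → ℕ) : List ℕ := patWord x y π (extend w)

theorem patWord_eq_vecWord (π : List ℕ) (w : ℕ → ℕ) :
    patWord x y π w = vecWord x y π fun i => w i :=
  patWord_congr _ _ fun i hi => by simp [extend, hi]

/-- The parameters of words that are not dominated by a word with another pattern. -/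
def patMinimal (L : List (List ℕ)) (π : List ℕ) : Set (Fin (patDim x π) → ℕ) :=
  {w | ∀ π' ∈ L, ¬∃ w' : Fin (patDim x π') → ℕ, val s (vecWord x y π' w') = val s (vecWord x y π w) ∧
    (weight o (vecWord x y π' w') < weight o (vecWord x y π w) ∨
      weight o (vecWord x y π' w') = weight o (vecWord x y π w) ∧
        Encodable.encode π' < Encodable.encode π)}

/-- The parameters of words that are not dominated by a word with the same pattern. -/
def lexMinimal (π : List ℕ) : Set (Fin (patDim x π) → ℕ) :=
  {w | ¬∃ w' : Fin (patDim x π) → ℕ, val s (vecWord x y π w') = val s (vecWord x y π w) ∧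
    weight o (vecWord x y π w') = weight o (vecWord x y π w) ∧
      ∃ i, (∀ j < i, w' j = w j) ∧ w' i < w i}

/-- Words are ordered by weight, then by the code of the pattern, then lexicographically by
exponents. The last comparison only makes sense within one pattern, so the minimum is taken in two
stages. -/
theorem exists_minimal {L : List (List ℕ)} {π : List ℕ} (hπ : π ∈ L)
    (w : Fin (patDim x π) → ℕ) :
    ∃ π' ∈ L, ∃ w' ∈ patMinimal x y s o L π' ∩ lexMinimal x y s o π',
      val s (vecWord x y π' w') = val s (vecWord x y π w) ∧
      weight o (vecWord x y π' w') ≤ weight o (vecWord x y π w) := by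
  -- First stage: least pair of weight and pattern code among the words of the given value.
  let K : Set (ℕ ×ₗ ℕ) := {κ | ∃ π' ∈ L, ∃ w' : Fin (patDim x π') → ℕ,
    val s (vecWord x y π' w') = val s (vecWord x y π w) ∧
      κ = toLex (weight o (vecWord x y π' w'), Encodable.encode π')}
  obtain ⟨κ, ⟨π₁, hπ₁, w₁, hv₁, rfl⟩, hmin⟩ :=
    (wellFounded_lt (α := ℕ ×ₗ ℕ)).has_min K ⟨_, π, hπ, w, rfl, rfl⟩
  have hmin' : ∀ π' ∈ L, ∀ w' : Fin (patDim x π') → ℕ,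
      val s (vecWord x y π' w') = val s (vecWord x y π w) →
      ¬(weight o (vecWord x y π' w') < weight o (vecWord x y π₁ w₁) ∨
      weight o (vecWord x y π' w') = weight o (vecWord x y π₁ w₁) ∧
        Encodable.encode π' < Encodable.encode π₁) := fun π' hπ' w' hv' h =>
    hmin _ ⟨π', hπ', w', hv', rfl⟩ (Prod.Lex.toLex_lt_toLex.2 h)
  -- Second stage: lexicographically least exponents with that pattern, weight and value.
  let W : Set (Lex (Fin (patDim x π₁) → ℕ)) := {v |
    val s (vecWord x y π₁ (ofLex v)) = val s (vecWord x y π w) ∧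
      weight o (vecWord x y π₁ (ofLex v)) = weight o (vecWord x y π₁ w₁)}
  obtain ⟨v, ⟨hv, hvw⟩, hvmin⟩ :=
    (wellFounded_lt (α := Lex (Fin (patDim x π₁) → ℕ))).has_min W ⟨toLex w₁, hv₁, rfl⟩
  refine ⟨π₁, hπ₁, ofLex v, ⟨?_, ?_⟩, hv, ?_⟩
  · rintro π' hπ' ⟨w', hw', h⟩
    rw [hvw] at h
    exact hmin' π' hπ' w' (hw'.trans hv) h
  · rintro ⟨w', hw', hw'w, h⟩
    exact hvmin (toLex w') ⟨hw'.trans hv, hw'w.trans hvw⟩ h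
  · rw [hvw]
    by_contra hlt
    exact hmin' π hπ w rfl (Or.inl (not_le.1 hlt))

/-- Neither word can beat the other, so weights agree, then pattern codes, then exponents, as each
comparison is total. -/
theorem minimal_unique {L : List (List ℕ)} {π π' : List ℕ} (hπ : π ∈ L) (hπ' : π' ∈ L)
    {w : Fin (patDim x π) → ℕ} {w' : Fin (patDim x π') → ℕ}
    (h₁ : w ∈ patMinimal x y s o L π) (h₂ : w ∈ lexMinimal x y s o π)
    (h₁' : w' ∈ patMinimal x y s o L π') (h₂' : w' ∈ lexMinimal x y s o π')
    (hv : val s (vecWord x y π w) = val s (vecWord x y π' w')) :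
    ∃ h : π = π', h ▸ w = w' := by
  have a₁ : ¬(_ ∨ _) := fun h => h₁ π' hπ' ⟨w', hv.symm, h⟩
  have a₂ : ¬(_ ∨ _) := fun h => h₁' π hπ ⟨w, hv, h⟩
  have hw : weight o (vecWord x y π w) = weight o (vecWord x y π' w') := by omega
  have hπ : π = π' := Encodable.encode_injective (by omega)
  subst hπ
  refine ⟨rfl, ?_⟩
  rcases lt_trichotomy (toLex w) (toLex w') with h | h | h
  · exact absurd ⟨w, hv, hw, h⟩ h₂'
  · exact h
  · exact absurd ⟨w', hv.symm, hw.symm, h⟩ h₂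

end Minimal

/-! #### Semilinearity -/

def extendFun {p : ℕ} {ι : Type*} (e : Fin p → ι) : (ι → ℕ) →+ (ℕ → ℕ) where
  toFun v := extend (v ∘ e)
  map_zero' := by funext i; simp [extend]
  map_add' v w := by funext i; simp only [extend, Pi.add_apply]; split_ifs <;> simp

section

variable {G : Type*} [Group G] (D : Description G) {k : ℕ}
  (gen : Fin k → NormalForm D.rank D.numT) (ω : Fin k → ℕ)
  {x y : List (List ℕ)}

local notation "II" => D.inputCode gen ω
local notation "ss" => letters fun i => nfValue D.b D.t (gen i)

/-- The maps `e` and `e'` select the exponents of two words from one joint vector, so that one of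
the two can later be projected away. -/
theorem isSemilinearSet_coordCode_le (hxy : ∀ u ∈ x ++ y, ∀ a ∈ u, a < k)
    (hx : ∀ u ∈ x, val ss u ∈ D.A) (π π' : List ℕ) (i : ℕ) (c : ℤ) {ι : Type*} [Finite ι]
    (e : Fin (patDim x π) → ι) (e' : Fin (patDim x π') → ι) :
    IsSemilinearSet {v : ι → ℕ | coordCode II (vecWord x y π (v ∘ e)) i + c ≤
      coordCode II (vecWord x y π' (v ∘ e')) i} := by
  obtain ⟨F, hF⟩ := exists_affine_coordCode D gen ω hxy hx π i
  obtain ⟨F', hF'⟩ := exists_affine_coordCode D gen ω hxy hx π' i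
  have := isSemilinearSet_nonneg (F'.comp (extendFun e') - F.comp (extendFun e))
    (coordCode II (patWord x y π' 0) i - coordCode II (patWord x y π 0) i - c)
  convert this using 1
  ext v
  simp only [Set.mem_ofPred_eq, vecWord, hF (extend _), hF' (extend _), AddMonoidHom.sub_apply,
    AddMonoidHom.comp_apply]
  change _ ↔ 0 ≤ F' (extend (v ∘ e')) - F (extend (v ∘ e)) + _
  constructor <;> intro h <;> linarith

theorem isSemilinearSet_coordCode_eq (hxy : ∀ u ∈ x ++ y, ∀ a ∈ u, a < k)
    (hx : ∀ u ∈ x, val ss u ∈ D.A) (π π' : List ℕ) (i : ℕ) {ι : Type*} [Finite ι]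
    (e : Fin (patDim x π) → ι) (e' : Fin (patDim x π') → ι) :
    IsSemilinearSet {v : ι → ℕ | coordCode II (vecWord x y π (v ∘ e)) i =
      coordCode II (vecWord x y π' (v ∘ e')) i} := by
  have := (isSemilinearSet_coordCode_le D gen ω hxy hx π π' i 0 e e').inter
    (isSemilinearSet_coordCode_le D gen ω hxy hx π' π i 0 e' e)
  convert this using 1
  ext v
  simp only [Set.mem_ofPred_eq, Set.mem_inter_iff, add_zero]
  exact le_antisymm_iff

theorem isSemilinearSet_val_eq (hxy : ∀ u ∈ x ++ y, ∀ a ∈ u, a < k)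
    (hx : ∀ u ∈ x, val ss u ∈ D.A) (π π' : List ℕ) {ι : Type*} [Finite ι]
    (e : Fin (patDim x π) → ι) (e' : Fin (patDim x π') → ι) :
    IsSemilinearSet {v : ι → ℕ | val ss (vecWord x y π (v ∘ e)) =
      val ss (vecWord x y π' (v ∘ e'))} := by
  have hlt : ∀ π w, ∀ a ∈ patWord x y π w, a < k := fun π w => lt_of_mem_patWord hxy π w
  -- Values do not depend on the weights, so these are set to `0`. The cosets are fixed by the
  -- patterns: if they differ, the set is empty.
  have hcos : ∀ π w, (wordCode (D.inputCode gen 0) (patWord x y π w)).2 =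
      pieceCoset (D.inputCode gen 0) x y (fullPiece x.length π) := fun π w => by
    rw [pieceCoset_eq D gen 0 hxy hx _ w, fullPiece_word]
  simp only [vecWord, val_eq_iff D gen 0 (hlt _ _) (hlt _ _), hcos]
  by_cases hc : pieceCoset (D.inputCode gen 0) x y (fullPiece x.length π) =
      pieceCoset (D.inputCode gen 0) x y (fullPiece x.length π')
  · simp only [hc, true_and]
    have := isSemilinearSet_forall_mem_list (List.range (inputRank (D.inputCode gen 0)))
      fun i _ => isSemilinearSet_coordCode_eq D gen 0 hxy hx π π' i e e'
    simpa only [List.mem_range, vecWord] using this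
  · simp only [hc, false_and]
    exact IsSemilinearSet.empty

theorem isSemilinearSet_weight_lt (hxy : ∀ u ∈ x ++ y, ∀ a ∈ u, a < k)
    (hx : ∀ u ∈ x, val ss u ∈ D.A) (π π' : List ℕ) {ι : Type*} [Finite ι]
    (e : Fin (patDim x π) → ι) (e' : Fin (patDim x π') → ι) :
    IsSemilinearSet {v : ι → ℕ | weight (letterWeights II) (vecWord x y π (v ∘ e)) <
      weight (letterWeights II) (vecWord x y π' (v ∘ e'))} := by
  have := isSemilinearSet_coordCode_le D gen ω hxy hx π π' (inputRank II) 1 e e'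
  simp only [coordCode_rank] at this
  convert this using 1
  ext v
  simp only [Set.mem_ofPred_eq]
  omega

theorem isSemilinearSet_weight_eq (hxy : ∀ u ∈ x ++ y, ∀ a ∈ u, a < k)
    (hx : ∀ u ∈ x, val ss u ∈ D.A) (π π' : List ℕ) {ι : Type*} [Finite ι]
    (e : Fin (patDim x π) → ι) (e' : Fin (patDim x π') → ι) :
    IsSemilinearSet {v : ι → ℕ | weight (letterWeights II) (vecWord x y π (v ∘ e)) =
      weight (letterWeights II) (vecWord x y π' (v ∘ e'))} := by
  have := isSemilinearSet_coordCode_eq D gen ω hxy hx π π' (inputRank II) e e'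
  simpa only [coordCode_rank, Nat.cast_inj] using this

theorem isSemilinearSet_lex {m : ℕ} {ι : Type*} [Finite ι] (e e' : Fin m → ι) :
    IsSemilinearSet {v : ι → ℕ | ∃ i, (∀ j < i, v (e j) = v (e' j)) ∧ v (e i) < v (e' i)} := by
  have hle : ∀ (a b : ι) (c : ℕ), IsSemilinearSet {v : ι → ℕ | v a + c ≤ v b} := fun a b c => by
    have := isSemilinearSet_nonneg
      ((Nat.castAddMonoidHom ℤ).comp (Pi.evalAddMonoidHom (fun _ : ι => ℕ) b) -
        (Nat.castAddMonoidHom ℤ).comp (Pi.evalAddMonoidHom (fun _ : ι => ℕ) a)) (-(c : ℤ))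
    convert this using 1
    ext v
    simp only [Set.mem_ofPred_eq, AddMonoidHom.sub_apply, AddMonoidHom.comp_apply,
      Pi.evalAddMonoidHom_apply, Nat.coe_castAddMonoidHom]
    omega
  have heq : ∀ a b : ι, IsSemilinearSet {v : ι → ℕ | v a = v b} := fun a b => by
    convert (hle a b 0).inter (hle b a 0) using 1
    ext v
    simp only [Set.mem_ofPred_eq, Set.mem_inter_iff, add_zero]
    exact le_antisymm_iff
  have h : ∀ i, IsSemilinearSet
      {v : ι → ℕ | (∀ j < i, v (e j) = v (e' j)) ∧ v (e i) < v (e' i)} := fun i => by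
    have h1 : IsSemilinearSet {v : ι → ℕ | ∀ j < i, v (e j) = v (e' j)} := by
      have := isSemilinearSet_forall_mem_list (Finset.univ.filter (· < i)).toList
        fun j _ => heq (e j) (e' j)
      simpa using this
    exact h1.inter (hle (e i) (e' i) 1)
  convert IsSemilinearSet.iUnion h using 1
  ext v
  simp

/-- Not being dominated is the complement of a projection of a semilinear relation. -/
theorem isSemilinearSet_patMinimal (hxy : ∀ u ∈ x ++ y, ∀ a ∈ u, a < k)
    (hx : ∀ u ∈ x, val ss u ∈ D.A) (L : List (List ℕ)) (π : List ℕ) :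
    IsSemilinearSet (patMinimal x y ss (letterWeights II) L π) := by
  refine isSemilinearSet_forall_mem_list L fun π' _ => IsSemilinearSet.compl ?_
  refine IsSemilinearSet.proj' (p := fun w (w' : Fin (patDim x π') → ℕ) =>
    val ss (vecWord x y π' w') = val ss (vecWord x y π w) ∧
    (weight (letterWeights II) (vecWord x y π' w') < weight (letterWeights II) (vecWord x y π w) ∨
      weight (letterWeights II) (vecWord x y π' w') = weight (letterWeights II) (vecWord x y π w) ∧
        Encodable.encode π' < Encodable.encode π)) ?_
  refine (isSemilinearSet_val_eq D gen hxy hx π' π Sum.inr Sum.inl).inter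
    ((isSemilinearSet_weight_lt D gen ω hxy hx π' π Sum.inr Sum.inl).union ?_)
  by_cases h : Encodable.encode π' < Encodable.encode π
  · simp only [h, and_true]
    exact isSemilinearSet_weight_eq D gen ω hxy hx π' π Sum.inr Sum.inl
  · simp only [h, and_false]
    exact IsSemilinearSet.empty

theorem isSemilinearSet_lexMinimal (hxy : ∀ u ∈ x ++ y, ∀ a ∈ u, a < k)
    (hx : ∀ u ∈ x, val ss u ∈ D.A) (π : List ℕ) :
    IsSemilinearSet (lexMinimal x y ss (letterWeights II) π) := by
  refine IsSemilinearSet.compl ?_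
  refine IsSemilinearSet.proj' (p := fun w (w' : Fin (patDim x π) → ℕ) =>
    val ss (vecWord x y π w') = val ss (vecWord x y π w) ∧
    weight (letterWeights II) (vecWord x y π w') = weight (letterWeights II) (vecWord x y π w) ∧
      ∃ i, (∀ j < i, w' j = w j) ∧ w' i < w i) ?_
  exact (isSemilinearSet_val_eq D gen hxy hx π π Sum.inr Sum.inl).inter
    ((isSemilinearSet_weight_eq D gen ω hxy hx π π Sum.inr Sum.inl).inter
      (isSemilinearSet_lex Sum.inr Sum.inl))

theorem mem_pieces {cls : List ClassCode} {P : Piece} :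
    P ∈ pieces cls ↔ P.1 < cls.length ∧ P.2.1 = (cls.getD P.1 ([], [], [], 0)).1 ∧
      (P.2.2.1, P.2.2.2) ∈ (cls.getD P.1 ([], [], [], 0)).2.1 := by
  simp only [pieces, List.mem_flatMap, List.mem_range, List.mem_map]
  constructor
  · rintro ⟨j, hj, p, hp, rfl⟩
    exact ⟨hj, rfl, hp⟩
  · rintro ⟨h1, h2, h3⟩
    exact ⟨P.1, h1, _, h3, by rw [← h2]⟩

/-- One class per pattern, whose image is a semilinear expression for its minimal parameters.
Existence of minimal words gives `dom`, and their uniqueness gives `sep`. -/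
theorem exists_goodClasses (hxy : ∀ u ∈ x ++ y, ∀ a ∈ u, a < k)
    (hx : ∀ u ∈ x, val ss u ∈ D.A) :
    ∃ cls, GoodClasses ss (letterWeights II) D.A.index x y cls := by
  classical
  set o := letterWeights II with ho
  let L := (wordsLE y.length D.A.index).dedup
  have hL : ∀ π, π ∈ L ↔ π.length ≤ D.A.index ∧ ∀ p ∈ π, p < y.length := fun π => by
    simp only [L, List.mem_dedup, mem_wordsLE]
  let S : (π : List ℕ) → Set (Fin (patDim x π) → ℕ) := fun π =>
    patMinimal x y ss o L π ∩ lexMinimal x y ss o π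
  have hS : ∀ π, IsSemilinearSet (S π) := fun π =>
    (isSemilinearSet_patMinimal D gen ω hxy hx L π).inter
      (isSemilinearSet_lexMinimal D gen ω hxy hx π)
  choose E hE using fun π => exists_semilinearExpr (hS π)
  -- Patterns without minimal words are dropped, since classes must be nonempty.
  let L' := L.filter fun π => (S π).Nonempty
  have hL' : ∀ π, π ∈ L' ↔ π ∈ L ∧ (S π).Nonempty := fun π => by simp [L']
  have hnodup : L'.Nodup := (List.nodup_dedup _).filter _
  let C : List ℕ → ClassCode := fun π => (π, (E π).code,
    (List.range (patDim x π)).map (fun i => weight o (x.getD (i % x.length) [])),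
    weight o (patWord x y π fun i => ([] : List ℕ).getD i 0))
  have hget : ∀ j (hj : j < L'.length), (L'.map C).getD j ([], [], [], 0) = C L'[j] := fun j hj => by
    simp [List.getD_eq_getElem?_getD, hj]
  have hmem : ∀ π (w : ℕ → ℕ), (fun i : Fin (patDim x π) => w i) ∈ S π ↔
      ∃ p ∈ (E π).code, ∃ z, ∀ i : Fin (patDim x π), w i = linPoint p.1 p.2 z i := fun π w => by
    rw [← hE π, SemilinearExpr.mem_toSet]
  refine ⟨L'.map C, ⟨fun i hi j hj hij => ?_, fun c hc => ?_, fun π hπ hπy w => ?_,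
    fun P hP Q hQ z z' hv => ?_⟩⟩
  · rw [List.length_map] at hi hj
    rw [hget i hi, hget j hj] at hij
    exact (List.Nodup.getElem_inj_iff hnodup).1 hij
  · obtain ⟨π, hπ, rfl⟩ := List.mem_map.1 hc
    obtain ⟨hπL, v, hv⟩ := (hL' π).1 hπ
    obtain ⟨h1, h2⟩ := (hL π).1 hπL
    refine ⟨h1, h2, ?_, fun p hp => ?_, rfl, rfl⟩
    · rw [← hE π, SemilinearExpr.mem_toSet] at hv
      obtain ⟨p, hp, _⟩ := hv
      exact List.length_pos_of_mem hp
    · obtain ⟨q, _, rfl⟩ := List.mem_map.1 hp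
      refine ⟨by simp [C], fun b hb => ?_⟩
      obtain ⟨v, _, rfl⟩ := List.mem_map.1 hb
      simp [C]
  · obtain ⟨π', hπ', w', hw', hv, hwt⟩ := exists_minimal x y ss o ((hL π).2 ⟨hπ, hπy⟩)
      fun i => w i
    obtain ⟨j, hj, hjπ⟩ := List.getElem_of_mem ((hL' π').2 ⟨hπ', w', hw'⟩)
    have hw'' := (hmem π' (extend w')).1 (by
      have : (fun i : Fin (patDim x π') => extend w' i) = w' := by funext i; simp [extend]
      rwa [this])
    obtain ⟨p, hp, z, hz⟩ := hw''
    have hword : Piece.word (j, π', p.1, p.2) x y z = vecWord x y π' w' :=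
      patWord_congr _ _ fun i hi => (hz ⟨i, hi⟩).symm
    refine ⟨(j, π', p.1, p.2), mem_pieces.2 ⟨by simpa using hj, ?_, ?_⟩, z, ?_, ?_⟩
    · change π' = ((L'.map C).getD j ([], [], [], 0)).1
      rw [hget j hj, hjπ]
    · change p ∈ ((L'.map C).getD j ([], [], [], 0)).2.1
      rw [hget j hj, hjπ]
      exact hp
    · rw [hword, hv, ← patWord_eq_vecWord]
    · rw [hword, patWord_eq_vecWord]; exact hwt
  · obtain ⟨i, π, a, B⟩ := P
    obtain ⟨j, π', a', B'⟩ := Q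
    obtain ⟨hi, hiπ, hp⟩ := mem_pieces.1 hP
    obtain ⟨hj, hjπ, hp'⟩ := mem_pieces.1 hQ
    simp only [List.length_map] at hi hj
    simp only [hget i hi, hget j hj] at hiπ hjπ hp hp'
    have hiπ : π = L'[i] := hiπ
    have hjπ : π' = L'[j] := hjπ
    rw [← hiπ] at hp
    rw [← hjπ] at hp'
    have h1 : (fun i : Fin (patDim x π) => linPoint a B z i) ∈ S π :=
      (hmem π _).2 ⟨_, hp, z, fun _ => rfl⟩
    have h2 : (fun i : Fin (patDim x π') => linPoint a' B' z' i) ∈ S π' :=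
      (hmem π' _).2 ⟨_, hp', z', fun _ => rfl⟩
    have hπL : π ∈ L := ((hL' π).1 (hiπ ▸ List.getElem_mem _)).1
    have hπL' : π' ∈ L := ((hL' π').1 (hjπ ▸ List.getElem_mem _)).1
    simp only [Piece.word, patWord_eq_vecWord] at hv
    obtain ⟨rfl, h⟩ := minimal_unique x y ss o hπL hπL' h1.1 h1.2 h2.1 h2.2 hv
    refine ⟨(List.Nodup.getElem_inj_iff hnodup).1 (hiπ.symm.trans hjπ), fun i hi => ?_⟩
    exact congrFun h ⟨i, hi⟩

end

end VirtAbelian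

/-! ### The algorithm and its output -/

namespace VirtAbelian

/-- Search for an output together with a certificate. -/
def search (I : InputCode) : Part OutputCode :=
  Nat.rfindOpt fun n => (Encodable.decode (α := OutputCode × List Instr) n).bind fun p =>
    bif checkOutput I p.1 && (runCert (classGoals I p.1) p.2).length == 0 then some p.1 else none

theorem partrec_search : Partrec search := by
  refine Partrec.rfindOpt (Primrec.to_comp ?_)
  refine Primrec.option_bind (Primrec.decode.comp Primrec.snd) ?_
  have h1 : Primrec fun q : (InputCode × ℕ) × OutputCode × List Instr =>
      checkOutput q.1.1 q.2.1 && (runCert (classGoals q.1.1 q.2.1) q.2.2).length == 0 := by fun_prop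
  exact Primrec.cond h1 (Primrec.option_some.comp (Primrec.fst.comp Primrec.snd))
    (Primrec.const none)

theorem mem_search {I : InputCode} {o : OutputCode} (h : o ∈ search I) :
    checkOutput I o = true ∧ ∃ l, runCert (classGoals I o) l = [] := by
  obtain ⟨n, hn⟩ := Nat.rfindOpt_spec h
  obtain ⟨p, -, hp⟩ := Option.mem_bind_iff.1 hn
  by_cases hc : (checkOutput I p.1 && (runCert (classGoals I p.1) p.2).length == 0) = true
  · rw [hc, cond_true, Option.mem_some_iff] at hp
    subst hp
    simp only [Bool.and_eq_true, beq_iff_eq, List.length_eq_zero_iff] at hc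
    exact ⟨hc.1, _, hc.2⟩
  · rw [Bool.not_eq_true] at hc
    rw [hc, cond_false] at hp
    exact absurd hp (Option.not_mem_none _)

theorem exists_mem_search {I : InputCode} {o : OutputCode} {l : List Instr}
    (h : checkOutput I o = true) (hl : runCert (classGoals I o) l = []) :
    ∃ o', o' ∈ search I := by
  have : (search I).Dom := Nat.rfindOpt_dom.2 ⟨Encodable.encode (o, l), o, by
    rw [Encodable.encodek, Option.bind_some]
    simp only [h, hl]
    rfl⟩
  exact ⟨_, Part.get_mem this⟩

/-! #### Decoding an output -/

/-- The coercion inside `ClassData.code` and `OutputData.code` takes the form of a bind followed by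
an identity map; this brings it to `Fin.val`. -/
theorem map_val_eq {n : ℕ} (l : List (Fin n)) : (List.map (fun i => i) do
    let a ← l
    pure (a : ℕ)) = l.map Fin.val := by
  induction l <;> simp_all

theorem exists_map_eq {α β : Type*} {f : α → β} {l : List β} (h : ∀ b ∈ l, ∃ a, f a = b) :
    ∃ L : List α, L.map f = l := by
  have : l ∈ Set.range (List.map f) := by rw [Set.range_list_map]; exact h
  exact this

theorem exists_ofFn_eq {α : Type*} {m : ℕ} {l : List α} (h : l.length = m) :
    ∃ f : Fin m → α, List.ofFn f = l := by
  subst h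
  exact ⟨l.get, List.ofFn_get l⟩

/-- The search runs through untyped codes. The bounds and lengths demanded of a well-formed class
are what is needed to read its code as typed data. -/
theorem exists_classData {x y : List (List ℕ)} {o : ℕ → ℕ} {d : ℕ} {c : ClassCode}
    (h : WellFormedClass x y o d c) : ∃ C : ClassData x.length y.length, C.code = c := by
  obtain ⟨π, im, co, c₀⟩ := c
  obtain ⟨π, rfl⟩ := exists_map_val h.lt
  have hm : ∀ n, n = ((π.map fun i : Fin y.length => (i : ℕ)).length + 1) * x.length →
      n = patternDim x.length π := fun n hn => by rw [hn, List.length_map]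
  obtain ⟨f, hf⟩ := exists_ofFn_eq (l := co) (m := patternDim x.length π)
    (hm _ (by rw [show co = _ from h.coeff_eq]; simp))
  obtain ⟨E, hE⟩ : ∃ E : SemilinearExpr (patternDim x.length π), E.code = im := by
    refine exists_map_eq fun p hp => ?_
    obtain ⟨h1, h2⟩ := h.length_eq p hp
    obtain ⟨a, ha⟩ := exists_ofFn_eq (hm _ h1)
    obtain ⟨B, hB⟩ := exists_map_eq (f := List.ofFn) (l := p.2) fun b hb =>
      exists_ofFn_eq (hm _ (h2 b hb))
    exact ⟨(a, B), by rw [ha, hB]⟩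
  refine ⟨⟨π, E, f, c₀⟩, ?_⟩
  rw [ClassData.code, map_val_eq, hf]
  exact congrArg (fun e => (π.map Fin.val, e, co, c₀)) hE

theorem exists_outputData {k : ℕ} {x y : List (List ℕ)} {cls : List ClassCode} {o : ℕ → ℕ} {d : ℕ}
    (hxy : ∀ u ∈ x ++ y, ∀ a ∈ u, a < k) (h : ∀ c ∈ cls, WellFormedClass x y o d c) :
    ∃ O : OutputData k, O.code = ((x, y), cls) := by
  obtain ⟨X, hX⟩ := exists_ofFn_eq (l := x) rfl
  obtain ⟨Y, hY⟩ := exists_ofFn_eq (l := y) rfl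
  have hX' : ∀ i, ∃ u : List (Fin k), u.map (fun i : Fin k => (i : ℕ)) = X i := fun i =>
    exists_map_val (hxy _ (List.mem_append_left _ (by rw [← hX, List.mem_ofFn]; exact ⟨i, rfl⟩)))
  have hY' : ∀ i, ∃ u : List (Fin k), u.map (fun i : Fin k => (i : ℕ)) = Y i := fun i =>
    exists_map_val (hxy _ (List.mem_append_right _ (by rw [← hY, List.mem_ofFn]; exact ⟨i, rfl⟩)))
  choose X' hX' using hX'
  choose Y' hY' using hY'
  obtain ⟨C, hC⟩ := exists_map_eq fun c hc => exists_classData (h c hc)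
  refine ⟨⟨x.length, y.length, X', Y', C.length, C.get⟩, ?_⟩
  simp only [OutputData.code, map_val_eq]
  refine Prod.ext (Prod.ext ?_ ?_) ?_
  · exact (congrArg List.ofFn (funext hX')).trans hX
  · exact (congrArg List.ofFn (funext hY')).trans hY
  · rw [← hC]
    exact List.ext_getElem (by simp) fun i _ _ => by simp

/-! #### Patterned words -/

theorem flatMap_range {α : Type*} (f : ℕ → List α) (n : ℕ) :
    (List.range n).flatMap f = (List.ofFn fun i : Fin n => f i).flatten := by
  rw [List.flatMap]
  congr 1
  exact List.ext_getElem (by simp) fun i _ _ => by simp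

theorem map_powerBlock {k r : ℕ} (X : Fin r → List (Fin k)) (w : ℕ → ℕ) (l : ℕ)
    (v : Fin r → ℕ) (hv : ∀ i : Fin r, v i = w (l * r + i)) :
    (powerBlock X v).map Fin.val =
      powWord (List.ofFn fun i => (X i).map Fin.val) w l := by
  unfold powWord powerBlock
  rw [List.length_ofFn, flatMap_range, List.map_flatten, List.map_ofFn]
  congr 2
  funext i
  simp [hv, List.map_flatten, List.getD_eq_getElem?_getD]

theorem map_patternedWord {k r s : ℕ} (X : Fin r → List (Fin k)) (Y : Fin s → List (Fin k))
    (π : List (Fin s)) (v : Fin (patternDim r π) → ℕ) (w : ℕ → ℕ) (hv : ∀ i, v i = w i) :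
    (patternedWord X Y π v).map Fin.val =
      patWord (List.ofFn fun i => (X i).map Fin.val) (List.ofFn fun i => (Y i).map Fin.val)
        (π.map Fin.val) w := by
  unfold patWord patternedWord
  rw [List.length_map, flatMap_range, List.map_append, List.map_flatten, List.map_ofFn,
    map_powerBlock X w 0]
  · congr 3
    funext l
    rw [Function.comp_apply, List.map_append, map_powerBlock X w (l + 1)]
    · simp [List.getD_eq_getElem?_getD]
    · intro i
      rw [hv, finProdFinEquiv_apply_val]
      congr 1
      simp only [Fin.val_succ]
      ring
  · intro i
    rw [hv, finProdFinEquiv_apply_val]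
    simp

end VirtAbelian

/-! ### Good outputs describe geodesic normal forms -/

namespace VirtAbelian

section Final

variable {G : Type*} [Group G] {k : ℕ} (O : OutputData k)

/-- The word of class `j` with parameters `v`. -/
def OutputData.word (j : Fin O.numClasses)
    (v : Fin (patternDim O.r (O.cls j).pattern) → ℕ) : List (Fin k) :=
  patternedWord O.x O.y (O.cls j).pattern v

theorem OutputData.code_fst_fst : O.code.1.1 = List.ofFn fun i => (O.x i).map Fin.val := by
  simp only [OutputData.code, map_val_eq]

theorem OutputData.code_fst_snd : O.code.1.2 = List.ofFn fun i => (O.y i).map Fin.val := by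
  simp only [OutputData.code, map_val_eq]

theorem OutputData.code_snd : O.code.2 = List.ofFn fun j => (O.cls j).code := rfl

theorem OutputData.getD_code (j : Fin O.numClasses) :
    O.code.2.getD j ([], [], [], 0) = (O.cls j).code := by
  simp [OutputData.code_snd, List.getD_eq_getElem?_getD]

theorem ClassData.code_fst {r s : ℕ} (C : ClassData r s) : C.code.1 = C.pattern.map Fin.val := by
  simp only [ClassData.code, map_val_eq]

theorem OutputData.mem_pieces (P : Piece) : P ∈ pieces O.code.2 ↔
    ∃ j : Fin O.numClasses, ∃ p ∈ (O.cls j).image.code,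
      P = (↑j, (O.cls j).pattern.map Fin.val, p.1, p.2) := by
  rw [VirtAbelian.mem_pieces]
  constructor
  · rintro ⟨h1, h2, h3⟩
    have h1 : P.1 < O.numClasses := by simpa [OutputData.code_snd] using h1
    have := O.getD_code ⟨P.1, h1⟩
    simp only at this
    rw [this] at h2 h3
    rw [ClassData.code_fst] at h2
    exact ⟨⟨P.1, h1⟩, _, h3, by rw [← h2]⟩
  · rintro ⟨j, p, hp, rfl⟩
    refine ⟨by simp [OutputData.code_snd], ?_, ?_⟩
    · simp only [O.getD_code, ClassData.code_fst]
    · simp only [O.getD_code]; exact hp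

theorem OutputData.piece_word (j : Fin O.numClasses) (a : List ℕ) (B : List (List ℕ)) (z : ℕ → ℕ)
    (v : Fin (patternDim O.r (O.cls j).pattern) → ℕ) (hv : ∀ i, v i = linPoint a B z i) :
    Piece.word (↑j, (O.cls j).pattern.map Fin.val, a, B) O.code.1.1 O.code.1.2 z =
      (O.word j v).map Fin.val := by
  rw [OutputData.word, map_patternedWord O.x O.y _ v _ hv, O.code_fst_fst, O.code_fst_snd]
  rfl

variable {O} {A : Subgroup G} {σ : Fin k → G} {o : ℕ → ℕ} {ω : Fin k → ℕ}

theorem val_word (u : List (Fin k)) : val (letters σ) (u.map Fin.val) = wordValue σ u :=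
  val_letters σ u

theorem image_getD_eq {r : ℕ} (x : Fin r → List (Fin k)) {i : ℕ} (hi : i < r) :
    (List.ofFn fun i => (x i).map Fin.val).getD i [] = (x ⟨i, hi⟩).map Fin.val := by
  simp [List.getD_eq_getElem?_getD, hi]

theorem range_words (p : G → Prop) {r : ℕ} {x : Fin r → List (Fin k)}
    (h1 : ∀ i, x i ∈ shortWords A k ∧ p (wordValue σ (x i)))
    (h2 : ∀ u ∈ shortWords A k, p (wordValue σ u) → ∃ i, wordValue σ (x i) = wordValue σ u) :
    Set.range (fun i => wordValue σ (x i)) = extendedGenSet A σ ∩ {g | p g} := by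
  ext g
  constructor
  · rintro ⟨i, rfl⟩
    exact ⟨⟨_, (h1 i).1, rfl⟩, (h1 i).2⟩
  · rintro ⟨⟨u, hu, rfl⟩, hp⟩
    exact h2 u hu hp

theorem GoodWords.words (hW : GoodWords A (letters σ) o k O.code.1.1 O.code.1.2) :
    ((∀ i, O.x i ∈ shortWords A k) ∧
      Function.Injective (fun i => wordValue σ (O.x i)) ∧
      Set.range (fun i => wordValue σ (O.x i)) = extendedGenSet A σ ∩ (A : Set G)) ∧
    ((∀ i, O.y i ∈ shortWords A k) ∧
      Function.Injective (fun i => wordValue σ (O.y i)) ∧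
      Set.range (fun i => wordValue σ (O.y i)) = extendedGenSet A σ \ (A : Set G)) := by
  obtain ⟨h1, h2, h3, h4, h5, h6⟩ := hW
  rw [O.code_fst_fst] at h1 h2 h4 h6
  rw [O.code_fst_snd] at h1 h3 h5 h6
  have hxm : ∀ i, (O.x i).map Fin.val ∈ List.ofFn fun i => (O.x i).map Fin.val := fun i =>
    (List.mem_ofFn).2 ⟨i, rfl⟩
  have hym : ∀ i, (O.y i).map Fin.val ∈ List.ofFn fun i => (O.y i).map Fin.val := fun i =>
    (List.mem_ofFn).2 ⟨i, rfl⟩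
  have hxs : ∀ i, O.x i ∈ shortWords A k := fun i => by
    have := (h1 _ (List.mem_append_left _ (hxm i))).2
    rwa [List.length_map] at this
  have hys : ∀ i, O.y i ∈ shortWords A k := fun i => by
    have := (h1 _ (List.mem_append_right _ (hym i))).2
    rwa [List.length_map] at this
  have hxA : ∀ i, wordValue σ (O.x i) ∈ A := fun i => by
    have := h2 _ (hxm i); rwa [val_word] at this
  have hyA : ∀ i, wordValue σ (O.y i) ∉ A := fun i => by
    have := h3 _ (hym i); rwa [val_word] at this
  have hcov : ∀ u ∈ shortWords A k, (∃ i, wordValue σ (O.x i) = wordValue σ u) ∨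
      ∃ i, wordValue σ (O.y i) = wordValue σ u := fun u hu => by
    obtain ⟨v, hv, hvu, -⟩ := h6 (u.map Fin.val) (by simp)
      (by simpa using hu.1) (by simpa using hu.2)
    rw [val_word] at hvu
    rcases List.mem_append.1 hv with hv | hv
    · obtain ⟨i, rfl⟩ := List.mem_ofFn.1 hv
      exact Or.inl ⟨i, by rwa [val_word] at hvu⟩
    · obtain ⟨i, rfl⟩ := List.mem_ofFn.1 hv
      exact Or.inr ⟨i, by rwa [val_word] at hvu⟩
  refine ⟨⟨hxs, fun i j hij => ?_, ?_⟩, hys, fun i j hij => ?_, ?_⟩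
  · refine Fin.ext (h4 i (by simp) j (by simp) ?_)
    rw [image_getD_eq _ i.2, image_getD_eq _ j.2, val_word, val_word]
    exact hij
  · refine range_words (fun g => g ∈ A) (fun i => ⟨hxs i, hxA i⟩) fun u hu hA => ?_
    refine (hcov u hu).resolve_right ?_
    rintro ⟨i, hi⟩
    exact hyA i (hi ▸ hA)
  · refine Fin.ext (h5 i (by simp) j (by simp) ?_)
    rw [image_getD_eq _ i.2, image_getD_eq _ j.2, val_word, val_word]
    exact hij
  · refine range_words (fun g => g ∉ A) (fun i => ⟨hys i, hyA i⟩) fun u hu hA => ?_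
    refine (hcov u hu).resolve_left ?_
    rintro ⟨i, hi⟩
    exact hA (hi ▸ hxA i)

theorem GoodClasses.unique (hC : GoodClasses (letters σ) o A.index O.code.1.1 O.code.1.2 O.code.2)
    {i j : Fin O.numClasses} {v : Fin (patternDim O.r (O.cls i).pattern) → ℕ}
    {w : Fin (patternDim O.r (O.cls j).pattern) → ℕ} (hv : v ∈ (O.cls i).image.toSet)
    (hw : w ∈ (O.cls j).image.toSet)
    (h : wordValue σ (O.word i v) = wordValue σ (O.word j w)) : ∃ e : i = j, e ▸ v = w := by
  obtain ⟨p, hp, z, hz⟩ := (SemilinearExpr.mem_toSet _ _).1 hv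
  obtain ⟨q, hq, z', hz'⟩ := (SemilinearExpr.mem_toSet _ _).1 hw
  obtain ⟨e, h'⟩ := hC.sep _ ((O.mem_pieces _).2 ⟨i, p, hp, rfl⟩) _
    ((O.mem_pieces _).2 ⟨j, q, hq, rfl⟩) z z' (by
      rw [O.piece_word i _ _ z v hz, O.piece_word j _ _ z' w hz', val_word, val_word, h])
  obtain rfl : i = j := Fin.ext e
  refine ⟨rfl, funext fun t => ?_⟩
  change v t = w t
  rw [hz, hz']
  refine h' t ?_
  rw [List.length_map, O.code_fst_fst, List.length_ofFn]
  exact t.2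

theorem GoodClasses.cls_pattern_injective
    (hC : GoodClasses (letters σ) o A.index O.code.1.1 O.code.1.2 O.code.2) :
    Function.Injective fun j => (O.cls j).pattern := fun i j hij =>
  Fin.ext (hC.pattern_inj i (by simp [OutputData.code_snd]) j (by simp [OutputData.code_snd]) (by
    rw [O.getD_code, O.getD_code, ClassData.code_fst, ClassData.code_fst]
    exact congrArg _ hij))

theorem GoodClasses.cls_pattern_length
    (hC : GoodClasses (letters σ) o A.index O.code.1.1 O.code.1.2 O.code.2)
    (j : Fin O.numClasses) : (O.cls j).pattern.length ≤ A.index := by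
  have hj := hC.wf (O.cls j).code (by rw [O.code_snd, List.mem_ofFn]; exact ⟨j, rfl⟩)
  have := hj.length_le
  rwa [ClassData.code_fst, List.length_map] at this

theorem GoodClasses.word_eq
    (hC : GoodClasses (letters σ) o A.index O.code.1.1 O.code.1.2 O.code.2)
    {i j : Fin O.numClasses} {v : Fin (patternDim O.r (O.cls i).pattern) → ℕ}
    {w : Fin (patternDim O.r (O.cls j).pattern) → ℕ} (hv : v ∈ (O.cls i).image.toSet)
    (hw : w ∈ (O.cls j).image.toSet)
    (h : wordValue σ (O.word i v) = wordValue σ (O.word j w)) : O.word i v = O.word j w := by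
  obtain ⟨rfl, rfl⟩ := hC.unique hv hw h
  rfl

/-- Reduction to a patterned word followed by domination. -/
theorem GoodClasses.exists_word_le [A.Normal] (hA : ∀ a ∈ A, ∀ b ∈ A, a * b = b * a)
    (hfin : A.index ≠ 0) (hW : GoodWords A (letters σ) o k O.code.1.1 O.code.1.2)
    (hC : GoodClasses (letters σ) o A.index O.code.1.1 O.code.1.2 O.code.2)
    (hω : ∀ u : List (Fin k), weight o (u.map Fin.val) = wordWeight ω u) (u : List (Fin k)) :
    ∃ j, ∃ v ∈ (O.cls j).image.toSet, wordValue σ (O.word j v) = wordValue σ u ∧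
      wordWeight ω (O.word j v) ≤ wordWeight ω u := by
  obtain ⟨π, w, hπ, hlen, hval, hwt⟩ := exists_patWord_le hA hfin hW.mem hW.notMem hW.cover
    (u.map Fin.val) (by simp)
  obtain ⟨P, hP, z, hz, hzw⟩ := hC.dom π hlen hπ w
  obtain ⟨j, p, hp, rfl⟩ := (O.mem_pieces _).1 hP
  have e := O.piece_word j p.1 p.2 z (fun i => linPoint p.1 p.2 z i) fun _ => rfl
  rw [e, hval, val_word, val_word] at hz
  rw [e, hω] at hzw
  rw [hω] at hwt
  exact ⟨j, _, (SemilinearExpr.mem_toSet _ _).2 ⟨p, hp, z, fun _ => rfl⟩, hz, hzw.trans hwt⟩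

theorem GoodClasses.weight_word
    (hC : GoodClasses (letters σ) o A.index O.code.1.1 O.code.1.2 O.code.2)
    (hω : ∀ u : List (Fin k), weight o (u.map Fin.val) = wordWeight ω u) (j : Fin O.numClasses)
    (v : Fin (patternDim O.r (O.cls j).pattern) → ℕ) :
    wordWeight ω (O.word j v) = (∑ i, (O.cls j).coeff i * v i) + (O.cls j).const := by
  have hj := hC.wf (O.cls j).code (by rw [O.code_snd, List.mem_ofFn]; exact ⟨j, rfl⟩)
  have hcoeff := hj.coeff_eq
  have hconst := hj.const_eq
  rw [ClassData.code_fst, List.length_map] at hcoeff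
  rw [ClassData.code_fst, getD_nil_fun] at hconst
  rw [← hω, OutputData.word, map_patternedWord O.x O.y _ v (extend v) fun i => by simp [extend],
    ← O.code_fst_fst, ← O.code_fst_snd, weight_patWord, ← hconst, add_comm, List.length_map]
  have hr : O.code.1.1.length = O.r := by rw [O.code_fst_fst, List.length_ofFn]
  congr 1
  rw [hr] at hcoeff ⊢
  rw [Finset.sum_range]
  refine Finset.sum_congr rfl fun i _ => ?_
  have h1 : (List.ofFn (O.cls j).coeff).getD i 0 = (O.cls j).coeff i := getD_ofFn _ i
  have h2 : List.ofFn (O.cls j).coeff = _ := hcoeff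
  rw [← h1, h2, mul_comm]
  congr 1
  · simp [List.getD_eq_getElem?_getD]
  · simp [extend]

/-- The normal form consists of all words of all classes. Every element is reached by domination,
and exactly once by separation. -/
theorem exists_geodesicNormalForm [A.Normal] (hA : ∀ a ∈ A, ∀ b ∈ A, a * b = b * a)
    (hfin : A.index ≠ 0) (hgen : Submonoid.closure (Set.range σ) = ⊤)
    (hW : GoodWords A (letters σ) o k O.code.1.1 O.code.1.2)
    (hC : GoodClasses (letters σ) o A.index O.code.1.1 O.code.1.2 O.code.2)
    (hω : ∀ u : List (Fin k), weight o (u.map Fin.val) = wordWeight ω u) :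
    ∃ (μ : G → List (Fin k)) (U : Fin O.numClasses → Set (List (Fin k))),
      IsGeodesicNormalForm σ ω μ ∧
      (∀ j, (U j).Nonempty) ∧
      Pairwise (fun i j => Disjoint (U i) (U j)) ∧
      (⋃ j, U j) = Set.range μ ∧
      ∀ j, ∃ φ : U j → (Fin (patternDim O.r (O.cls j).pattern) → ℕ),
        Function.Injective φ ∧
        (∀ u : U j,
          patternedWord O.x O.y (O.cls j).pattern (φ u) = (u : List (Fin k))) ∧
        Set.range φ = (O.cls j).image.toSet ∧
        (∀ u : U j, wordWeight ω (u : List (Fin k)) =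
          (∑ i, (O.cls j).coeff i * φ u i) + (O.cls j).const) := by
  have hword : ∀ g : G, ∃ u, wordValue σ u = g := fun g => by
    obtain ⟨l, hl, rfl⟩ := Submonoid.exists_list_of_mem_closure
      (show g ∈ Submonoid.closure (Set.range σ) by rw [hgen]; trivial)
    obtain ⟨u, rfl⟩ := exists_map_eq hl
    exact ⟨u, rfl⟩
  have hrep : ∀ g : G, ∃ j, ∃ v ∈ (O.cls j).image.toSet, wordValue σ (O.word j v) = g := fun g => by
    obtain ⟨u, rfl⟩ := hword g
    obtain ⟨j, v, hv, h, -⟩ := hC.exists_word_le hA hfin hW hω u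
    exact ⟨j, v, hv, h⟩
  choose J V hV hJ using hrep
  -- By uniqueness, the word chosen for the value of a class word is that word itself, so the range
  -- of the normal form is the whole union of the classes.
  have heq : ∀ j, ∀ v ∈ (O.cls j).image.toSet,
      O.word (J (wordValue σ (O.word j v))) (V (wordValue σ (O.word j v))) = O.word j v :=
    fun j v hv => hC.word_eq (hV _) hv (hJ _)
  refine ⟨fun g => O.word (J g) (V g), fun j => {u | ∃ v ∈ (O.cls j).image.toSet, O.word j v = u},
    fun g => ⟨hJ g, fun u hu => ?_⟩, fun j => ?_, fun i j hij => ?_, ?_, fun j => ?_⟩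
  · obtain ⟨j, v, hv, h1, h2⟩ := hC.exists_word_le hA hfin hW hω u
    -- The class word that dominates `u` has the same value as the chosen word and hence equals it,
    -- so the chosen word is geodesic.
    have := hC.word_eq hv (hV g) (h1.trans hu)
    change wordWeight ω (O.word (J g) (V g)) ≤ _
    rwa [← this]
  · have hj := hC.wf (O.cls j).code (by rw [O.code_snd, List.mem_ofFn]; exact ⟨j, rfl⟩)
    obtain ⟨p, hp⟩ := List.exists_mem_of_length_pos hj.nonempty
    exact ⟨_, _, (SemilinearExpr.mem_toSet _ _).2 ⟨p, hp, 0, fun _ => rfl⟩, rfl⟩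
  · refine Set.disjoint_left.2 ?_
    rintro _ ⟨v, hv, rfl⟩ ⟨w, hw, h⟩
    exact hij (hC.unique hv hw (by rw [h])).1
  · ext u
    simp only [Set.mem_iUnion, Set.mem_range]
    constructor
    · rintro ⟨j, v, hv, rfl⟩
      exact ⟨_, heq j v hv⟩
    · rintro ⟨g, rfl⟩
      exact ⟨J g, V g, hV g, rfl⟩
  · choose φ hφ hφu using fun u : {u | ∃ v ∈ (O.cls j).image.toSet, O.word j v = u} => u.2
    refine ⟨φ, fun u u' h => ?_, hφu, ?_, fun u => ?_⟩
    · exact Subtype.ext (by rw [← hφu u, ← hφu u', h])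
    · ext v
      constructor
      · rintro ⟨u, rfl⟩
        exact hφ u
      · intro hv
        refine ⟨⟨O.word j v, v, hv, rfl⟩, ?_⟩
        obtain ⟨_, h⟩ := hC.unique (hφ ⟨O.word j v, v, hv, rfl⟩) hv (by rw [hφu])
        exact h
    · rw [← hC.weight_word hω, hφu]

end Final

end VirtAbelian

theorem mainTheorem2 :
    ∃ alg : VirtAbelian.InputCode →. VirtAbelian.OutputCode, Partrec alg ∧
      ∀ (G : Type*) [Group G] (D : VirtAbelian.Description G) (k : ℕ)
        (gen : Fin k → VirtAbelian.NormalForm D.rank D.numT) (ω : Fin k → ℕ)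
        (σ : Fin k → G),
        (∀ i, σ i = VirtAbelian.nfValue D.b D.t (gen i)) →
        Submonoid.closure (Set.range σ) = ⊤ →
        (∀ i, 0 < ω i) →
        ∃ O : VirtAbelian.OutputData k,
          O.code ∈ alg (D.inputCode gen ω) ∧
          -- `x₁, …, x_r` are words for the elements of `S ∩ A`, without repetition
          ((∀ i, O.x i ∈ VirtAbelian.shortWords D.A k) ∧
            Function.Injective (fun i => VirtAbelian.wordValue σ (O.x i)) ∧
            Set.range (fun i => VirtAbelian.wordValue σ (O.x i)) =
              VirtAbelian.extendedGenSet D.A σ ∩ (D.A : Set G)) ∧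
          -- `y₁, …, y_s` are words for the elements of `S \ A`, without repetition
          ((∀ i, O.y i ∈ VirtAbelian.shortWords D.A k) ∧
            Function.Injective (fun i => VirtAbelian.wordValue σ (O.y i)) ∧
            Set.range (fun i => VirtAbelian.wordValue σ (O.y i)) =
              VirtAbelian.extendedGenSet D.A σ \ (D.A : Set G)) ∧
          -- the patterns are distinct words in `y₁, …, y_s` of length at most `[G : A]`
          (Function.Injective fun j => (O.cls j).pattern) ∧
          (∀ j, (O.cls j).pattern.length ≤ D.A.index) ∧
          ∃ (μ : G → List (Fin k)) (U : Fin O.numClasses → Set (List (Fin k))),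
            VirtAbelian.IsGeodesicNormalForm σ ω μ ∧
            -- the classes partition the image of the normal form
            (∀ j, (U j).Nonempty) ∧
            Pairwise (fun i j => Disjoint (U i) (U j)) ∧
            (⋃ j, U j) = Set.range μ ∧
            ∀ j, ∃ φ : U j → (Fin (VirtAbelian.patternDim O.r (O.cls j).pattern) → ℕ),
              Function.Injective φ ∧
              (∀ u : U j,
                VirtAbelian.patternedWord O.x O.y (O.cls j).pattern (φ u) = (u : List (Fin k))) ∧
              Set.range φ = (O.cls j).image.toSet ∧
              (∀ u : U j, VirtAbelian.wordWeight ω (u : List (Fin k)) =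
                (∑ i, (O.cls j).coeff i * φ u i) + (O.cls j).const) := by
  refine ⟨VirtAbelian.search, VirtAbelian.partrec_search, ?_⟩
  intro G _ D k gen ω σ hσ hgen _
  obtain rfl : σ = fun i => VirtAbelian.nfValue D.b D.t (gen i) := funext hσ
  have := D.normal
  obtain ⟨x, y, hW⟩ := VirtAbelian.exists_goodWords D.A
    (VirtAbelian.letters fun i => VirtAbelian.nfValue D.b D.t (gen i))
    (VirtAbelian.letterWeights (D.inputCode gen ω)) k
  obtain ⟨cls, hC⟩ := VirtAbelian.exists_goodClasses D gen ω
    (fun u hu => (hW.short u hu).1) hW.mem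
  -- A good output and a certificate for it exist, so the search halts.
  obtain ⟨hcheck, l, hl⟩ := (VirtAbelian.check_iff D gen ω ((x, y), cls)).2 ⟨hW, hC⟩
  obtain ⟨o, ho⟩ := VirtAbelian.exists_mem_search hcheck hl
  -- The output found may differ from the one constructed, but it has passed the same check and is
  -- therefore good.
  obtain ⟨hW, hC⟩ := (VirtAbelian.check_iff D gen ω o).1 (VirtAbelian.mem_search ho)
  obtain ⟨O, hO⟩ := VirtAbelian.exists_outputData (fun u hu => (hW.short u hu).1) hC.wf
  obtain rfl : O.code = o := hO
  obtain ⟨hx, hy⟩ := hW.words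
  have hA : ∀ a ∈ D.A, ∀ b ∈ D.A, a * b = b * a := by
    intro a ha b hb
    obtain ⟨z, rfl⟩ := D.exists_avec ha
    obtain ⟨z', rfl⟩ := D.exists_avec hb
    rw [← D.avec_add, ← D.avec_add, add_comm]
  have hfin : D.A.index ≠ 0 := by
    rw [D.index_eq]
    exact D.numT_pos.ne'
  refine ⟨O, ho, hx, hy, hC.cls_pattern_injective, hC.cls_pattern_length, ?_⟩
  exact VirtAbelian.exists_geodesicNormalForm hA hfin hgen hW hC
    (VirtAbelian.weight_letterWeights D gen ω)
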